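/- Consider the fourth Painlevé equation $$y''=\frac{(y')^2}{2y}+\frac32y^3+4xy^2+2\Bigl(x^2-2\alpha+\frac{\beta}{2}\Bigr)y-\frac{\beta^2}{2y}\qquad(\mathrm{P4})$$ (understood after multiplication by $2y$, so that $y\equiv0$ is a solution when $\beta=0$). A solution meromorphic in $\mathbb C$ is called classical if it solves a Riccati equation $y'=\sigma(y^2+2xy)+q$ with $\sigma^2=1$, $2\alpha-\frac\beta2=-\sigma(\frac q2+1)$, $\beta^2=q^2$, or is $y\equiv 0$ (with $\beta=0$), or is obtained from such solutions by finitely many of the Bäcklund transformations $$R_0^{+}[y]=y+\frac{2(1+2\alpha)y}{y'-y^2-2xy-\beta},\qquad R_0^{-}[y]=y+\frac{2(1-2\alpha)y}{y'+y^2+2xy+\beta},\qquad R_\infty^{\pm}[y]=\pm\frac{y'}{2y}-\frac y2-x+\frac{\beta}{2y}$$ (denominators not identically zero), which change $(\alpha,\beta)$ to $(-\alpha\mp1,\,-2\alpha+\beta\mp1)$ for $R_0^\pm$ and to $(-\alpha,\,-2\alpha+\beta\mp1)$ for $R_\infty^\pm$. Let $\Theta(t)=0,\frac12,1$ for $t<0$,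 $t=0$, $t>0$, and take $\arg x\in(-\frac\pi4,\frac{7\pi}4)$ in the formulas below. Conventions. All relations hold as $|x|\to\infty$, uniformly in closed subsectors of the indicated open sectors. A background of type $L\in\{\frac{\beta}{2x},-\frac{\beta}{2x},-2x\}$ is a system of solutions $B_j$, $j\in\mathbb Z$, of (P4), independent of the parameter $c$, such that $B_j=L(1+O(x^{-2}))$ for $\arg x\in(\frac{\pi}{2}j-\frac{3\pi}4,\frac\pi2j+\frac\pi4)$. In the sector $|\arg x-\frac\pi2k|<\frac\pi4$, $k\in\{0,1,2,3\}$, the relation $$y=L(1+O(x^{-2}))+\mu\,x^{\kappa}e^{-(-1)^kx^2}(1+O(x^{-2}))$$ means that the first term is exactly $B_k$ for $\arg x<\frac\pi2k$, exactly $B_{k+1}$ for $\arg x>\frac\pi2k$, and $\frac12(B_k+B_{k+1})$ for $\arg x=\frac\pi2k$ (on this ray the second term is understood as $x^\kappa e^{-(-1)^kx^2}(\mu+O(x^{-2}))$); the relation $y=L(1+O(x^{-2}))$ means that in addition there is no exponentially small term, i.e. $y=B_k=B_{k+1}$. Theorem. Let $\alpha=\frac12+n$, $\beta=2m$ with integers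 $0\le m\le n$. There exist backgrounds of the three types $\frac{\beta}{2x}$, $-\frac{\beta}{2x}$, $-2x$, and two families of classical solutions of (P4), each parametrized by $c\in\mathbb C\cup\{\infty\}$ (distinct $c$ give distinct solutions, except that the second family is trivial if $m=0$), such that the following holds. 1. First family. i) For $\arg x\in(-\frac\pi4,\frac\pi4)$ and $c\in\mathbb C$: $y=\frac{\beta}{2x}(1+O(x^{-2}))+\mu_1x^{2n-4m}e^{-x^2}(1+O(x^{-2}))$, $\mu_1=-c(-1)^m2^{n-2m+1}\frac{m!}{(n-m)!}$; for $c=\infty$: $y=-2x(1+O(x^{-2}))$. ii) For $\arg x\in(\frac\pi4,\frac{3\pi}4)$: if $c\ne0$, $y=-2x(1+O(x^{-2}))+\mu_2x^{4n-2m+2}e^{x^2}(1+O(x^{-2}))$, $\mu_2=\bigl(\frac1c+2\sqrt\pi\,\Theta(\arg x-\frac\pi2)\bigr)(-1)^m\frac{2^{2n-m+1}}{n!\,(n-m)!}$; if $c=0$, $y=\frac{\beta}{2x}(1+O(x^{-2}))$. iii) For $\arg x\in(\frac{3\pi}4,\frac{5\pi}4)$: if $1+2\sqrt\pi c\ne0$,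 $y=\frac{\beta}{2x}(1+O(x^{-2}))+\mu_3x^{2n-4m}e^{-x^2}(1+O(x^{-2}))$, $\mu_3=-\frac{c}{1+2\sqrt\pi c}(-1)^m2^{n-2m+1}\frac{m!}{(n-m)!}$; if $1+2\sqrt\pi c=0$, $y=-2x(1+O(x^{-2}))$. iv) For $\arg x\in(\frac{5\pi}4,\frac{7\pi}4)$: if $c\ne0$, $y=-2x(1+O(x^{-2}))+\mu_4x^{4n-2m+2}e^{x^2}(1+O(x^{-2}))$, $\mu_4=\bigl(\frac1c+2\sqrt\pi\,\Theta(\frac{3\pi}2-\arg x)\bigr)(-1)^m\frac{2^{2n-m+1}}{n!\,(n-m)!}$; if $c=0$, $y=\frac{\beta}{2x}(1+O(x^{-2}))$. For $c=\infty$, one puts $\frac1c=0$ in ii), iv) and $\frac{c}{1+2\sqrt\pi c}=\frac1{2\sqrt\pi}$ in iii). 2. Second family. If $m=0$, all its members are $y\equiv0$. If $m\ge1$: i) For $\arg x\in(-\frac\pi4,\frac\pi4)$ and $c\in\mathbb C$: $y=-\frac{\beta}{2x}(1+O(x^{-2}))+\mu_1x^{2n+2m}e^{-x^2}(1+O(x^{-2}))$,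 $\mu_1=-\bigl(c+i\sqrt\pi\,\Theta(\arg x)\bigr)\frac{2^{n+m+1}}{n!\,(m-1)!}$; for $c=\infty$: $y=\frac{\beta}{2x}(1+O(x^{-2}))$. ii) For $\arg x\in(\frac\pi4,\frac{3\pi}4)$ and $c\in\mathbb C$: if $c+i\sqrt\pi\ne0$, $y=\frac{\beta}{2x}(1+O(x^{-2}))+\mu_2x^{4m-2n-2}e^{x^2}(1+O(x^{-2}))$, $\mu_2=\frac{1}{c+i\sqrt\pi}(-1)^m2^{2m-n-1}\frac{(n-m)!}{(m-1)!}$; if $c+i\sqrt\pi=0$, $y=-\frac{\beta}{2x}(1+O(x^{-2}))$. iii) For $\arg x\in(\frac{3\pi}4,\frac{5\pi}4)$: if $c\ne\infty$, $y=-\frac{\beta}{2x}(1+O(x^{-2}))+\mu_3x^{2n+2m}e^{-x^2}(1+O(x^{-2}))$, $\mu_3=-\bigl(c+i\sqrt\pi\,\Theta(\pi-\arg x)\bigr)\frac{2^{n+m+1}}{n!\,(m-1)!}$; if $c=\infty$, $y=\frac{\beta}{2x}(1+O(x^{-2}))$. iv) For $\arg x\in(\frac{5\pi}4,\frac{7\pi}4)$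 and $c\in\mathbb C$: if $c\ne0$, $y=\frac{\beta}{2x}(1+O(x^{-2}))+\mu_4x^{4m-2n-2}e^{x^2}(1+O(x^{-2}))$, $\mu_4=\frac1c(-1)^m2^{2m-n-1}\frac{(n-m)!}{(m-1)!}$; if $c=0$, $y=-\frac{\beta}{2x}(1+O(x^{-2}))$. For $c=\infty$, $y=\frac{\beta}{2x}(1+O(x^{-2}))$ also in ii) and iv). -/

import Mathlib

namespace PIV

/-- `y` is a (global, meromorphic) solution of the fourth Painlevé equation
`y'' = y'^2/(2y) + (3/2) y^3 + 4 x y^2 + 2 (x^2 - a) y - b/(2y)` with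
`a = 2α - β/2`, `b = β^2`.  The equation is multiplied by `2y`, so that it makes sense at the zeros
of `y` and for the trivial solution `y ≡ 0` when `β = 0`.  The normal form requirement only fixes
the values of `y` at its poles and at removable singularities. -/
def IsSolution (α β : ℂ) (y : ℂ → ℂ) : Prop :=
  MeromorphicNFOn y Set.univ ∧
    ∀ x : ℂ, AnalyticAt ℂ y x →
      2 * y x * deriv (deriv y) x =
        (deriv y x) ^ 2 + 3 * (y x) ^ 4 + 8 * x * (y x) ^ 3
          + 4 * (x ^ 2 - (2 * α - β / 2)) * (y x) ^ 2 - β ^ 2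

/-- Classical solutions for the parameters `(α, β)`: the meromorphic solutions of the Riccati
equations `y' = σ (y^2 + 2 x y) + q`, `σ^2 = 1` (whose parameters are `a = -σ (q/2 + 1)`,
`b = q^2`), the trivial solution `y ≡ 0` for `β = 0`, and everything obtained from them by the four
basic Bäcklund transformations, each applied only where its denominator does not vanish
identically. -/
inductive IsClassical : ℂ → ℂ → (ℂ → ℂ) → Prop
  | riccati (α β σ q : ℂ) (y : ℂ → ℂ) (hσ : σ ^ 2 = 1)
      (ha : 2 * α - β / 2 = -σ * (q / 2 + 1)) (hb : β ^ 2 = q ^ 2)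
      (hy : MeromorphicNFOn y Set.univ)
      (hric : ∀ x : ℂ, AnalyticAt ℂ y x → deriv y x = σ * ((y x) ^ 2 + 2 * x * y x) + q) :
      IsClassical α β y
  | zero (α : ℂ) : IsClassical α 0 (fun _ => 0)
  | zeroPlus (α β : ℂ) (y z : ℂ → ℂ) (h : IsClassical α β y)
      (hne : ∃ x : ℂ, AnalyticAt ℂ y x ∧ deriv y x - (y x) ^ 2 - 2 * x * y x - β ≠ 0)
      (hz : MeromorphicNFOn z Set.univ)
      (hzy : z =ᶠ[Filter.codiscrete ℂ] fun x =>
        y x + 2 * (1 + 2 * α) * y x / (deriv y x - (y x) ^ 2 - 2 * x * y x - β)) :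
      IsClassical (-α - 1) (-2 * α + β - 1) z
  | zeroMinus (α β : ℂ) (y z : ℂ → ℂ) (h : IsClassical α β y)
      (hne : ∃ x : ℂ, AnalyticAt ℂ y x ∧ deriv y x + (y x) ^ 2 + 2 * x * y x + β ≠ 0)
      (hz : MeromorphicNFOn z Set.univ)
      (hzy : z =ᶠ[Filter.codiscrete ℂ] fun x =>
        y x + 2 * (1 - 2 * α) * y x / (deriv y x + (y x) ^ 2 + 2 * x * y x + β)) :
      IsClassical (-α + 1) (-2 * α + β + 1) z
  | inftyPlus (α β : ℂ) (y z : ℂ → ℂ) (h : IsClassical α β y)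
      (hne : ∃ x : ℂ, AnalyticAt ℂ y x ∧ y x ≠ 0)
      (hz : MeromorphicNFOn z Set.univ)
      (hzy : z =ᶠ[Filter.codiscrete ℂ] fun x =>
        deriv y x / (2 * y x) - y x / 2 - x + β / (2 * y x)) :
      IsClassical (-α) (-2 * α + β - 1) z
  | inftyMinus (α β : ℂ) (y z : ℂ → ℂ) (h : IsClassical α β y)
      (hne : ∃ x : ℂ, AnalyticAt ℂ y x ∧ y x ≠ 0)
      (hz : MeromorphicNFOn z Set.univ)
      (hzy : z =ᶠ[Filter.codiscrete ℂ] fun x =>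
        -(deriv y x / (2 * y x)) - y x / 2 - x + β / (2 * y x)) :
      IsClassical (-α) (-2 * α + β + 1) z

/-- The step function with value `1/2` at the jump. -/
noncomputable def Θ (t : ℝ) : ℂ := if t < 0 then 0 else if t = 0 then 1 / 2 else 1

/-- The point of modulus `r` and argument `θ`. -/
noncomputable def pt (r θ : ℝ) : ℂ := (r : ℂ) * Complex.exp ((θ : ℂ) * Complex.I)

/-- `y = L (1 + O(x⁻²))` as `|x| → ∞` in the open sector `a < arg x < b`, uniformly in closed
subsectors. -/
def AsympOn (a b : ℝ) (L y : ℂ → ℂ) : Prop :=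
  ∀ s t : ℝ, a < s → t < b → ∃ C R : ℝ, ∀ r θ : ℝ, R ≤ r → s ≤ θ → θ ≤ t →
    ∃ δ : ℂ, ‖δ‖ ≤ C / r ^ 2 ∧ y (pt r θ) = L (pt r θ) * (1 + δ)

/-- `B` is a system of backgrounds of the type `L`: `B j` is a solution with
`B j = L (1 + O(x⁻²))`, without exponential terms, in the two neighbouring sectors of opening `π/2`
centred at the directions `(j-1)π/2` and `jπ/2`, including their common boundary ray.  (In the
quadrant `(j-1)π/2 < arg x < jπ/2` this is the sum of the formal series solution starting
with `L`.) -/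
def IsBackground (α β : ℂ) (L : ℂ → ℂ) (B : ℤ → ℂ → ℂ) : Prop :=
  ∀ j : ℤ, IsSolution α β (B j) ∧
    AsympOn ((j : ℝ) * (Real.pi / 2) - 3 * Real.pi / 4) ((j : ℝ) * (Real.pi / 2) + Real.pi / 4)
      L (B j)

/-- The exponential monomial `x^κ e^{-x²}` (`k` even) or `x^κ e^{x²}` (`k` odd), which is small in
the sector of opening `π/2` centred at the direction `kπ/2`. -/
noncomputable def expMonomial (k κ : ℤ) (x : ℂ) : ℂ :=
  x ^ κ * Complex.exp (-((-1 : ℂ) ^ k * x ^ 2))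

/-- In the sector `kπ/2 - π/4 < arg x < kπ/2 + π/4`,
`y = L (1 + O(x⁻²)) + μ(arg x) x^κ e^{∓x²} (1 + O(x⁻²))`, uniformly in closed subsectors.
The first term is the background `B k` for `arg x < kπ/2`, the background `B (k+1)` for
`arg x > kπ/2`, and their arithmetic mean on the Stokes ray `arg x = kπ/2`; the coefficient `μ` may
jump there. On the Stokes ray the exponential term is `x^κ e^{∓x²} (μ + O(x⁻²))`. -/
def HasAsymp (k : ℤ) (B : ℤ → ℂ → ℂ) (κ : ℤ) (μ : ℝ → ℂ) (y : ℂ → ℂ) : Prop :=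
  ∀ s t : ℝ, (k : ℝ) * (Real.pi / 2) - Real.pi / 4 < s →
    t < (k : ℝ) * (Real.pi / 2) + Real.pi / 4 →
    ∃ C R : ℝ, ∀ r θ : ℝ, R ≤ r → s ≤ θ → θ ≤ t →
      ∃ δ : ℂ, ‖δ‖ ≤ C / r ^ 2 ∧
        (θ < (k : ℝ) * (Real.pi / 2) →
          y (pt r θ) = B k (pt r θ) + μ θ * expMonomial k κ (pt r θ) * (1 + δ)) ∧
        ((k : ℝ) * (Real.pi / 2) < θ →
          y (pt r θ) = B (k + 1) (pt r θ) + μ θ * expMonomial k κ (pt r θ) * (1 + δ)) ∧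
        (θ = (k : ℝ) * (Real.pi / 2) →
          y (pt r θ) = (B k (pt r θ) + B (k + 1) (pt r θ)) / 2
            + expMonomial k κ (pt r θ) * (μ θ + δ))

/-- In the sector `kπ/2 - π/4 < arg x < kπ/2 + π/4`, `y = L (1 + O(x⁻²))` uniformly in closed
subsectors, and `y` has no exponentially small term: it is equal to both backgrounds. -/
def HasPureAsymp (k : ℤ) (L : ℂ → ℂ) (B : ℤ → ℂ → ℂ) (y : ℂ → ℂ) : Prop :=
  AsympOn ((k : ℝ) * (Real.pi / 2) - Real.pi / 4) ((k : ℝ) * (Real.pi / 2) + Real.pi / 4) L y ∧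
    y = B k ∧ y = B (k + 1)

/-- `√π` as a complex number. -/
noncomputable def sqrtPi : ℂ := (Real.sqrt Real.pi : ℂ)

end PIV

/-!
The classical solutions of P4 are built from the solutions of one Riccati equation.

P4 is the equation of the component `f1` of the symmetric system
`f0' = f0 (f1 - f2) + 2 a0`, `f1' = f1 (f2 - f0) + 2 a1`, `f2' = f2 (f0 - f1) + 2 a2`,
`f0 + f1 + f2 = -2x`, `a0 + a1 + a2 = -1`, on which the Bäcklund transformations act by reflections
in the roots and rotations of the indices. The nonzero solutions of `y' = -(y² + 2xy)` are
`-2 e^{-x²} / (γ + 2 ∫_x^∞ e^{-t²} dt)` (`seed`); from each solution of this equation, zero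
included, a chain of fractional linear maps and the translations `Tri.stepA` produce solutions with
parameters `(k, m, -m - k - 1)` (`tri`), that is, with `α = 1/2 + m + k`, `β = 2m`. This is the
first family (`fam`), with `γ = 1/c`. The second family (`dual`) is its image under the symmetry
`x ↦ i x` (`Tri.mirror`), which exchanges the components `0` and `1`; here `γ = -2ic`.

The asymptotics are those of the complementary error function, carried through the chain. In a
sector where the seed is exponentially small the component `2` of `tri` is dominant (`BgTwo`), and
in a sector where the seed is asymptotic to `-2x` the component `1` is (`BgOne`). The dominant
terms of all components are forced by the system: a solution of `h' = h q + κ` with `h = O(1/x)` and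
`q ~ l x` satisfies `h ~ -κ / (l x)`, by a Cauchy estimate for `h'` (`Lead.of_linear_ode`). Hence
no formal series is needed, and the sharp constants in front of the exponential terms come from
the *difference* of two solutions: for `f` and `g` with the same leading term `A x^p`,
`r / f - r / g = -r (f - g) / (f g)`, so every step multiplies the difference by an explicit
monomial (`DiffLead`).

The background solutions are members of the same families, so that the first terms of the asymptotic
relations are exact: the rational solution (zero seed), and the solutions with `γ = 0` and
`γ = -2√π` (`bgParam`). The latter alternate because `γ + 2 ∫_x^∞ e^{-t²} dt` is of size
`e^{-x²} / x` near `+∞` for `γ = 0` and near `-∞` for `γ = -2√π`; this is the source of the jumps of the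
coefficients on the Stokes rays.
-/

namespace PIV

open MeasureTheory Set Filter Topology

/-! ### The complementary error function -/

/-- The integrand of the complementary error function on the ray of direction `ω`. -/
noncomputable def rayKernel (ω x : ℂ) (s : ℝ) : ℂ :=
  Complex.exp (-(ω ^ 2 * (s : ℂ) ^ 2) - 2 * x * ω * s)

/-- The integral of `rayKernel` over the half-line. -/
noncomputable def rayIntegral (ω x : ℂ) : ℂ := ∫ s in Ioi (0 : ℝ), rayKernel ω x s

lemma norm_rayKernel (ω x : ℂ) (s : ℝ) :
    ‖rayKernel ω x s‖ = Real.exp (-((ω ^ 2).re * s ^ 2) - 2 * (x * ω).re * s) := by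
  have h1 : (ω ^ 2 * (s : ℂ) ^ 2).re = (ω ^ 2).re * s ^ 2 := by
    rw [← Complex.ofReal_pow, Complex.re_mul_ofReal]
  have h2 : (2 * x * ω * s).re = 2 * (x * ω).re * s := by
    rw [Complex.re_mul_ofReal, mul_assoc 2 x ω]
    simp [Complex.mul_re]
  rw [rayKernel, Complex.norm_exp, Complex.sub_re, Complex.neg_re, h1, h2]

lemma continuous_rayKernel (ω x : ℂ) : Continuous (rayKernel ω x) := by
  unfold rayKernel; fun_prop

/-- Completing the square: a Gaussian bound which is uniform for bounded `x`. -/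
lemma norm_rayKernel_le {ω x : ℂ} {M : ℝ} (hω : 0 < (ω ^ 2).re) (hx : ‖x * ω‖ ≤ M) {s : ℝ}
    (hs : 0 ≤ s) :
    ‖rayKernel ω x s‖ ≤
      Real.exp (2 * M ^ 2 / (ω ^ 2).re) * Real.exp (-((ω ^ 2).re / 2) * s ^ 2) := by
  rw [norm_rayKernel, ← Real.exp_add]
  apply Real.exp_le_exp.2
  have h1 : -(x * ω).re ≤ M := (neg_le_abs _).trans ((Complex.abs_re_le_norm _).trans hx)
  have h2 : 2 * M * s ≤ 2 * M ^ 2 / (ω ^ 2).re + (ω ^ 2).re / 2 * s ^ 2 := by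
    have h3 : 0 ≤ (2 * M - (ω ^ 2).re * s) ^ 2 / (2 * (ω ^ 2).re) := by positivity
    have h4 : (2 * M - (ω ^ 2).re * s) ^ 2 / (2 * (ω ^ 2).re) =
      2 * M ^ 2 / (ω ^ 2).re + (ω ^ 2).re / 2 * s ^ 2 - 2 * M * s := by
      field_simp
      ring
    linarith
  nlinarith [mul_le_mul_of_nonneg_right h1 hs]

lemma integrableOn_gaussianBound {a : ℝ} (ha : 0 < a) (K : ℝ) :
    IntegrableOn (fun s : ℝ => K * Real.exp (-(a / 2) * s ^ 2)) (Ioi 0) :=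
  ((integrable_exp_neg_mul_sq (half_pos ha)).const_mul K).integrableOn

lemma integrableOn_mul_gaussianBound {a : ℝ} (ha : 0 < a) (K : ℝ) :
    IntegrableOn (fun s : ℝ => K * (s * Real.exp (-(a / 2) * s ^ 2))) (Ioi 0) :=
  ((integrable_mul_exp_neg_mul_sq (half_pos ha)).const_mul K).integrableOn

lemma integrableOn_rayKernel {ω : ℂ} (hω : 0 < (ω ^ 2).re) (x : ℂ) :
    IntegrableOn (rayKernel ω x) (Ioi 0) := by
  refine (integrableOn_gaussianBound hω
    (Real.exp (2 * ‖x * ω‖ ^ 2 / (ω ^ 2).re))).mono'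
    (continuous_rayKernel ω x).aestronglyMeasurable ?_
  filter_upwards [ae_restrict_mem measurableSet_Ioi] with s hs
  exact norm_rayKernel_le hω le_rfl (le_of_lt hs)

lemma integrableOn_mul_rayKernel {ω : ℂ} (hω : 0 < (ω ^ 2).re) (x : ℂ) :
    IntegrableOn (fun s : ℝ => (s : ℂ) * rayKernel ω x s) (Ioi 0) := by
  refine (integrableOn_mul_gaussianBound hω
    (Real.exp (2 * ‖x * ω‖ ^ 2 / (ω ^ 2).re))).mono'
    (Complex.continuous_ofReal.mul (continuous_rayKernel ω x)).aestronglyMeasurable ?_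
  filter_upwards [ae_restrict_mem measurableSet_Ioi] with s hs
  have hs0 : 0 ≤ s := le_of_lt hs
  rw [norm_mul, Complex.norm_real, Real.norm_of_nonneg hs0, mul_left_comm]
  exact mul_le_mul_of_nonneg_left (norm_rayKernel_le hω le_rfl hs0) hs0

lemma hasDerivAt_rayIntegral {ω : ℂ} (hω : 0 < (ω ^ 2).re) (x : ℂ) :
    HasDerivAt (rayIntegral ω)
      (∫ s in Ioi (0 : ℝ), -(2 * ω) * ((s : ℂ) * rayKernel ω x s)) x := by
  have hball : Metric.ball x 1 ∈ 𝓝 x := Metric.ball_mem_nhds x one_pos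
  refine (hasDerivAt_integral_of_dominated_loc_of_deriv_le
    (bound := fun s : ℝ => 2 * ‖ω‖ * Real.exp (2 * ((‖x‖ + 1) * ‖ω‖) ^ 2 / (ω ^ 2).re) *
      (s * Real.exp (-((ω ^ 2).re / 2) * s ^ 2)))
    (F' := fun z s => -(2 * ω) * ((s : ℂ) * rayKernel ω z s))
    hball ?_ (integrableOn_rayKernel hω x) ?_ ?_ (integrableOn_mul_gaussianBound hω _) ?_).2
  · exact Eventually.of_forall fun z => (continuous_rayKernel ω z).aestronglyMeasurable
  · exact ((integrableOn_mul_rayKernel hω x).const_mul _).aestronglyMeasurable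
  · filter_upwards [ae_restrict_mem measurableSet_Ioi] with s hs z hz
    have hs0 : 0 ≤ s := le_of_lt hs
    have hz1 : ‖z‖ ≤ ‖x‖ + 1 := by
      have h : ‖z - x‖ < 1 := by simpa [dist_eq_norm] using hz
      have h2 := norm_add_le (z - x) x
      rw [sub_add_cancel] at h2
      linarith
    have hM : ‖z * ω‖ ≤ (‖x‖ + 1) * ‖ω‖ := by
      rw [norm_mul]; gcongr
    have h := norm_rayKernel_le hω hM hs0
    rw [norm_mul, norm_mul, norm_neg, norm_mul, Complex.norm_real, Real.norm_of_nonneg hs0]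
    calc ‖(2 : ℂ)‖ * ‖ω‖ * (s * ‖rayKernel ω z s‖)
        ≤ ‖(2 : ℂ)‖ * ‖ω‖ * (s * (Real.exp (2 * ((‖x‖ + 1) * ‖ω‖) ^ 2 / (ω ^ 2).re) *
          Real.exp (-((ω ^ 2).re / 2) * s ^ 2))) := by gcongr
      _ = _ := by rw [Complex.norm_ofNat]; ring
  · filter_upwards with s z _
    have h : HasDerivAt (fun z : ℂ => -(ω ^ 2 * (s : ℂ) ^ 2) - 2 * z * ω * s)
        (-(2 * ω * s)) z := by
      have := (((hasDerivAt_id z).const_mul 2).mul_const ω).mul_const (s : ℂ)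
      simpa using this.const_sub (-(ω ^ 2 * (s : ℂ) ^ 2))
    convert! h.cexp using 1
    simp only [rayKernel]; ring

/-- Integration by parts in the ray integral. -/
lemma rayIntegral_parts {ω : ℂ} (hω : 0 < (ω ^ 2).re) (x : ℂ) :
    2 * x * ω * rayIntegral ω x =
      1 - 2 * ω ^ 2 * ∫ s in Ioi (0 : ℝ), (s : ℂ) * rayKernel ω x s := by
  have hI1 := integrableOn_rayKernel hω x
  have hI2 := integrableOn_mul_rayKernel hω x
  have hd : ∀ s ∈ Ici (0 : ℝ), HasDerivAt (rayKernel ω x)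
      (-(2 * ω ^ 2) * ((s : ℂ) * rayKernel ω x s) + -(2 * x * ω) * rayKernel ω x s) s := by
    intro s _
    have h : HasDerivAt (fun z : ℂ => -(ω ^ 2 * z ^ 2) - 2 * x * ω * z)
        (-(2 * ω ^ 2 * s) - 2 * x * ω) (s : ℂ) := by
      have h1 := (((hasDerivAt_id (s : ℂ)).pow 2).const_mul (ω ^ 2)).neg
      have h2 := (hasDerivAt_id (s : ℂ)).const_mul (2 * x * ω)
      convert! h1.sub h2 using 1
      simp; ring
    convert! h.cexp.comp_ofReal using 1
    simp only [rayKernel]; ring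
  have hlim : Tendsto (rayKernel ω x) atTop (𝓝 0) := by
    rw [tendsto_zero_iff_norm_tendsto_zero]
    have hg : Tendsto (fun s : ℝ => Real.exp (2 * ‖x * ω‖ ^ 2 / (ω ^ 2).re) *
        Real.exp (-((ω ^ 2).re / 2) * s ^ 2)) atTop (𝓝 0) := by
      rw [← mul_zero (Real.exp (2 * ‖x * ω‖ ^ 2 / (ω ^ 2).re))]
      refine Tendsto.const_mul _ (Real.tendsto_exp_atBot.comp ?_)
      exact (tendsto_pow_atTop two_ne_zero).const_mul_atTop_of_neg (by linarith)
    refine squeeze_zero' (Eventually.of_forall fun _ => norm_nonneg _) ?_ hg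
    filter_upwards [eventually_ge_atTop 0] with s hs
    exact norm_rayKernel_le hω le_rfl hs
  have hint : IntegrableOn (fun s : ℝ => -(2 * ω ^ 2) * ((s : ℂ) * rayKernel ω x s) +
      -(2 * x * ω) * rayKernel ω x s) (Ioi 0) := (hI2.const_mul _).add (hI1.const_mul _)
  have h := integral_Ioi_of_hasDerivAt_of_tendsto' hd hint hlim
  rw [integral_add (hI2.const_mul _) (hI1.const_mul _), integral_const_mul,
    integral_const_mul] at h
  have h0 : rayKernel ω x 0 = 1 := by simp [rayKernel]
  rw [h0] at h
  simp only [rayIntegral]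
  linear_combination -h

/-- `2 ∫_x^∞ e^{-t²} dt`, an entire function of `x`. -/
noncomputable def erfcTwo (x : ℂ) : ℂ := 2 * Complex.exp (-x ^ 2) * rayIntegral 1 x

/-- For every ray on which `e^{-t²}` decays, the integral over the ray from `x` is a primitive of
the same function. -/
lemma hasDerivAt_ray {ω : ℂ} (hω : 0 < (ω ^ 2).re) (x : ℂ) :
    HasDerivAt (fun x => 2 * ω * Complex.exp (-x ^ 2) * rayIntegral ω x)
      (-2 * Complex.exp (-x ^ 2)) x := by
  have hω0 : ω ≠ 0 := by rintro rfl; simp at hω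
  have h1 : HasDerivAt (fun x : ℂ => Complex.exp (-x ^ 2))
      (Complex.exp (-x ^ 2) * (-(2 * x))) x := by
    have := ((hasDerivAt_pow 2 x).neg).cexp
    simpa using this
  have h2 := hasDerivAt_rayIntegral hω x
  rw [integral_const_mul] at h2
  convert! (h1.const_mul (2 * ω)).mul h2 using 1
  have h3 := rayIntegral_parts hω x
  linear_combination 2 * Complex.exp (-x ^ 2) * h3

lemma hasDerivAt_erfcTwo (x : ℂ) : HasDerivAt erfcTwo (-2 * Complex.exp (-x ^ 2)) x := by
  have h := hasDerivAt_ray (ω := 1) (by simp) x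
  simp only [mul_one] at h
  exact h

lemma eq_of_hasDerivAt_eq {f g f' : ℂ → ℂ} (hf : ∀ x, HasDerivAt f (f' x) x)
    (hg : ∀ x, HasDerivAt g (f' x) x) (h0 : f 0 = g 0) (x : ℂ) : f x = g x := by
  have h : ∀ x, HasDerivAt (fun x => f x - g x) 0 x := fun x => by
    convert! (hf x).sub (hg x) using 1
    simp
  have := is_const_of_deriv_eq_zero (fun x => (h x).differentiableAt) (fun x => (h x).deriv) x 0
  simp only [h0, sub_self] at this
  exact sub_eq_zero.1 this

lemma erfcTwo_zero : erfcTwo 0 = sqrtPi := by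
  have h : rayIntegral 1 0 = ((∫ s in Ioi (0 : ℝ), Real.exp (-1 * s ^ 2) : ℝ) : ℂ) := by
    refine Eq.trans ?_ integral_ofReal
    simp [rayIntegral, rayKernel]
  rw [erfcTwo, h, integral_gaussian_Ioi]
  simp [sqrtPi]
  ring

/-- The complementary error function as an integral along any ray on which `e^{-t²}` decays. -/
lemma erfcTwo_eq_ray {φ : ℝ} (hφ : |φ| < Real.pi / 4) (x : ℂ) :
    erfcTwo x = 2 * Complex.exp (φ * Complex.I) * Complex.exp (-x ^ 2) *
      rayIntegral (Complex.exp (φ * Complex.I)) x := by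
  obtain ⟨h1, h2⟩ := abs_lt.1 hφ
  set ω := Complex.exp (φ * Complex.I) with hωdef
  have hω2 : ω ^ 2 = Complex.exp ((2 * φ : ℝ) * Complex.I) := by
    rw [hωdef, ← Complex.exp_nat_mul]; push_cast; ring_nf
  have hre : 0 < (ω ^ 2).re := by
    rw [hω2, Complex.exp_ofReal_mul_I_re]
    exact Real.cos_pos_of_mem_Ioo ⟨by linarith, by linarith⟩
  refine eq_of_hasDerivAt_eq hasDerivAt_erfcTwo (hasDerivAt_ray hre) ?_ x
  have h : rayIntegral ω 0 = ∫ s in Ioi (0 : ℝ), Complex.exp (-(ω ^ 2) * (s : ℂ) ^ 2) := by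
    simp [rayIntegral, rayKernel]
  have hω0 : ω ≠ 0 := Complex.exp_ne_zero _
  rw [erfcTwo_zero, h, integral_gaussian_complex_Ioi hre]
  -- the principal root of `π / ω²` is `√π / ω` as `|arg ω| < π/4`
  have hroot : ((Real.pi : ℂ) / ω ^ 2) ^ (1 / 2 : ℂ) = sqrtPi / ω := by
    have e1 : (Real.pi : ℂ) / ω ^ 2 =
        Complex.exp ((Real.log Real.pi : ℝ) + ((-2 * φ : ℝ) : ℂ) * Complex.I) := by
      rw [hω2, Complex.exp_add, ← Complex.ofReal_exp, Real.exp_log Real.pi_pos, div_eq_mul_inv,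
        ← Complex.exp_neg]
      push_cast; ring_nf
    have e2 : Complex.log ((Real.pi : ℂ) / ω ^ 2) =
        (Real.log Real.pi : ℝ) + ((-2 * φ : ℝ) : ℂ) * Complex.I := by
      rw [e1, Complex.log_exp]
      · simp; linarith [Real.pi_pos]
      · simp; linarith [Real.pi_pos]
    have e3 : sqrtPi = Complex.exp ((Real.log Real.pi / 2 : ℝ)) := by
      rw [sqrtPi, ← Complex.ofReal_exp, Real.exp_half, Real.exp_log Real.pi_pos]
    rw [Complex.cpow_def_of_ne_zero (by rw [e1]; exact Complex.exp_ne_zero _), e2, e3, hωdef,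
      ← Complex.exp_sub]
    congr 1
    push_cast; ring
  rw [hroot]
  simp
  field_simp

lemma erfcTwo_neg (x : ℂ) : erfcTwo (-x) = 2 * sqrtPi - erfcTwo x := by
  refine eq_of_hasDerivAt_eq (f := fun x => erfcTwo (-x)) (g := fun x => 2 * sqrtPi - erfcTwo x)
    (f' := fun x => 2 * Complex.exp (-x ^ 2)) (fun x => ?_) (fun x => ?_) ?_ x
  · have := (hasDerivAt_erfcTwo (-x)).comp x (hasDerivAt_neg x)
    simpa [Function.comp_def] using this
  · simpa using (hasDerivAt_erfcTwo x).const_sub (2 * sqrtPi)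
  · simp only [neg_zero, erfcTwo_zero]; ring

/-- The leading asymptotics of the complementary error function in `|arg x| < 3π/4`, with an
explicit error bound: the ray of direction `-θ/3` serves the point of argument `θ`. -/
lemma norm_erfcTwo_sub_one_le {r θ : ℝ} (hr : 0 < r) (hθ : |θ| < 3 * Real.pi / 4) :
    ‖pt r θ * Complex.exp (pt r θ ^ 2) * erfcTwo (pt r θ) - 1‖ ≤
      1 / (2 * Real.cos (2 * θ / 3) ^ 2) / r ^ 2 := by
  obtain ⟨h1, h2⟩ := abs_lt.1 hθ
  have hcos : 0 < Real.cos (2 * θ / 3) :=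
    Real.cos_pos_of_mem_Ioo ⟨by linarith, by linarith⟩
  set x := pt r θ with hx
  have hφ : |(-θ / 3)| < Real.pi / 4 := abs_lt.2 ⟨by linarith, by linarith⟩
  rw [erfcTwo_eq_ray hφ]
  set ω := Complex.exp (((-θ / 3 : ℝ) : ℂ) * Complex.I) with hωdef
  have hω2 : ω ^ 2 = Complex.exp ((-(2 * θ / 3) : ℝ) * Complex.I) := by
    rw [hωdef, ← Complex.exp_nat_mul]; push_cast; ring_nf
  have hre : (ω ^ 2).re = Real.cos (2 * θ / 3) := by
    rw [hω2, Complex.exp_ofReal_mul_I_re, Real.cos_neg]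
  have hxω : x * ω = (r : ℂ) * Complex.exp ((2 * θ / 3 : ℝ) * Complex.I) := by
    rw [hx, pt, hωdef, mul_assoc, ← Complex.exp_add]; push_cast; ring_nf
  have hxre : (x * ω).re = r * Real.cos (2 * θ / 3) := by
    rw [hxω, Complex.re_ofReal_mul, Complex.exp_ofReal_mul_I_re]
  have hnω : ‖ω‖ = 1 := Complex.norm_exp_ofReal_mul_I _
  have hpos : 0 < (ω ^ 2).re := by rw [hre]; exact hcos
  have hexp : Complex.exp (x ^ 2) * Complex.exp (-x ^ 2) = 1 := by
    rw [← Complex.exp_add]; simp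
  have e1 : x * Complex.exp (x ^ 2) * (2 * ω * Complex.exp (-x ^ 2) * rayIntegral ω x) - 1 =
      -(2 * ω ^ 2 * ∫ s in Ioi (0 : ℝ), (s : ℂ) * rayKernel ω x s) := by
    linear_combination rayIntegral_parts hpos x + 2 * x * ω * rayIntegral ω x * hexp
  rw [e1, norm_neg, norm_mul, norm_mul, norm_pow, hnω, Complex.norm_ofNat]
  set ρ := 2 * (r * Real.cos (2 * θ / 3)) with hρ
  have hρ0 : 0 < ρ := by positivity
  have hG := Real.integral_rpow_mul_exp_neg_mul_Ioi (a := 2) (r := ρ) two_pos hρ0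
  have hbound : ‖∫ s in Ioi (0 : ℝ), (s : ℂ) * rayKernel ω x s‖ ≤
      ∫ s in Ioi (0 : ℝ), s ^ ((2 : ℝ) - 1) * Real.exp (-(ρ * s)) := by
    refine norm_integral_le_of_norm_le ?_ ?_
    · by_contra hcon
      rw [integral_undef hcon] at hG
      rw [Real.Gamma_two] at hG
      have : (0 : ℝ) < (1 / ρ) ^ (2 : ℝ) * 1 := by positivity
      linarith
    · filter_upwards [ae_restrict_mem measurableSet_Ioi] with s hs
      have hs0 : (0 : ℝ) ≤ s := le_of_lt hs
      rw [norm_mul, Complex.norm_real, Real.norm_of_nonneg hs0, norm_rayKernel, hxre]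
      norm_num
      refine mul_le_mul_of_nonneg_left (Real.exp_le_exp.2 ?_) hs0
      have : 0 ≤ (ω ^ 2).re * s ^ 2 := by positivity
      rw [hρ]
      nlinarith
  rw [hG, Real.Gamma_two] at hbound
  calc 2 * 1 ^ 2 * ‖∫ s in Ioi (0 : ℝ), (s : ℂ) * rayKernel ω x s‖
      ≤ 2 * 1 ^ 2 * ((1 / ρ) ^ (2 : ℝ) * 1) := by gcongr
    _ = _ := by
      rw [Real.rpow_two, hρ]; field_simp

end PIV

namespace PIV

open MeasureTheory Set Filter Topology Asymptotics

/-! ### Asymptotic relations in sectors -/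

/-- The filter `|x| → ∞` in the closed sector `s ≤ arg x ≤ t`. -/
noncomputable def sec (s t : ℝ) : Filter ℂ :=
  ((atTop : Filter ℝ) ×ˢ 𝓟 (Icc s t)).map fun p => pt p.1 p.2

/-- `P x` holds for all large `x` in the open sector `a < arg x < b`, locally uniformly in the
argument. -/
def SecEv (a b : ℝ) (P : ℂ → Prop) : Prop :=
  ∀ s t : ℝ, a < s → t < b → ∀ᶠ x in sec s t, P x

/-- `f = O(x ^ k)` in the open sector `a < arg x < b`, uniformly in closed subsectors. -/
def SecO (a b : ℝ) (k : ℤ) (f : ℂ → ℂ) : Prop :=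
  ∀ s t : ℝ, a < s → t < b → f =O[sec s t] fun x => x ^ k

/-- `f = C x ^ k + O(x ^ (k - 2))` in the open sector `a < arg x < b`, uniformly in closed
subsectors. The coefficient `C` may vanish. -/
def Lead (a b : ℝ) (C : ℂ) (k : ℤ) (f : ℂ → ℂ) : Prop :=
  SecO a b (k - 2) fun x => f x - C * x ^ k

lemma norm_pt {r : ℝ} (hr : 0 ≤ r) (θ : ℝ) : ‖pt r θ‖ = r := by
  simp [pt, Complex.norm_exp_ofReal_mul_I, abs_of_nonneg hr]

lemma pt_add (r θ φ : ℝ) : pt r (θ + φ) = Complex.exp (φ * Complex.I) * pt r θ := by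
  simp only [pt]
  rw [mul_left_comm, ← Complex.exp_add]
  push_cast; ring_nf

lemma eventually_sec {s t : ℝ} {P : ℂ → Prop} :
    (∀ᶠ x in sec s t, P x) ↔ ∃ R : ℝ, ∀ r, R ≤ r → ∀ θ ∈ Icc s t, P (pt r θ) := by
  rw [sec, eventually_map, eventually_prod_principal_iff, eventually_atTop]

lemma sec_eventually_ge (s t R : ℝ) : ∀ᶠ x in sec s t, R ≤ ‖x‖ :=
  eventually_sec.2 ⟨max R 0, fun r hr θ _ => by
    rw [norm_pt ((le_max_right _ _).trans hr)]; exact (le_max_left _ _).trans hr⟩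

lemma sec_eventually_ne (s t : ℝ) : ∀ᶠ x in sec s t, x ≠ 0 := by
  filter_upwards [sec_eventually_ge s t 1] with x hx h0
  rw [h0, norm_zero] at hx
  linarith

lemma SecEv.of_forall {a b : ℝ} {P : ℂ → Prop} (h : ∀ x, P x) : SecEv a b P :=
  fun _ _ _ _ => Eventually.of_forall h

lemma SecEv.mono {a b : ℝ} {P Q : ℂ → Prop} (h : SecEv a b P) (hPQ : ∀ x, P x → Q x) :
    SecEv a b Q := fun s t hs ht => (h s t hs ht).mono hPQ

lemma SecEv.and {a b : ℝ} {P Q : ℂ → Prop} (h : SecEv a b P) (h' : SecEv a b Q) :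
    SecEv a b fun x => P x ∧ Q x := fun s t hs ht => (h s t hs ht).and (h' s t hs ht)

lemma secEv_ne (a b : ℝ) : SecEv a b fun x => x ≠ 0 := fun s t _ _ => sec_eventually_ne s t

lemma SecO.subset {a b a' b' : ℝ} {k : ℤ} {f : ℂ → ℂ} (h : SecO a b k f) (ha : a ≤ a')
    (hb : b' ≤ b) : SecO a' b' k f := fun s t hs ht => h s t (ha.trans_lt hs) (ht.trans_le hb)

lemma Lead.subset {a b a' b' : ℝ} {C : ℂ} {k : ℤ} {f : ℂ → ℂ} (h : Lead a b C k f) (ha : a ≤ a')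
    (hb : b' ≤ b) : Lead a' b' C k f := SecO.subset h ha hb

section algebra

variable {a b : ℝ} {k l : ℤ} {f g : ℂ → ℂ} {C D : ℂ}

lemma SecO.congr (h : SecO a b k f) (hfg : SecEv a b fun x => f x = g x) : SecO a b k g :=
  fun s t hs ht => (h s t hs ht).congr' (hfg s t hs ht) EventuallyEq.rfl

lemma SecO.add (hf : SecO a b k f) (hg : SecO a b k g) : SecO a b k fun x => f x + g x :=
  fun s t hs ht => (hf s t hs ht).add (hg s t hs ht)

lemma SecO.sub (hf : SecO a b k f) (hg : SecO a b k g) : SecO a b k fun x => f x - g x :=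
  fun s t hs ht => (hf s t hs ht).sub (hg s t hs ht)

lemma SecO.neg (hf : SecO a b k f) : SecO a b k fun x => -f x :=
  fun s t hs ht => (hf s t hs ht).neg_left

lemma SecO.const_mul (c : ℂ) (hf : SecO a b k f) : SecO a b k fun x => c * f x :=
  fun s t hs ht => (hf s t hs ht).const_mul_left c

lemma secO_zpow (a b : ℝ) (k : ℤ) : SecO a b k fun x => x ^ k :=
  fun s t _ _ => isBigO_refl _ (sec s t)

lemma secO_zero (a b : ℝ) (k : ℤ) : SecO a b k fun _ => 0 :=
  fun _ _ _ _ => isBigO_zero _ _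

lemma SecO.mul (hf : SecO a b k f) (hg : SecO a b l g) : SecO a b (k + l) fun x => f x * g x :=
  fun s t hs ht => ((hf s t hs ht).mul (hg s t hs ht)).congr' EventuallyEq.rfl <| by
    filter_upwards [sec_eventually_ne s t] with x hx using (zpow_add₀ hx k l).symm

lemma SecO.mono (hf : SecO a b k f) (hkl : k ≤ l) : SecO a b l f := fun s t hs ht =>
  (hf s t hs ht).trans <| IsBigO.of_bound' <| by
    filter_upwards [sec_eventually_ge s t 1] with x hx
    rw [norm_zpow, norm_zpow]
    exact zpow_le_zpow_right₀ hx hkl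

lemma SecO.cast (hf : SecO a b k f) (hkl : k = l) : SecO a b l f := hkl ▸ hf

lemma Lead.congr (h : Lead a b C k f) (hfg : SecEv a b fun x => f x = g x) : Lead a b C k g :=
  SecO.congr h (hfg.mono fun x hx => by rw [hx])

lemma Lead.cast (hf : Lead a b C k f) (hC : C = D) (hkl : k = l) : Lead a b D l f :=
  hC ▸ hkl ▸ hf

lemma Lead.secO (h : Lead a b C k f) : SecO a b k f := by
  have h1 : SecO a b k fun x => C * x ^ k := (secO_zpow a b k).const_mul C
  exact ((SecO.mono h (by linarith)).add h1).congr (SecEv.of_forall fun x => by ring)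

lemma Lead.of_secO (h : SecO a b (k - 2) f) : Lead a b 0 k f :=
  h.congr (SecEv.of_forall fun x => by ring)

lemma Lead.add (hf : Lead a b C k f) (hg : Lead a b D k g) :
    Lead a b (C + D) k fun x => f x + g x :=
  (SecO.add hf hg).congr (SecEv.of_forall fun x => by ring)

lemma Lead.neg (hf : Lead a b C k f) : Lead a b (-C) k fun x => -f x :=
  (SecO.neg hf).congr (SecEv.of_forall fun x => by ring)

lemma Lead.sub (hf : Lead a b C k f) (hg : Lead a b D k g) :
    Lead a b (C - D) k fun x => f x - g x :=
  (SecO.sub hf hg).congr (SecEv.of_forall fun x => by ring)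

lemma Lead.add_secO (hf : Lead a b C k f) (hg : SecO a b (k - 2) g) :
    Lead a b C k fun x => f x + g x :=
  (SecO.add hf hg).congr (SecEv.of_forall fun x => by ring)

lemma Lead.const_mul (c : ℂ) (hf : Lead a b C k f) : Lead a b (c * C) k fun x => c * f x :=
  (SecO.const_mul c hf).congr (SecEv.of_forall fun x => by ring)

lemma lead_monomial (a b : ℝ) (C : ℂ) (k : ℤ) : Lead a b C k fun x => C * x ^ k :=
  (secO_zero a b _).congr (SecEv.of_forall fun x => by ring)

lemma lead_const (a b : ℝ) (C : ℂ) : Lead a b C 0 fun _ => C :=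
  (lead_monomial a b C 0).congr (SecEv.of_forall fun x => by simp)

lemma lead_linear (a b : ℝ) (C : ℂ) : Lead a b C 1 fun x => C * x :=
  (lead_monomial a b C 1).congr (SecEv.of_forall fun x => by simp)

lemma Lead.mul (hf : Lead a b C k f) (hg : Lead a b D l g) :
    Lead a b (C * D) (k + l) fun x => f x * g x := by
  have h1 : SecO a b (k - 2 + l) fun x => (f x - C * x ^ k) * g x := SecO.mul hf hg.secO
  have h2 : SecO a b (k + (l - 2)) fun x => C * x ^ k * (g x - D * x ^ l) :=
    SecO.mul ((secO_zpow a b k).const_mul C) hg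
  refine ((h1.cast (by ring)).add (h2.cast (l := k - 2 + l) (by ring))).congr ?_ |>.cast
    (show k - 2 + l = k + l - 2 by ring)
  refine (secEv_ne a b).mono fun x hx => ?_
  rw [zpow_add₀ hx]; ring

lemma Lead.isEquivalent (hf : Lead a b C k f) (hC : C ≠ 0) {s t : ℝ} (hs : a < s) (ht : t < b) :
    IsEquivalent (sec s t) f fun x => C * x ^ k := by
  have h : (fun x : ℂ => x ^ (k - 2)) =o[sec s t] fun x => x ^ k := by
    refine IsLittleO.of_bound fun c hc => ?_
    filter_upwards [sec_eventually_ge s t 1, sec_eventually_ge s t (1 / c)] with x h1 h2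
    have h0 : (0 : ℝ) < ‖x‖ := by linarith
    rw [norm_zpow, norm_zpow, zpow_sub₀ h0.ne', div_eq_inv_mul]
    refine mul_le_mul_of_nonneg_right ?_ (zpow_nonneg h0.le _)
    rw [inv_le_comm₀ (by positivity) hc, ← one_div]
    have : ‖x‖ ≤ ‖x‖ ^ (2 : ℤ) := by
      rw [show ‖x‖ ^ (2 : ℤ) = ‖x‖ * ‖x‖ by rw [zpow_two]]
      nlinarith
    exact h2.trans this
  exact ((hf s t hs ht).trans_isLittleO h).const_mul_right hC

lemma Lead.secEv_ne_zero (hf : Lead a b C k f) (hC : C ≠ 0) : SecEv a b fun x => f x ≠ 0 := by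
  intro s t hs ht
  have h := (hf.isEquivalent hC hs ht).isBigO_symm
  obtain ⟨c, hc⟩ := h.bound
  filter_upwards [hc, sec_eventually_ne s t] with x h1 hx h0
  rw [h0, norm_zero, mul_zero, norm_le_zero_iff] at h1
  exact mul_ne_zero hC (zpow_ne_zero _ hx) h1

lemma Lead.secO_inv (hf : Lead a b C k f) (hC : C ≠ 0) : SecO a b (-k) fun x => (f x)⁻¹ := by
  intro s t hs ht
  refine ((hf.isEquivalent hC hs ht).inv.isBigO).trans ?_
  refine ((isBigO_refl (fun x : ℂ => x ^ (-k)) (sec s t)).const_mul_left C⁻¹).congr_left ?_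
  intro x
  simp [mul_comm]

lemma Lead.inv (hf : Lead a b C k f) (hC : C ≠ 0) : Lead a b C⁻¹ (-k) fun x => (f x)⁻¹ := by
  have h1 : SecO a b (-k + -k + (k - 2)) fun x =>
      (f x)⁻¹ * (-C⁻¹ * x ^ (-k)) * (f x - C * x ^ k) :=
    ((hf.secO_inv hC).mul ((secO_zpow a b (-k)).const_mul _)).mul hf
  refine (h1.cast (by ring)).congr ?_
  refine ((secEv_ne a b).and (hf.secEv_ne_zero hC)).mono fun x hx => ?_
  have := zpow_ne_zero k hx.1
  have := hx.2
  rw [zpow_neg]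
  field_simp
  ring

lemma Lead.div (hf : Lead a b C k f) (hg : Lead a b D l g) (hD : D ≠ 0) :
    Lead a b (C / D) (k - l) fun x => f x / g x :=
  ((hf.mul (hg.inv hD)).cast (div_eq_mul_inv _ _).symm (sub_eq_add_neg _ _).symm).congr
    (SecEv.of_forall fun _ => (div_eq_mul_inv _ _).symm)

end algebra

/-! ### Cauchy estimates in sectors -/

/-- A closed sector contains, far out, discs of radius proportional to the modulus around the
points of a smaller closed sector. -/
lemma exists_closedBall_of_sec {s s' t t' : ℝ} (hs : s' < s) (ht : t < t') :
    ∃ ε : ℝ, 0 < ε ∧ ε ≤ 1 / 2 ∧ ∀ P : ℂ → Prop, (∀ᶠ x in sec s' t', P x) →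
      ∀ᶠ x in sec s t, ∀ z ∈ Metric.closedBall x (ε * ‖x‖), P z := by
  have hη : 0 < min (s - s') (t' - t) := lt_min (by linarith) (by linarith)
  have hc : ContinuousAt Complex.arg 1 := Complex.continuousAt_arg (by simp)
  obtain ⟨δ, hδ, hδ'⟩ := Metric.continuousAt_iff.1 hc _ hη
  refine ⟨min (δ / 2) (1 / 2), by positivity, min_le_right _ _, fun P hP => ?_⟩
  obtain ⟨R, hR⟩ := eventually_sec.1 hP
  refine eventually_sec.2 ⟨max (2 * R) 1, fun r hr θ hθ z hz => ?_⟩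
  have hr0 : 0 < r := lt_of_lt_of_le one_pos ((le_max_right _ _).trans hr)
  have hx0 : pt r θ ≠ 0 := by rw [← norm_pos_iff, norm_pt hr0.le]; exact hr0
  set w := z / pt r θ with hw
  have hzw : z = w * pt r θ := by rw [hw]; field_simp
  have hw1 : ‖w - 1‖ ≤ min (δ / 2) (1 / 2) := by
    have h1 : w - 1 = (z - pt r θ) / pt r θ := by rw [hw]; field_simp
    rw [h1, norm_div, div_le_iff₀ (norm_pos_iff.2 hx0), ← dist_eq_norm]
    exact hz
  have harg : |w.arg| < min (s - s') (t' - t) := by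
    have := hδ' (x := w) (by
      rw [dist_eq_norm]; exact (hw1.trans (min_le_left _ _)).trans_lt (by linarith))
    simpa using this
  have hwn : 1 / 2 ≤ ‖w‖ := by
    have h1 := norm_sub_norm_le (1 : ℂ) (1 - w)
    rw [sub_sub_cancel, norm_one, norm_sub_rev] at h1
    linarith [hw1.trans (min_le_right _ _)]
  have hz' : z = pt (r * ‖w‖) (θ + w.arg) := by
    rw [pt_add, hzw, pt, pt]
    conv_lhs => rw [← Complex.norm_mul_exp_arg_mul_I w]
    push_cast; ring
  rw [hz']
  obtain ⟨h1, h2⟩ := abs_lt.1 harg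
  have h3 := min_le_left (s - s') (t' - t)
  have h4 := min_le_right (s - s') (t' - t)
  refine hR _ ?_ _ ⟨by linarith [hθ.1], by linarith [hθ.2]⟩
  have : 2 * R ≤ r := (le_max_left _ _).trans hr
  nlinarith

lemma SecEv.eventually_nhds {a b : ℝ} {P : ℂ → Prop} (h : SecEv a b P) :
    SecEv a b fun x => ∀ᶠ z in 𝓝 x, P z := by
  intro s t hs ht
  obtain ⟨ε, hε, -, H⟩ := exists_closedBall_of_sec (s := s) (t := t)
    (show (a + s) / 2 < s by linarith) (show t < (t + b) / 2 by linarith)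
  filter_upwards [H P (h _ _ (by linarith) (by linarith)), sec_eventually_ne s t] with x hx h0
  exact Filter.mem_of_superset
    (Metric.closedBall_mem_nhds x (mul_pos hε (norm_pos_iff.2 h0))) hx

/-- Cauchy's estimate: differentiation gains a power of `x`. -/
lemma SecO.deriv {a b : ℝ} {f : ℂ → ℂ} (hf : SecO a b (-1) f)
    (hd : SecEv a b fun x => DifferentiableAt ℂ f x) : SecO a b (-2) (deriv f) := by
  intro s t hs ht
  obtain ⟨ε, hε, hε2, H⟩ := exists_closedBall_of_sec (s := s) (t := t)
    (show (a + s) / 2 < s by linarith) (show t < (t + b) / 2 by linarith)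
  have h1 : a < (a + s) / 2 := by linarith
  have h2 : (t + b) / 2 < b := by linarith
  obtain ⟨c, hc, hb⟩ := (hf _ _ h1 h2).exists_pos
  refine IsBigO.of_bound (2 * c / ε) ?_
  filter_upwards [H _ hb.bound, H _ (hd _ _ h1 h2), sec_eventually_ne s t] with x hx hdx h0
  have hn : 0 < ‖x‖ := norm_pos_iff.2 h0
  have key := Complex.norm_deriv_le_of_forall_mem_sphere_norm_le (c := x) (R := ε * ‖x‖)
    (C := 2 * c / ‖x‖) (f := f) (by positivity)
    (DifferentiableOn.diffContOnCl_ball (U := Metric.closedBall x (ε * ‖x‖))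
      (fun z hz => (hdx z hz).differentiableWithinAt) subset_rfl)
    (fun z hz => by
      have hz' := Metric.sphere_subset_closedBall hz
      refine (hx z hz').trans ?_
      have hzx : ‖x‖ / 2 ≤ ‖z‖ := by
        have h3 := norm_sub_norm_le x (x - z)
        rw [sub_sub_cancel] at h3
        have h4 : ‖x - z‖ ≤ ε * ‖x‖ := by
          rw [norm_sub_rev, ← dist_eq_norm]; exact hz'
        nlinarith
      rw [norm_zpow, zpow_neg_one, mul_comm 2 c, mul_div_assoc]
      refine mul_le_mul_of_nonneg_left ?_ hc.le
      rw [show 2 / ‖x‖ = (‖x‖ / 2)⁻¹ by rw [inv_div]]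
      exact inv_anti₀ (by positivity) hzx)
  refine key.trans (le_of_eq ?_)
  rw [norm_zpow, zpow_neg, show ‖x‖ ^ (2 : ℤ) = ‖x‖ * ‖x‖ by rw [zpow_two]]
  field_simp

/-- A solution `h = O(1/x)` of a linear equation `h' = q h + κ` with `q ~ l x` is, up to
`O(x⁻³)`, the solution `-κ/q` of the equation without the derivative. -/
lemma Lead.of_linear_ode {a b : ℝ} {h q : ℂ → ℂ} {κ l : ℂ} (hl : l ≠ 0)
    (hh : SecO a b (-1) h) (hq : Lead a b l 1 q)
    (hode : SecEv a b fun x => HasDerivAt h (h x * q x + κ) x) :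
    Lead a b (-κ / l) (-1) h := by
  have h1 : SecO a b (-2) fun x => h x * q x + κ :=
    (hh.deriv (hode.mono fun x hx => hx.differentiableAt)).congr
      (hode.mono fun x hx => hx.deriv)
  have h2 : Lead a b (-κ) 0 fun x => h x * q x :=
    ((lead_const a b (-κ)).add_secO h1).congr (SecEv.of_forall fun x => by ring)
  refine ((h2.div hq hl).cast rfl (by norm_num)).congr ?_
  refine (hq.secEv_ne_zero hl).mono fun x hx => ?_
  field_simp

/-! ### Rotations of sectors -/

lemma map_sec (s t φ : ℝ) :
    (sec s t).map (fun x => Complex.exp (φ * Complex.I) * x) = sec (s + φ) (t + φ) := by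
  ext S
  change (∀ᶠ x in (sec s t).map _, x ∈ S) ↔ ∀ᶠ x in sec (s + φ) (t + φ), x ∈ S
  rw [eventually_map, eventually_sec, eventually_sec]
  refine exists_congr fun R => forall₂_congr fun r _ => ⟨fun h θ hθ => ?_, fun h θ hθ => ?_⟩
  · have := h (θ - φ) ⟨by linarith [hθ.1], by linarith [hθ.2]⟩
    rwa [← pt_add, sub_add_cancel] at this
  · rw [← pt_add]
    exact h (θ + φ) ⟨by linarith [hθ.1], by linarith [hθ.2]⟩

lemma SecEv.rotate {a b : ℝ} {P : ℂ → Prop} (φ : ℝ) (h : SecEv (a + φ) (b + φ) P) :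
    SecEv a b fun x => P (Complex.exp (φ * Complex.I) * x) := by
  intro s t hs ht
  have := h (s + φ) (t + φ) (by linarith) (by linarith)
  rwa [← map_sec, eventually_map] at this

lemma SecO.rotate {a b : ℝ} {k : ℤ} {f : ℂ → ℂ} (φ : ℝ) (h : SecO (a + φ) (b + φ) k f) :
    SecO a b k fun x => f (Complex.exp (φ * Complex.I) * x) := by
  intro s t hs ht
  have := h (s + φ) (t + φ) (by linarith) (by linarith)
  rw [← map_sec, isBigO_map] at this
  refine this.trans (IsBigO.of_bound' (Eventually.of_forall fun x => ?_))
  simp [Complex.norm_exp_ofReal_mul_I, mul_zpow]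

lemma Lead.rotate {a b : ℝ} {C : ℂ} {k : ℤ} {f : ℂ → ℂ} (φ : ℝ)
    (h : Lead (a + φ) (b + φ) C k f) :
    Lead a b (C * Complex.exp (φ * Complex.I) ^ k) k
      fun x => f (Complex.exp (φ * Complex.I) * x) :=
  (SecO.rotate φ h).congr (SecEv.of_forall fun x => by rw [mul_zpow]; ring)

/-! ### Relative errors and exponentially small terms -/

lemma SecO.exists_bound {a b : ℝ} {k : ℤ} {f : ℂ → ℂ} (h : SecO a b k f) {s t : ℝ} (hs : a < s)
    (ht : t < b) : ∃ K R : ℝ, ∀ r θ : ℝ, R ≤ r → s ≤ θ → θ ≤ t →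
      0 < r ∧ ‖f (pt r θ)‖ ≤ K * r ^ k := by
  obtain ⟨K, hK⟩ := (h s t hs ht).bound
  obtain ⟨R, hR⟩ := eventually_sec.1 hK
  refine ⟨K, max R 1, fun r θ hr h1 h2 => ?_⟩
  have hr0 : 0 < r := lt_of_lt_of_le one_pos ((le_max_right _ _).trans hr)
  refine ⟨hr0, ?_⟩
  have := hR r ((le_max_left _ _).trans hr) θ ⟨h1, h2⟩
  rwa [norm_zpow, norm_pt hr0.le] at this

/-- The relative error is bounded by the absolute one. -/
lemma norm_div_monomial_le {K r θ : ℝ} {C d : ℂ} {k : ℤ} (hr : 0 < r)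
    (hd : ‖d‖ ≤ K * r ^ (k - 2)) :
    ‖d / (C * pt r θ ^ k)‖ ≤ K / ‖C‖ / r ^ 2 := by
  rw [norm_div, norm_mul, norm_zpow, norm_pt hr.le]
  have hrk : 0 < r ^ k := zpow_pos hr k
  rw [zpow_sub₀ hr.ne', show r ^ (2 : ℤ) = r ^ 2 from rfl] at hd
  calc ‖d‖ / (‖C‖ * r ^ k) ≤ K * (r ^ k / r ^ 2) / (‖C‖ * r ^ k) := by gcongr
    _ = _ := by field_simp

lemma pt_ne_zero {r : ℝ} (hr : 0 < r) (θ : ℝ) : pt r θ ≠ 0 := by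
  rw [← norm_pos_iff, norm_pt hr.le]; exact hr

lemma Lead.asympOn {a b : ℝ} {C : ℂ} {k : ℤ} {L y : ℂ → ℂ} (h : Lead a b C k y) (hC : C ≠ 0)
    (hL : ∀ x, x ≠ 0 → L x = C * x ^ k) : AsympOn a b L y := by
  intro s t hs ht
  obtain ⟨K, R, hK⟩ := SecO.exists_bound h hs ht
  refine ⟨K / ‖C‖, R, fun r θ hr h1 h2 => ?_⟩
  obtain ⟨hr0, hb⟩ := hK r θ hr h1 h2
  have hx := pt_ne_zero hr0 θ
  refine ⟨_, norm_div_monomial_le (C := C) (θ := θ) hr0 hb, ?_⟩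
  rw [hL _ hx]
  have := zpow_ne_zero k hx
  field_simp
  ring

lemma expMonomial_eq (k κ : ℤ) (x : ℂ) : expMonomial k κ x = x ^ κ * expMonomial k 0 x := by
  simp [expMonomial]

lemma expMonomial_ne_zero (k : ℤ) (x : ℂ) : expMonomial k 0 x ≠ 0 := by
  simp [expMonomial]

/-- The relation with exponentially small term follows from the leading terms of the differences
to the two backgrounds, each taken in the whole sector. -/
lemma HasAsymp.of_lead {k κ : ℤ} {B : ℤ → ℂ → ℂ} {μ : ℝ → ℂ} {y : ℂ → ℂ} {C C' : ℂ}
    (h : Lead ((k : ℝ) * (Real.pi / 2) - Real.pi / 4) ((k : ℝ) * (Real.pi / 2) + Real.pi / 4) C κ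
      fun x => (y x - B k x) / expMonomial k 0 x)
    (h' : Lead ((k : ℝ) * (Real.pi / 2) - Real.pi / 4) ((k : ℝ) * (Real.pi / 2) + Real.pi / 4) C' κ
      fun x => (y x - B (k + 1) x) / expMonomial k 0 x)
    (h0 : C = 0 → y = B k) (h0' : C' = 0 → y = B (k + 1))
    (hμ : ∀ θ, θ < (k : ℝ) * (Real.pi / 2) → μ θ = C)
    (hμ' : ∀ θ, (k : ℝ) * (Real.pi / 2) < θ → μ θ = C')
    (hμ0 : μ ((k : ℝ) * (Real.pi / 2)) = (C + C') / 2) : HasAsymp k B κ μ y := by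
  intro s t hs ht
  obtain ⟨K, R, hK⟩ := SecO.exists_bound h hs ht
  obtain ⟨K', R', hK'⟩ := SecO.exists_bound h' hs ht
  -- on the Stokes ray both backgrounds are compared with `y` at once
  have hpw : ∃ K'' R'' : ℝ, ∀ r θ : ℝ, R'' ≤ r → s ≤ θ → θ ≤ t → 0 < r ∧
      ‖((y (pt r θ) - B k (pt r θ)) / expMonomial k 0 (pt r θ) +
        (y (pt r θ) - B (k + 1) (pt r θ)) / expMonomial k 0 (pt r θ)) / (2 * pt r θ ^ κ) -
        (C + C') / 2‖ ≤ K'' / r ^ 2 := by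
    obtain ⟨K₁, R₁, hK₁⟩ := SecO.exists_bound (Lead.add h h') hs ht
    refine ⟨K₁ / 2, R₁, fun r θ hr h1 h2 => ⟨(hK₁ r θ hr h1 h2).1, ?_⟩⟩
    obtain ⟨hr0, hb⟩ := hK₁ r θ hr h1 h2
    have := norm_div_monomial_le (C := 2) (θ := θ) hr0 hb
    rw [Complex.norm_ofNat] at this
    refine le_trans (le_of_eq ?_) this
    congr 1
    have := zpow_ne_zero κ (pt_ne_zero hr0 θ)
    field_simp
  obtain ⟨K'', R'', hK''⟩ := hpw
  refine ⟨max (K / ‖C‖) (max (K' / ‖C'‖) (max K'' 0)), max R (max R' R''),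
    fun r θ hr h1 h2 => ?_⟩
  obtain ⟨hr0, hb⟩ := hK r θ ((le_max_left _ _).trans hr) h1 h2
  obtain ⟨-, hb'⟩ := hK' r θ (((le_max_left _ _).trans (le_max_right _ _)).trans hr) h1 h2
  obtain ⟨-, hb''⟩ := hK'' r θ (((le_max_right _ _).trans (le_max_right _ _)).trans hr) h1 h2
  have hx := zpow_ne_zero κ (pt_ne_zero hr0 θ)
  have hE := expMonomial_ne_zero k (pt r θ)
  have hr2 : 0 < r ^ 2 := by positivity
  have hle : ∀ {c : ℝ}, c ≤ max (K / ‖C‖) (max (K' / ‖C'‖) (max K'' 0)) →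
      c / r ^ 2 ≤ max (K / ‖C‖) (max (K' / ‖C'‖) (max K'' 0)) / r ^ 2 :=
    fun hc => by gcongr
  have hmax0 : 0 ≤ max (K / ‖C‖) (max (K' / ‖C'‖) (max K'' 0)) / r ^ 2 :=
    div_nonneg (((le_max_right _ _).trans (le_max_right _ _)).trans (le_max_right _ _)) hr2.le
  rcases lt_trichotomy θ ((k : ℝ) * (Real.pi / 2)) with hθ | hθ | hθ
  · by_cases hC : C = 0
    · refine ⟨0, by simpa using hmax0, fun _ => ?_, fun h => absurd h hθ.not_gt,
        fun h => absurd h hθ.ne⟩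
      rw [hμ θ hθ, hC, h0 hC]; ring
    · refine ⟨_, (norm_div_monomial_le (C := C) (θ := θ) hr0 hb).trans
        (hle (le_max_left _ _)), fun _ => ?_,
        fun h => absurd h hθ.not_gt, fun h => absurd h hθ.ne⟩
      rw [hμ θ hθ, expMonomial_eq]
      field_simp
      ring
  · refine ⟨_, hb''.trans (hle ((le_max_left _ _).trans ((le_max_right _ _).trans
      (le_max_right _ _)))), fun h => absurd hθ h.ne, fun h => absurd hθ h.ne', fun _ => ?_⟩
    have hμθ : μ θ = (C + C') / 2 := by rw [hθ]; exact hμ0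
    rw [expMonomial_eq, hμθ]
    field_simp
    ring
  · by_cases hC : C' = 0
    · refine ⟨0, by simpa using hmax0, fun h => absurd h hθ.not_gt, fun _ => ?_,
        fun h => absurd h hθ.ne'⟩
      rw [hμ' θ hθ, hC, h0' hC]; ring
    · refine ⟨_, (norm_div_monomial_le (C := C') (θ := θ) hr0 hb').trans
        (hle ((le_max_left _ _).trans (le_max_right _ _))), fun h => absurd h hθ.not_gt,
        fun _ => ?_, fun h => absurd h hθ.ne'⟩
      rw [hμ' θ hθ, expMonomial_eq]
      field_simp
      ring

end PIV

namespace PIV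

open Set Filter Topology

/-! ### The symmetric form of the equation -/

/-- A triple of functions, thought of as a solution of the symmetric form of P4. -/
structure Tri where
  /-- the component with index `0` -/
  f0 : ℂ → ℂ
  /-- the component with index `1` -/
  f1 : ℂ → ℂ
  /-- the component with index `2` -/
  f2 : ℂ → ℂ

/-- The symmetric form `f_i' = f_i (f_{i+1} - f_{i+2}) + 2 a_i`, `f_0 + f_1 + f_2 = -2x` of P4 at
the point `x`, indices modulo `3`. Each component then solves P4. -/
structure Sys (a0 a1 a2 : ℂ) (F : Tri) (x : ℂ) : Prop where
  d0 : HasDerivAt F.f0 (F.f0 x * (F.f1 x - F.f2 x) + 2 * a0) x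
  d1 : HasDerivAt F.f1 (F.f1 x * (F.f2 x - F.f0 x) + 2 * a1) x
  d2 : HasDerivAt F.f2 (F.f2 x * (F.f0 x - F.f1 x) + 2 * a2) x
  sum : F.f0 x + F.f1 x + F.f2 x = -(2 * x)

/-- Cyclic permutation of the components. -/
def Tri.cyc (F : Tri) : Tri := ⟨F.f2, F.f0, F.f1⟩

/-- The reflection in the root with index `0`, whose parameter is `a`. -/
noncomputable def Tri.refl (a : ℂ) (F : Tri) : Tri :=
  ⟨F.f0, fun x => F.f1 x + 2 * a / F.f0 x, fun x => F.f2 x - 2 * a / F.f0 x⟩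

/-- The symmetry `x ↦ i x` of P4, which exchanges the components `0` and `1`. -/
noncomputable def Tri.mirror (F : Tri) : Tri :=
  ⟨fun x => -Complex.I * F.f1 (Complex.I * x), fun x => -Complex.I * F.f0 (Complex.I * x),
    fun x => -Complex.I * F.f2 (Complex.I * x)⟩

/-- The translation `(a0, a1, a2) ↦ (a0 + 1, a1, a2 - 1)` of the parameters: the reflections in
the roots `2` and `1` followed by a rotation. -/
noncomputable def Tri.stepA (a1 a2 : ℂ) (F : Tri) : Tri :=
  ((F.cyc.refl a2).cyc).refl (a1 + a2)

/-- The translation `(a0, a1, a2) ↦ (a0, a1 + 1, a2 - 1)` of the parameters: the reflections in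
the roots `2` and `0` followed by a rotation. -/
noncomputable def Tri.stepB (a0 a2 : ℂ) (F : Tri) : Tri :=
  ⟨fun x => F.f2 x - 2 * (a0 + a2) / (F.f0 x + 2 * a2 / F.f2 x),
    fun x => F.f0 x + 2 * a2 / F.f2 x,
    fun x => F.f1 x - 2 * a2 / F.f2 x + 2 * (a0 + a2) / (F.f0 x + 2 * a2 / F.f2 x)⟩

lemma Sys.cyc {a0 a1 a2 : ℂ} {F : Tri} {x : ℂ} (h : Sys a0 a1 a2 F x) :
    Sys a2 a0 a1 F.cyc x :=
  ⟨h.d2, h.d0, h.d1, by simp only [Tri.cyc]; rw [← h.sum]; ring⟩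

lemma Sys.refl {a0 a1 a2 : ℂ} {F : Tri} {x : ℂ} (h : Sys a0 a1 a2 F x) (h0 : F.f0 x ≠ 0) :
    Sys (-a0) (a1 + a0) (a2 + a0) (F.refl a0) x := by
  have hd : HasDerivAt (fun x => 2 * a0 / F.f0 x)
      (-(2 * a0) * (F.f0 x * (F.f1 x - F.f2 x) + 2 * a0) / F.f0 x ^ 2) x := by
    convert! (hasDerivAt_const x (2 * a0)).div h.d0 h0 using 1
    ring
  refine ⟨?_, ?_, ?_, ?_⟩
  · convert! h.d0 using 1
    simp only [Tri.refl]
    field_simp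
    ring
  · convert! h.d1.add hd using 1
    simp only [Tri.refl]
    field_simp
    ring
  · convert! h.d2.sub hd using 1
    simp only [Tri.refl]
    field_simp
    ring
  · simp only [Tri.refl]
    rw [← h.sum]
    ring

lemma Sys.mirror {a0 a1 a2 : ℂ} {F : Tri} {x : ℂ} (h : Sys a0 a1 a2 F (Complex.I * x)) :
    Sys a1 a0 a2 F.mirror x := by
  have hI : HasDerivAt (fun x => Complex.I * x) Complex.I x := by
    simpa using (hasDerivAt_id x).const_mul Complex.I
  have key : ∀ {f : ℂ → ℂ} {f' : ℂ}, HasDerivAt f f' (Complex.I * x) →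
      HasDerivAt (fun x => -Complex.I * f (Complex.I * x)) f' x := fun {f f'} hf => by
    convert! (hf.comp x hI).const_mul (-Complex.I) using 1
    linear_combination f' * Complex.I_sq
  refine ⟨?_, ?_, ?_, ?_⟩
  · convert! key h.d1 using 1
    simp only [Tri.mirror]
    linear_combination (F.f1 (Complex.I * x) *
      (F.f0 (Complex.I * x) - F.f2 (Complex.I * x))) * Complex.I_sq
  · convert! key h.d0 using 1
    simp only [Tri.mirror]
    linear_combination (F.f0 (Complex.I * x) *
      (F.f2 (Complex.I * x) - F.f1 (Complex.I * x))) * Complex.I_sq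
  · convert! key h.d2 using 1
    simp only [Tri.mirror]
    linear_combination (F.f2 (Complex.I * x) *
      (F.f1 (Complex.I * x) - F.f0 (Complex.I * x))) * Complex.I_sq
  · simp only [Tri.mirror]
    linear_combination -Complex.I * h.sum + 2 * x * Complex.I_sq

lemma Tri.mirror_stepA (a1 a2 : ℂ) (F : Tri) :
    (F.stepA a1 a2).mirror = F.mirror.stepB a1 a2 := by
  have hI : ∀ z w : ℂ, z / (-Complex.I * w) = Complex.I * (z / w) := fun z w => by
    rw [div_mul_eq_div_div, div_neg, Complex.div_I]; ring
  have hI' : ∀ z w : ℂ, -Complex.I * z + Complex.I * w = -Complex.I * (z - w) := fun z w => by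
    ring
  simp only [stepA, stepB, mirror, cyc, refl, hI, hI']
  congr 1 <;> funext x <;> ring

lemma Tri.mirror_stepB (a0 a2 : ℂ) (F : Tri) :
    (F.stepB a0 a2).mirror = F.mirror.stepA a0 a2 := by
  have hI : ∀ z w : ℂ, z / (-Complex.I * w) = Complex.I * (z / w) := fun z w => by
    rw [div_mul_eq_div_div, div_neg, Complex.div_I]; ring
  have hI' : ∀ z w : ℂ, -Complex.I * z - Complex.I * w = -Complex.I * (z + w) := fun z w => by
    ring
  simp only [stepA, stepB, mirror, cyc, refl, hI, hI']
  congr 1 <;> funext x <;> ring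

/-! ### Meromorphic solutions -/

lemma eventually_codiscrete {P : ℂ → Prop} :
    (∀ᶠ x in codiscrete ℂ, P x) ↔ ∀ x₀, ∀ᶠ x in 𝓝[≠] x₀, P x := by
  rw [Filter.codiscrete, Filter.Eventually, mem_codiscreteWithin_iff_forall_mem_nhdsNE]
  simp [Filter.Eventually]

lemma eventually_codiscrete_nhds {P : ℂ → Prop} (h : ∀ᶠ x in codiscrete ℂ, P x) :
    ∀ᶠ x in codiscrete ℂ, ∀ᶠ z in 𝓝 x, P z := by
  rw [eventually_codiscrete] at h ⊢
  intro x₀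
  filter_upwards [eventually_eventually_nhdsWithin.2 (h x₀), self_mem_nhdsWithin] with x hx hne
  rwa [isOpen_compl_singleton.nhdsWithin_eq hne] at hx

lemma exists_of_codiscrete {P : ℂ → Prop} (h : ∀ᶠ x in codiscrete ℂ, P x) : ∃ x, P x :=
  (eventually_codiscrete.1 h 0).exists

lemma eventually_codiscrete_mul_I {P : ℂ → Prop} (h : ∀ᶠ x in codiscrete ℂ, P x) :
    ∀ᶠ x in codiscrete ℂ, P (Complex.I * x) := by
  rw [eventually_codiscrete] at h ⊢
  intro x₀
  have ht : Tendsto (fun x => Complex.I * x) (𝓝[≠] x₀) (𝓝[≠] (Complex.I * x₀)) := by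
    refine tendsto_nhdsWithin_iff.2 ⟨?_, ?_⟩
    · exact ((continuous_const_mul Complex.I).tendsto x₀).mono_left nhdsWithin_le_nhds
    · filter_upwards [self_mem_nhdsWithin] with x hx hcon
      exact hx (mul_left_cancel₀ Complex.I_ne_zero hcon)
  exact ht.eventually (h _)

/-- A meromorphic solution of a linear equation with non-zero inhomogeneity does not vanish
identically; hence its zeros are isolated. -/
lemma codiscrete_ne_zero_of_ode {h q c : ℂ → ℂ} (hh : Meromorphic h) (hc : ∀ x, c x ≠ 0)
    (hode : ∀ᶠ x in codiscrete ℂ, HasDerivAt h (h x * q x + c x) x) :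
    ∀ᶠ x in codiscrete ℂ, h x ≠ 0 := by
  have hode' := eventually_codiscrete.1 hode
  rw [eventually_codiscrete]
  intro x₀
  refine (hh x₀).eventually_eq_zero_or_eventually_ne_zero.resolve_left fun h0 => ?_
  have h1 := eventually_eventually_nhdsWithin.2 h0
  obtain ⟨x, ⟨⟨hx0, hx⟩, hxd⟩, hne⟩ :=
    (((h0.and h1).and (hode' x₀)).and self_mem_nhdsWithin).exists
  rw [isOpen_compl_singleton.nhdsWithin_eq hne] at hx
  have h2 : HasDerivAt h 0 x := (hasDerivAt_const x 0).congr_of_eventuallyEq hx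
  have h3 := hxd.unique h2
  rw [hx0, zero_mul, zero_add] at h3
  exact hc x h3

/-- A global meromorphic solution of the symmetric form: the system holds outside a discrete set,
which takes care of the poles and of junk values of the quotients in the definitions. -/
structure GSys (a0 a1 a2 : ℂ) (F : Tri) : Prop where
  m0 : Meromorphic F.f0
  m1 : Meromorphic F.f1
  m2 : Meromorphic F.f2
  sys : ∀ᶠ x in codiscrete ℂ, Sys a0 a1 a2 F x

section GSys

variable {a0 a1 a2 : ℂ} {F : Tri}

lemma GSys.cyc (h : GSys a0 a1 a2 F) : GSys a2 a0 a1 F.cyc :=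
  ⟨h.m2, h.m0, h.m1, h.sys.mono fun _ hx => hx.cyc⟩

lemma GSys.f0_ne (h : GSys a0 a1 a2 F) (h0 : a0 ≠ 0) : ∀ᶠ x in codiscrete ℂ, F.f0 x ≠ 0 :=
  codiscrete_ne_zero_of_ode h.m0 (fun _ => mul_ne_zero two_ne_zero h0) 
    (h.sys.mono fun _ hx => hx.d0)

lemma GSys.f1_ne (h : GSys a0 a1 a2 F) (h1 : a1 ≠ 0) : ∀ᶠ x in codiscrete ℂ, F.f1 x ≠ 0 :=
  h.cyc.cyc.f0_ne h1

lemma GSys.f2_ne (h : GSys a0 a1 a2 F) (h2 : a2 ≠ 0) : ∀ᶠ x in codiscrete ℂ, F.f2 x ≠ 0 :=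
  h.cyc.f0_ne h2

lemma GSys.refl (h : GSys a0 a1 a2 F) (h0 : a0 ≠ 0) :
    GSys (-a0) (a1 + a0) (a2 + a0) (F.refl a0) := by
  refine ⟨h.m0, h.m1.add ((Meromorphic.const _).div h.m0),
    h.m2.sub ((Meromorphic.const _).div h.m0), ?_⟩
  filter_upwards [h.sys, h.f0_ne h0] with x hx hx0 using hx.refl hx0

lemma meromorphic_comp_mul_I {f : ℂ → ℂ} (hf : Meromorphic f) :
    Meromorphic fun x => -Complex.I * f (Complex.I * x) := by
  intro x
  have h : MeromorphicAt (f ∘ fun x => Complex.I * x) x :=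
    (hf (Complex.I * x)).comp_analyticAt (analyticAt_const.mul analyticAt_id)
  exact (MeromorphicAt.const (-Complex.I) x).mul h

lemma GSys.mirror (h : GSys a0 a1 a2 F) : GSys a1 a0 a2 F.mirror :=
  ⟨meromorphic_comp_mul_I h.m1, meromorphic_comp_mul_I h.m0, meromorphic_comp_mul_I h.m2,
    (eventually_codiscrete_mul_I h.sys).mono fun _ hx => hx.mirror⟩

/-- The reflection in the root with index `2`, with the components in their natural order. -/
lemma GSys.refl_two (h : GSys a0 a1 a2 F) (h2 : a2 ≠ 0) :
    GSys (a0 + a2) (a1 + a2) (-a2) ((F.cyc.refl a2).cyc).cyc :=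
  (h.cyc.refl h2).cyc.cyc

lemma GSys.stepA (h : GSys a0 a1 a2 F) (h2 : a2 ≠ 0) (h1 : a1 + a2 ≠ 0)
    (hs : a0 + a1 + a2 = -1) : GSys (a0 + 1) a1 (a2 - 1) (F.stepA a1 a2) := by
  have := (h.cyc.refl h2).cyc.refl h1
  convert this using 1
  · linear_combination hs
  · ring
  · linear_combination -hs
  · rfl

end GSys

/-- The normal form on `ℂ` of a meromorphic function. -/
noncomputable def nf (f : ℂ → ℂ) : ℂ → ℂ := toMeromorphicNFOn f univ

lemma nf_meromorphicNFOn (f : ℂ → ℂ) : MeromorphicNFOn (nf f) univ :=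
  meromorphicNFOn_toMeromorphicNFOn f univ

lemma nf_eq_codiscrete {f : ℂ → ℂ} (hf : Meromorphic f) : nf f =ᶠ[codiscrete ℂ] f :=
  (toMeromorphicNFOn_eqOn_codiscrete hf.meromorphicOn).symm

lemma nf_eq_of_analyticAt {f : ℂ → ℂ} (hf : Meromorphic f) {x : ℂ} (hx : AnalyticAt ℂ f x) :
    nf f x = f x := by
  rw [nf, toMeromorphicNFOn_eq_toMeromorphicNFAt hf.meromorphicOn (mem_univ x),
    toMeromorphicNFAt_eq_self.2 hx.meromorphicNFAt]

lemma nf_congr {f g : ℂ → ℂ} (hf : Meromorphic f) (hg : Meromorphic g)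
    (h : f =ᶠ[codiscrete ℂ] g) : nf f = nf g := by
  funext x
  have h1 : nf f =ᶠ[codiscrete ℂ] nf g :=
    ((nf_eq_codiscrete hf).trans h).trans (nf_eq_codiscrete hg).symm
  have h2 : nf f =ᶠ[𝓝[≠] x] nf g := eventually_codiscrete.1 h1 x
  exact (((nf_meromorphicNFOn f (mem_univ x)).eventuallyEq_nhdsNE_iff_eventuallyEq_nhds
    (nf_meromorphicNFOn g (mem_univ x))).1 h2).eq_of_nhds

lemma nf_zero : nf (fun _ => 0) = fun _ => 0 := by
  funext x
  exact nf_eq_of_analyticAt (Meromorphic.const 0) analyticAt_const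

lemma codiscrete_analyticAt {f : ℂ → ℂ} (hf : Meromorphic f) :
    ∀ᶠ x in codiscrete ℂ, AnalyticAt ℂ f x :=
  eventually_codiscrete.2 fun x => (hf x).eventually_analyticAt

/-- An equation which holds outside a discrete set holds wherever both sides are continuous. -/
lemma eq_of_codiscrete {g h : ℂ → ℂ} (hgh : ∀ᶠ x in codiscrete ℂ, g x = h x) {x : ℂ}
    (hg : ContinuousAt g x) (hh : ContinuousAt h x) : g x = h x := by
  have h1 : g =ᶠ[𝓝[≠] x] h := eventually_codiscrete.1 hgh x
  exact tendsto_nhds_unique_of_eventuallyEq (hg.tendsto.mono_left nhdsWithin_le_nhds)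
    (hh.tendsto.mono_left nhdsWithin_le_nhds) h1

/-- The component `f1` of a solution of the symmetric form solves P4. -/
lemma GSys.isSolution {a0 a1 a2 : ℂ} {F : Tri} (h : GSys a0 a1 a2 F) {α β : ℂ}
    (hα : 2 * α - β / 2 = a0 - a2) (hβ : β ^ 2 = (2 * a1) ^ 2) : IsSolution α β (nf F.f1) := by
  refine ⟨nf_meromorphicNFOn _, fun x hx => ?_⟩
  refine eq_of_codiscrete (g := fun x => 2 * nf F.f1 x * deriv (deriv (nf F.f1)) x)
    (h := fun x => (deriv (nf F.f1) x) ^ 2 + 3 * (nf F.f1 x) ^ 4 + 8 * x * (nf F.f1 x) ^ 3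
          + 4 * (x ^ 2 - (2 * α - β / 2)) * (nf F.f1 x) ^ 2 - β ^ 2) ?_ ?_ ?_
  · filter_upwards [eventually_codiscrete_nhds (h.sys.and (nf_eq_codiscrete h.m1))] with z hz
    have e1 : nf F.f1 =ᶠ[𝓝 z] F.f1 := hz.mono fun _ hw => hw.2
    have e2 : deriv (nf F.f1) =ᶠ[𝓝 z]
        fun w => F.f1 w * (F.f2 w - F.f0 w) + 2 * a1 := by
      refine e1.deriv.trans (hz.mono fun w hw => hw.1.d1.deriv)
    obtain ⟨hs, -⟩ := hz.self_of_nhds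
    have e3 := e2.deriv_eq
    have e4 : HasDerivAt (fun w => F.f1 w * (F.f2 w - F.f0 w) + 2 * a1) _ z :=
      (hs.d1.mul (hs.d2.sub hs.d0)).add_const (2 * a1)
    simp only [Pi.sub_apply] at e4
    rw [e4.deriv] at e3
    rw [e3, e2.eq_of_nhds, e1.eq_of_nhds, hα, hβ, show F.f2 z = -(2 * z) - F.f0 z - F.f1 z by
      linear_combination hs.sum]
    ring
  · exact (continuousAt_const.mul hx.continuousAt).mul hx.deriv.deriv.continuousAt
  · have h1 := hx.continuousAt
    have h2 := hx.deriv.continuousAt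
    fun_prop

/-! ### Bäcklund transformations in the symmetric form -/

section classical

variable {a0 a1 a2 α β : ℂ} {F : Tri}

/-- What is needed of `nf f1` outside a discrete set in order to apply a Bäcklund
transformation. -/
lemma GSys.codiscrete_nf (h : GSys a0 a1 a2 F) : ∀ᶠ x in codiscrete ℂ,
    AnalyticAt ℂ (nf F.f1) x ∧ nf F.f1 x = F.f1 x ∧
      deriv (nf F.f1) x = F.f1 x * (F.f2 x - F.f0 x) + 2 * a1 ∧
      F.f0 x + F.f1 x + F.f2 x = -(2 * x) := by
  filter_upwards [eventually_codiscrete_nhds (nf_eq_codiscrete h.m1), h.sys,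
    codiscrete_analyticAt (meromorphicOn_univ.1 (nf_meromorphicNFOn F.f1).meromorphicOn)]
    with x h1 h2 h3
  have h1' : nf F.f1 =ᶠ[𝓝 x] F.f1 := h1
  exact ⟨h3, h1'.eq_of_nhds, by rw [h1'.deriv_eq, h2.d1.deriv], h2.sum⟩

/-- `R₀⁺` is the reflection in the root with index `2`. -/
lemma GSys.classical_zeroPlus (h : GSys a0 a1 a2 F) (hβ : β = 2 * a1) (hα : 2 * α = -1 - 2 * a2)
    (hcl : IsClassical α β (nf F.f1)) (h1 : ∀ᶠ x in codiscrete ℂ, F.f1 x ≠ 0) (h2 : a2 ≠ 0) :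
    IsClassical (-α - 1) (-2 * α + β - 1) (nf fun x => F.f1 x - 2 * a2 / F.f2 x) := by
  have hev := (h.codiscrete_nf.and h1).and (h.f2_ne h2)
  refine IsClassical.zeroPlus α β _ _ hcl ?_ (nf_meromorphicNFOn _) ?_
  · obtain ⟨x, ⟨⟨hx1, hx2, hx3, hx4⟩, hx5⟩, hx6⟩ := exists_of_codiscrete hev
    refine ⟨x, hx1, ?_⟩
    rw [hx2, hx3, hβ, show F.f1 x * (F.f2 x - F.f0 x) + 2 * a1 - F.f1 x ^ 2 -
      2 * x * F.f1 x - 2 * a1 = 2 * (F.f1 x * F.f2 x) by linear_combination F.f1 x * (-hx4)]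
    exact mul_ne_zero two_ne_zero (mul_ne_zero hx5 hx6)
  · filter_upwards [hev, nf_eq_codiscrete
      (h.m1.sub ((Meromorphic.const (2 * a2)).div h.m2))] with x hx hx'
    obtain ⟨⟨⟨hx1, hx2, hx3, hx4⟩, hx5⟩, hx6⟩ := hx
    refine hx'.trans ?_
    rw [hx2, hx3, hβ, hα, show F.f1 x * (F.f2 x - F.f0 x) + 2 * a1 - F.f1 x ^ 2 -
      2 * x * F.f1 x - 2 * a1 = 2 * (F.f1 x * F.f2 x) by linear_combination F.f1 x * (-hx4)]
    simp only [Pi.sub_apply, Pi.div_apply]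
    field_simp
    ring

/-- `R₀⁻` is the reflection in the root with index `0`. -/
lemma GSys.classical_zeroMinus (h : GSys a0 a1 a2 F) (hβ : β = -2 * a1) (hα : 2 * α = 1 + 2 * a0)
    (hcl : IsClassical α β (nf F.f1)) (h1 : ∀ᶠ x in codiscrete ℂ, F.f1 x ≠ 0) (h0 : a0 ≠ 0) :
    IsClassical (-α + 1) (-2 * α + β + 1) (nf fun x => F.f1 x + 2 * a0 / F.f0 x) := by
  have hev := (h.codiscrete_nf.and h1).and (h.f0_ne h0)
  refine IsClassical.zeroMinus α β _ _ hcl ?_ (nf_meromorphicNFOn _) ?_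
  · obtain ⟨x, ⟨⟨hx1, hx2, hx3, hx4⟩, hx5⟩, hx6⟩ := exists_of_codiscrete hev
    refine ⟨x, hx1, ?_⟩
    rw [hx2, hx3, hβ, show F.f1 x * (F.f2 x - F.f0 x) + 2 * a1 + F.f1 x ^ 2 +
      2 * x * F.f1 x + -2 * a1 = -2 * (F.f1 x * F.f0 x) by linear_combination F.f1 x * hx4]
    exact mul_ne_zero (by norm_num) (mul_ne_zero hx5 hx6)
  · filter_upwards [hev, nf_eq_codiscrete
      (h.m1.add ((Meromorphic.const (2 * a0)).div h.m0))] with x hx hx'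
    obtain ⟨⟨⟨hx1, hx2, hx3, hx4⟩, hx5⟩, hx6⟩ := hx
    refine hx'.trans ?_
    rw [hx2, hx3, hβ, hα, show F.f1 x * (F.f2 x - F.f0 x) + 2 * a1 + F.f1 x ^ 2 +
      2 * x * F.f1 x + -2 * a1 = -2 * (F.f1 x * F.f0 x) by linear_combination F.f1 x * hx4]
    simp only [Pi.add_apply, Pi.div_apply]
    field_simp
    ring

/-- `R_∞⁺` is a rotation, preceded by the reflection in the root with index `1` if `β = 2 a1`. -/
lemma GSys.classical_inftyPlus (h : GSys a0 a1 a2 F) (hcl : IsClassical α β (nf F.f1))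
    (h1 : ∀ᶠ x in codiscrete ℂ, F.f1 x ≠ 0) :
    IsClassical (-α) (-2 * α + β - 1) (nf fun x => F.f2 x + (a1 + β / 2) / F.f1 x) := by
  have hev := h.codiscrete_nf.and h1
  refine IsClassical.inftyPlus α β _ _ hcl ?_ (nf_meromorphicNFOn _) ?_
  · obtain ⟨x, ⟨hx1, hx2, -, -⟩, hx5⟩ := exists_of_codiscrete hev
    exact ⟨x, hx1, by rwa [hx2]⟩
  · filter_upwards [hev, nf_eq_codiscrete
      (h.m2.add ((Meromorphic.const (a1 + β / 2)).div h.m1))] with x hx hx'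
    obtain ⟨⟨hx1, hx2, hx3, hx4⟩, hx5⟩ := hx
    refine hx'.trans ?_
    rw [hx2, hx3]
    simp only [Pi.add_apply, Pi.div_apply]
    field_simp
    linear_combination F.f1 x * hx4

/-- `R_∞⁻` is a rotation, preceded by the reflection in the root with index `1` if
`β = -2 a1`. -/
lemma GSys.classical_inftyMinus (h : GSys a0 a1 a2 F) (hcl : IsClassical α β (nf F.f1))
    (h1 : ∀ᶠ x in codiscrete ℂ, F.f1 x ≠ 0) :
    IsClassical (-α) (-2 * α + β + 1) (nf fun x => F.f0 x + (β / 2 - a1) / F.f1 x) := by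
  have hev := h.codiscrete_nf.and h1
  refine IsClassical.inftyMinus α β _ _ hcl ?_ (nf_meromorphicNFOn _) ?_
  · obtain ⟨x, ⟨hx1, hx2, -, -⟩, hx5⟩ := exists_of_codiscrete hev
    exact ⟨x, hx1, by rwa [hx2]⟩
  · filter_upwards [hev, nf_eq_codiscrete
      (h.m0.add ((Meromorphic.const (β / 2 - a1)).div h.m1))] with x hx hx'
    obtain ⟨⟨hx1, hx2, hx3, hx4⟩, hx5⟩ := hx
    refine hx'.trans ?_
    rw [hx2, hx3]
    simp only [Pi.add_apply, Pi.div_apply]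
    field_simp
    linear_combination F.f1 x * hx4

end classical

/-! ### The hierarchy generated by a solution of a Riccati equation -/

/-- The chain `y_0 = y`, `y_{m+1} = 2 (m + 1) / (2x + y_m)`; if `y' = -(y² + 2xy)`, then
`y_m' = -(y_m² + 2 x y_m) + 2m`. -/
noncomputable def ricc (y : ℂ → ℂ) : ℕ → ℂ → ℂ
  | 0 => y
  | m + 1 => fun x => 2 * ((m : ℂ) + 1) / (2 * x + ricc y m x)

/-- The solution of the symmetric form with parameters `(k, m, -m - k - 1)` generated by the
solution `y` of `y' = -(y² + 2xy)`. -/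
noncomputable def tri (y : ℂ → ℂ) (m : ℕ) : ℕ → Tri
  | 0 => ⟨fun _ => 0, ricc y m, fun x => -(2 * x) - ricc y m x⟩
  | k + 1 => (tri y m k).stepA m (-((m : ℂ) + k + 1))

/-- A meromorphic solution of `y' = -(y² + 2xy)`. -/
structure IsSeed (y : ℂ → ℂ) : Prop where
  mero : Meromorphic y
  ode : ∀ᶠ x in codiscrete ℂ, HasDerivAt y (y x * (-(2 * x) - y x)) x

lemma isSeed_zero : IsSeed fun _ => 0 :=
  ⟨Meromorphic.const 0, Eventually.of_forall fun x => by simpa using hasDerivAt_const x (0 : ℂ)⟩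

lemma natCast_add_one_ne_zero' (m k : ℕ) : (m : ℂ) + k + 1 ≠ 0 := by
  exact_mod_cast Nat.succ_ne_zero (m + k)

lemma tri_zero_sys {y : ℂ → ℂ} {m : ℕ} {x : ℂ}
    (h : HasDerivAt (ricc y m) (ricc y m x * (-(2 * x) - ricc y m x) + 2 * m) x) :
    Sys 0 m (-((m : ℂ) + 1)) (tri y m 0) x := by
  refine ⟨?_, ?_, ?_, ?_⟩
  · convert! hasDerivAt_const x (0 : ℂ) using 1
    simp [tri]
  · convert! h using 1
    simp [tri]
  · convert! ((hasDerivAt_id x).const_mul 2).neg.sub h using 1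
    simp [tri]
    ring
  · simp [tri]

lemma hasDerivAt_ricc_succ {y : ℂ → ℂ} {m : ℕ} {x : ℂ} (hx : 2 * x + ricc y m x ≠ 0)
    (h : HasDerivAt (ricc y m) (ricc y m x * (-(2 * x) - ricc y m x) + 2 * m) x) :
    HasDerivAt (ricc y (m + 1))
      (ricc y (m + 1) x * (-(2 * x) - ricc y (m + 1) x) + 2 * (m + 1 : ℕ)) x := by
  convert! (hasDerivAt_const x (2 * ((m : ℂ) + 1))).div
    (((hasDerivAt_id x).const_mul 2).add h) hx using 1
  simp only [ricc, Pi.add_apply, id]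
  push_cast
  field_simp
  ring

lemma IsSeed.gsys {y : ℂ → ℂ} (hy : IsSeed y) (m : ℕ) :
    ∀ k : ℕ, GSys k m (-((m : ℂ) + k + 1)) (tri y m k) := by
  intro k
  induction k with
  | zero =>
    suffices h : Meromorphic (ricc y m) ∧ ∀ᶠ x in codiscrete ℂ,
        HasDerivAt (ricc y m) (ricc y m x * (-(2 * x) - ricc y m x) + 2 * m) x by
      have hx : Meromorphic fun x : ℂ => -(2 * x) := fun x => by
        exact (AnalyticAt.meromorphicAt (by fun_prop))
      refine ⟨Meromorphic.const 0, h.1, hx.sub h.1, h.2.mono fun x hx => ?_⟩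
      simpa using tri_zero_sys hx
    induction m with
    | zero => exact ⟨hy.mero, hy.ode.mono fun x hx => by simpa [ricc] using hx⟩
    | succ m ih =>
      have hx : Meromorphic fun x : ℂ => -(2 * x) := fun x => by
        exact (AnalyticAt.meromorphicAt (by fun_prop))
      have hx' : Meromorphic fun x : ℂ => 2 * x := fun x => by
        exact (AnalyticAt.meromorphicAt (by fun_prop))
      have hG : GSys 0 m (-((m : ℂ) + 1)) (tri y m 0) :=
        ⟨Meromorphic.const 0, ih.1, hx.sub ih.1, ih.2.mono fun x hx => tri_zero_sys hx⟩
      refine ⟨(Meromorphic.const _).div (hx'.add ih.1), ?_⟩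
      filter_upwards [ih.2, hG.f2_ne (neg_ne_zero.2 (by
        simpa using natCast_add_one_ne_zero' m 0))] with x h1 h2
      refine hasDerivAt_ricc_succ (fun h => h2 ?_) h1
      simp only [tri]
      linear_combination -h
  | succ k ih =>
    have h := ih.stepA (neg_ne_zero.2 (natCast_add_one_ne_zero' m k)) (by
      have := natCast_add_one_ne_zero' 0 k
      intro h
      apply this
      push_cast
      linear_combination -h) (by ring)
    convert h using 1
    · push_cast; ring
    · push_cast; ring
    · rfl

/-- The first components vanish identically only for the trivial seed, and only if `m = 0`. -/
lemma IsSeed.tri_f1_ne {y : ℂ → ℂ} (hy : IsSeed y) {m : ℕ}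
    (h : m ≠ 0 ∨ ∀ᶠ x in codiscrete ℂ, y x ≠ 0) (k : ℕ) :
    ∀ᶠ x in codiscrete ℂ, (tri y m k).f1 x ≠ 0 := by
  by_cases hm : m = 0
  · subst hm
    have h0 := h.resolve_left (by simp)
    induction k with
    | zero => simpa [tri, ricc] using h0
    | succ k ih =>
      have hG := hy.gsys 0 k
      have hk := natCast_add_one_ne_zero' 0 k
      have hg1 := (hG.refl_two (neg_ne_zero.2 hk)).f1_ne (by
        intro h
        apply hk
        linear_combination -h)
      filter_upwards [ih, hG.f2_ne (neg_ne_zero.2 hk), hg1] with x h1 h2 h3 h4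
      simp only [tri, Tri.stepA, Tri.cyc, Tri.refl] at h3 h4
      have clear : ∀ f g c : ℂ, g ≠ 0 → f + c / g = 0 → f * g = -c := fun f g c hg h => by
        field_simp at h
        linear_combination h
      have h5 := clear _ _ _ h3 h4
      rw [mul_sub, mul_div_cancel₀ _ h2] at h5
      refine mul_ne_zero h2 h1 ?_
      push_cast at h5
      linear_combination h5
  · exact (hy.gsys m k).f1_ne (by exact_mod_cast hm)

section classical

variable {y : ℂ → ℂ}

lemma IsSeed.deriv_nf (hy : IsSeed y) (m : ℕ) {x : ℂ} (hx : AnalyticAt ℂ (nf (ricc y m)) x) :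
    deriv (nf (ricc y m)) x =
      nf (ricc y m) x * (-(2 * x) - nf (ricc y m) x) + 2 * m := by
  have hG := hy.gsys m 0
  refine eq_of_codiscrete (g := deriv (nf (ricc y m)))
    (h := fun x => nf (ricc y m) x * (-(2 * x) - nf (ricc y m) x) + 2 * m) ?_ ?_ ?_
  · filter_upwards [hG.codiscrete_nf] with z hz
    obtain ⟨-, h1, h2, h3⟩ := hz
    simp only [tri] at h1 h2 h3
    rw [h2, h1]
    ring
  · exact hx.deriv.continuousAt
  · have := hx.continuousAt
    fun_prop

/-- The members of the first family are classical. -/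
lemma IsSeed.isClassical (hy : IsSeed y) {m : ℕ}
    (h : m ≠ 0 ∨ ∀ᶠ x in codiscrete ℂ, y x ≠ 0) (k : ℕ) :
    IsClassical (1 / 2 + m + k) (2 * m) (nf (tri y m k).f1) := by
  induction k with
  | zero =>
    refine IsClassical.riccati _ _ (-1) (2 * m) _ (by norm_num) ?_ rfl (nf_meromorphicNFOn _) ?_
    · push_cast; ring
    · intro x hx
      have := hy.deriv_nf m hx
      simp only [tri]
      rw [this]; ring
  | succ k ih =>
    have hG := hy.gsys m k
    have hne := neg_ne_zero.2 (natCast_add_one_ne_zero' m k)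
    have hk : (m : ℂ) + -((m : ℂ) + k + 1) ≠ 0 := by
      have := natCast_add_one_ne_zero' 0 k
      intro h
      apply this
      push_cast
      linear_combination -h
    have h1 := hG.classical_zeroPlus rfl (by ring) ih (hy.tri_f1_ne h k) hne
    have hG' := hG.refl_two hne
    have h2 := hG'.classical_inftyPlus h1 (hG'.f1_ne hk)
    convert h2 using 1
    · push_cast; ring
    · ring
    · simp only [tri, Tri.stepA, Tri.cyc, Tri.refl]
      congr 1
      funext x
      ring

/-- The rotated solutions `-i f1(ix)` are classical. -/
lemma IsSeed.isClassical_mirror_f0 (hy : IsSeed y) {m : ℕ}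
    (h : m ≠ 0 ∨ ∀ᶠ x in codiscrete ℂ, y x ≠ 0) (k : ℕ) :
    IsClassical (-(1 / 2 + m + k)) (-2 * m) (nf (tri y m k).mirror.f0) ∧
      IsClassical (1 / 2 + (m + k + 1)) (2 * (k + 1)) (nf (tri y m (k + 1)).mirror.f1) := by
  have step : ∀ k : ℕ, IsClassical (-(1 / 2 + m + k)) (-2 * m) (nf (tri y m k).mirror.f0) →
      IsClassical (1 / 2 + (m + k + 1)) (2 * (k + 1)) (nf (tri y m (k + 1)).mirror.f1) := by
    intro k ih
    have hG := (hy.gsys m k).mirror.cyc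
    have hf : ∀ᶠ x in codiscrete ℂ, (tri y m k).mirror.cyc.f1 x ≠ 0 := by
      filter_upwards [eventually_codiscrete_mul_I (hy.tri_f1_ne h k)] with x hx
      exact mul_ne_zero (neg_ne_zero.2 Complex.I_ne_zero) hx
    have h1 := hG.classical_zeroMinus (by ring) (by ring) ih hf
      (neg_ne_zero.2 (natCast_add_one_ne_zero' m k))
    convert h1 using 1
    · ring
    · ring
    · rw [tri, Tri.mirror_stepA]
      rfl
  suffices h0 : IsClassical (-(1 / 2 + m + k)) (-2 * m) (nf (tri y m k).mirror.f0) from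
    ⟨h0, step k h0⟩
  induction k with
  | zero =>
    have hG := (hy.gsys m 0).mirror.cyc
    refine IsClassical.riccati _ _ 1 (2 * m) _ (by norm_num) ?_ (by ring)
      (nf_meromorphicNFOn _) ?_
    · push_cast; ring
    · intro x hx
      refine eq_of_codiscrete (g := deriv (nf (tri y m 0).mirror.f0))
        (h := fun x => 1 * (nf (tri y m 0).mirror.f0 x ^ 2 +
          2 * x * nf (tri y m 0).mirror.f0 x) + 2 * m) ?_ ?_ ?_
      · filter_upwards [hG.codiscrete_nf] with z hz
        obtain ⟨-, e1, e2, e3⟩ := hz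
        simp only [Tri.cyc] at e1 e2 e3
        rw [e2, e1]
        have e4 : (tri y m 0).mirror.f1 z = 0 := by simp [Tri.mirror, tri]
        rw [e4] at e3 ⊢
        linear_combination (-(tri y m 0).mirror.f0 z) * e3
      · exact hx.deriv.continuousAt
      · have := hx.continuousAt
        fun_prop
  | succ k ih =>
    have h1 := step k ih
    have hG := (hy.gsys m k).mirror.cyc
    have hne := neg_ne_zero.2 (natCast_add_one_ne_zero' m k)
    have hG' := hG.refl hne
    have hk : (k : ℂ) + 1 ≠ 0 := by exact_mod_cast Nat.succ_ne_zero k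
    have e : (tri y m (k + 1)).mirror.f1 =
        ((tri y m k).mirror.cyc.refl (-((m : ℂ) + k + 1))).f1 := by
      rw [tri, Tri.mirror_stepA]
      rfl
    rw [e] at h1
    have h2 := hG'.classical_inftyMinus h1 (hG'.f1_ne (by
      intro h
      apply hk
      linear_combination -h))
    convert h2 using 1
    · push_cast; ring
    · ring
    · rw [tri, Tri.mirror_stepA]
      simp only [Tri.stepB, Tri.cyc, Tri.refl]
      congr 1
      funext x
      ring

end classical

/-! ### The rational solutions -/

/-- Equality of triples outside a discrete set. -/
def Tri.Ae (F G : Tri) : Prop :=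
  ∀ᶠ x in codiscrete ℂ, F.f0 x = G.f0 x ∧ F.f1 x = G.f1 x ∧ F.f2 x = G.f2 x

lemma Tri.Ae.symm {F G : Tri} (h : F.Ae G) : G.Ae F :=
  h.mono fun _ hx => ⟨hx.1.symm, hx.2.1.symm, hx.2.2.symm⟩

lemma Tri.Ae.trans {F G H : Tri} (h : F.Ae G) (h' : G.Ae H) : F.Ae H := by
  filter_upwards [h, h'] with x h1 h2
  exact ⟨h1.1.trans h2.1, h1.2.1.trans h2.2.1, h1.2.2.trans h2.2.2⟩

lemma Tri.Ae.stepA {F G : Tri} (h : F.Ae G) (a1 a2 : ℂ) : (F.stepA a1 a2).Ae (G.stepA a1 a2) := by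
  filter_upwards [h] with x hx
  simp only [Tri.stepA, Tri.cyc, Tri.refl, hx.1, hx.2.1, hx.2.2]
  exact ⟨trivial, trivial, trivial⟩

lemma Tri.Ae.stepB {F G : Tri} (h : F.Ae G) (a0 a2 : ℂ) : (F.stepB a0 a2).Ae (G.stepB a0 a2) := by
  filter_upwards [h] with x hx
  simp only [Tri.stepB, hx.1, hx.2.1, hx.2.2]
  exact ⟨trivial, trivial, trivial⟩

lemma Tri.Ae.mirror {F G : Tri} (h : F.Ae G) : F.mirror.Ae G.mirror := by
  filter_upwards [eventually_codiscrete_mul_I h] with x hx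
  simp only [Tri.mirror, hx.1, hx.2.1, hx.2.2]
  exact ⟨trivial, trivial, trivial⟩

/-- The braid relation `s₀ s₁ s₀ = s₁ s₀ s₁` of the reflections with parameters `a` and `b`, on the
components with index `0` and `1`. -/
lemma braid {g0 g1 a b : ℂ} (h0 : g0 ≠ 0) (h1 : g1 ≠ 0) (hp : g0 - b / g1 ≠ 0)
    (hr : g1 + a / g0 ≠ 0) :
    (g0 - b / g1) - a / (g1 + (a + b) / (g0 - b / g1)) = g0 - (a + b) / (g1 + a / g0) := by
  have e1 : g0 - b / g1 = (g0 * g1 - b) / g1 := by field_simp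
  have e3 : g1 + a / g0 = (g0 * g1 + a) / g0 := by field_simp
  have hp' : g0 * g1 - b ≠ 0 := fun h => hp (by rw [e1, h, zero_div])
  have hr' : g0 * g1 + a ≠ 0 := fun h => hr (by rw [e3, h, zero_div])
  have e2 : g1 + (a + b) / ((g0 * g1 - b) / g1) = g1 * (g0 * g1 + a) / (g0 * g1 - b) := by
    rw [div_div_eq_mul_div, eq_div_iff hp', add_mul, div_mul_cancel₀ _ hp']; ring
  rw [e3, e1, e2, div_div_eq_mul_div, div_div_eq_mul_div, div_sub_div _ _ h1 (mul_ne_zero h1 hr'),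
    eq_sub_iff_add_eq, div_add_div _ _ (mul_ne_zero h1 (mul_ne_zero h1 hr')) hr', div_eq_iff]
  · ring
  · exact mul_ne_zero (mul_ne_zero h1 (mul_ne_zero h1 hr')) hr'

/-- The two translations commute. -/
lemma Tri.stepA_stepB_comm {a0 a1 a2 : ℂ} {F : Tri} {x : ℂ} (hs : a0 + a1 + a2 = -1)
    (h0 : F.f0 x + 2 * a2 / F.f2 x ≠ 0) (h1 : F.f1 x - 2 * a2 / F.f2 x ≠ 0)
    (hp : (F.stepA a1 a2).f2 x ≠ 0) (hr : (F.stepB a0 a2).f2 x ≠ 0) :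
    ((F.stepA a1 a2).stepB (a0 + 1) (a2 - 1)).f0 x =
        ((F.stepB a0 a2).stepA (a1 + 1) (a2 - 1)).f0 x ∧
      ((F.stepA a1 a2).stepB (a0 + 1) (a2 - 1)).f1 x =
        ((F.stepB a0 a2).stepA (a1 + 1) (a2 - 1)).f1 x ∧
      ((F.stepA a1 a2).stepB (a0 + 1) (a2 - 1)).f2 x =
        ((F.stepB a0 a2).stepA (a1 + 1) (a2 - 1)).f2 x := by
  have e0 : 2 * (a0 + 1 + (a2 - 1)) = 2 * (a0 + a2) := by ring
  have e1 : 2 * (a1 + 1 + (a2 - 1)) = 2 * (a1 + a2) := by ring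
  have e2 : 2 * (a2 - 1) = 2 * (a0 + a2) + 2 * (a1 + a2) := by linear_combination -2 * hs
  have e3 : F.f0 x + 2 * a2 / F.f2 x - 2 * (a1 + a2) / (F.f1 x - 2 * a2 / F.f2 x) ≠ 0 := hp
  have e4 : F.f1 x - 2 * a2 / F.f2 x + 2 * (a0 + a2) / (F.f0 x + 2 * a2 / F.f2 x) ≠ 0 := hr
  have b1 := braid h0 h1 e3 e4
  have b2 := braid (a := -(2 * (a1 + a2))) (b := -(2 * (a0 + a2))) h1 h0
    (by rwa [neg_div, sub_neg_eq_add]) (by rwa [neg_div, ← sub_eq_add_neg])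
  simp only [stepA, stepB, cyc, Tri.refl, e0, e1, e2]
  generalize F.f0 x + 2 * a2 / F.f2 x = g0 at *
  generalize F.f1 x - 2 * a2 / F.f2 x = g1 at *
  have b3 : g1 + (2 * (a0 + a2) + 2 * (a1 + a2)) / (g0 - 2 * (a1 + a2) / g1) =
      g1 + 2 * (a0 + a2) / g0 +
        2 * (a1 + a2) / (g0 - (2 * (a0 + a2) + 2 * (a1 + a2)) / (g1 + 2 * (a0 + a2) / g0)) := by
    have n1 : -(2 * (a1 + a2)) + -(2 * (a0 + a2)) = -(2 * (a0 + a2) + 2 * (a1 + a2)) := by ring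
    simp only [n1, neg_div, sub_neg_eq_add, ← sub_eq_add_neg] at b2
    exact b2.symm
  exact ⟨b1, b3, by linear_combination -b1 - b3⟩

lemma IsSeed.stepB_tri {y : ℂ → ℂ} (hy : IsSeed y) (m k : ℕ) :
    ((tri y m k).stepB k (-((m : ℂ) + k + 1))).Ae (tri y (m + 1) k) := by
  have hc := natCast_add_one_ne_zero'
  induction k with
  | zero =>
    filter_upwards [(hy.gsys m 0).f2_ne (neg_ne_zero.2 (hc m 0))] with x hx
    have h1 : 2 * x + ricc y m x ≠ 0 := fun h => hx (by
      simp only [tri]; linear_combination -h)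
    have h2 : (m : ℂ) + 1 ≠ 0 := by exact_mod_cast Nat.succ_ne_zero m
    simp only [tri, Tri.stepB, ricc]
    have e : -(2 * x) - ricc y m x = -(2 * x + ricc y m x) := by ring
    simp only [e]
    push_cast
    refine ⟨?_, ?_, ?_⟩ <;> field_simp <;> ring
  | succ k ih =>
    have hG := hy.gsys m k
    have hk : (k : ℂ) + 1 ≠ 0 := by exact_mod_cast Nat.succ_ne_zero k
    have hm : (m : ℂ) + 1 ≠ 0 := by exact_mod_cast Nat.succ_ne_zero m
    have hR := hG.refl_two (neg_ne_zero.2 (hc m k))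
    have hf2 := (hy.gsys m (k + 1)).f2_ne (neg_ne_zero.2 (hc m (k + 1)))
    have hf2' := (hy.gsys (m + 1) k).f2_ne (neg_ne_zero.2 (hc (m + 1) k))
    have hcomm : (((tri y m k).stepA m (-((m : ℂ) + k + 1))).stepB (k + 1)
        (-((m : ℂ) + k + 1) - 1)).Ae (((tri y m k).stepB k (-((m : ℂ) + k + 1))).stepA
          (m + 1) (-((m : ℂ) + k + 1) - 1)) := by
      filter_upwards [hR.f0_ne (by intro h; apply hm; linear_combination -h),
        hR.f1_ne (by intro h; apply hk; linear_combination -h), hf2, hf2', ih] with x h0 h1 h2 h3 h4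
      exact Tri.stepA_stepB_comm (by ring) h0 h1 h2 (by rw [h4.2.2]; exact h3)
    have h := hcomm.trans (ih.stepA (m + 1) (-((m : ℂ) + k + 1) - 1))
    convert h using 2
    · push_cast; ring
    · push_cast; ring
    · rfl
    · simp only [tri]
      congr 1
      · push_cast; ring
      · push_cast; ring

/-- The rational solutions are permuted by the symmetry `x ↦ i x`. -/
lemma mirror_tri_zero (m k : ℕ) :
    (tri (fun _ => 0) m k).mirror.Ae (tri (fun _ => 0) k m) := by
  induction k with
  | zero =>
    induction m with
    | zero =>
      refine Eventually.of_forall fun x => ?_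
      simp only [Tri.mirror, tri, ricc]
      refine ⟨by ring, by ring, ?_⟩
      linear_combination 2 * x * Complex.I_sq
    | succ m ih =>
      have h := (isSeed_zero.stepB_tri m 0).mirror
      rw [Tri.mirror_stepB] at h
      refine h.symm.trans ?_
      convert ih.stepA _ _ using 1
      simp only [tri]
      congr 1
      push_cast; ring
  | succ k ih =>
    have h := ih.stepB m (-((m : ℂ) + k + 1))
    rw [← Tri.mirror_stepA] at h
    refine Tri.Ae.trans h ?_
    convert isSeed_zero.stepB_tri k m using 2
    ring

/-! ### Asymptotics along the hierarchy -/

lemma Lead.secO_of_zero {a b : ℝ} {k : ℤ} {f : ℂ → ℂ} (h : Lead a b 0 k f) :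
    SecO a b (k - 2) f := SecO.congr h (SecEv.of_forall fun x => by ring)

/-- The difference of the reciprocals of two functions with the same leading term, in units of
`E`. -/
lemma Lead.div_sub_div {a b : ℝ} {A B : ℂ} {p κ : ℤ} {f g E : ℂ → ℂ} (hA : A ≠ 0)
    (hf : Lead a b A p f) (hg : Lead a b A p g) (h : Lead a b B κ fun x => (f x - g x) / E x)
    (r : ℂ) :
    Lead a b (-r * B / A ^ 2) (κ - 2 * p) fun x => (r / f x - r / g x) / E x := by
  refine (((h.const_mul (-r)).div (hf.mul hg) (mul_ne_zero hA hA)).cast (by rw [sq])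
    (by ring)).congr ?_
  refine ((hf.secEv_ne_zero hA).and (hg.secEv_ne_zero hA)).mono fun x hx => ?_
  obtain ⟨h1, h2⟩ := hx
  have e : r / f x - r / g x = -r * (f x - g x) / (f x * g x) := by field_simp; ring
  rw [e]
  ring

/-- The solution `F` of the symmetric form with parameters `(k, m, -m - k - 1)` is dominated by its
component with index `2` in the sector `a < arg x < b`. -/
structure BgTwo (a b : ℝ) (m k : ℕ) (F : Tri) : Prop where
  sys : SecEv a b (Sys k m (-((m : ℂ) + k + 1)) F)
  l0 : Lead a b (-k) (-1) F.f0
  l1 : Lead a b m (-1) F.f1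
  l2 : Lead a b (-2) 1 F.f2

/-- The solution `F` of the symmetric form with parameters `(k, m, -m - k - 1)` is dominated by its
component with index `1` in the sector `a < arg x < b`. -/
structure BgOne (a b : ℝ) (m k : ℕ) (F : Tri) : Prop where
  sys : SecEv a b (Sys k m (-((m : ℂ) + k + 1)) F)
  l0 : Lead a b k (-1) F.f0
  l1 : Lead a b (-2) 1 F.f1
  l2 : Lead a b (m + k + 1) (-1) F.f2

section bg

variable {a b : ℝ} {m k : ℕ} {F G : Tri} {y z E : ℂ → ℂ} {C : ℂ} {κ : ℤ}

lemma BgTwo.of_sys (h : SecEv a b (Sys k m (-((m : ℂ) + k + 1)) F))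
    (h0 : Lead a b (-k) (-1) F.f0) (h1 : SecO a b (-1) F.f1) : BgTwo a b m k F := by
  have h2 : Lead a b (-2) 1 F.f2 := by
    refine ((lead_linear a b (-2)).add_secO (h0.secO.add h1).neg).congr (h.mono fun x hx => ?_)
    linear_combination -hx.sum
  refine ⟨h, h0, ?_, h2⟩
  have hq : Lead a b (-2) 1 fun x => F.f2 x - F.f0 x :=
    (h2.add_secO h0.secO.neg).congr (SecEv.of_forall fun x => by ring)
  exact (Lead.of_linear_ode (by norm_num) h1 hq (h.mono fun x hx => hx.d1)).cast (by ring) rfl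

lemma BgOne.of_sys (h : SecEv a b (Sys k m (-((m : ℂ) + k + 1)) F))
    (h0 : Lead a b k (-1) F.f0) (h1 : Lead a b (-2) 1 F.f1) : BgOne a b m k F := by
  have h2 : SecO a b (-1) F.f2 := by
    refine ((((lead_linear a b (-2)).sub h1).cast (sub_self _) rfl).secO_of_zero.add
      h0.secO.neg).congr (h.mono fun x hx => ?_)
    linear_combination -hx.sum
  refine ⟨h, h0, h1, ?_⟩
  have hq : Lead a b 2 1 fun x => F.f0 x - F.f1 x :=
    ((h1.neg.cast (neg_neg _) rfl).add_secO h0.secO).congr (SecEv.of_forall fun x => by ring)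
  exact (Lead.of_linear_ode (by norm_num) h2 hq (h.mono fun x hx => hx.d2)).cast (by ring) rfl

lemma natCast_succ_ne (k : ℕ) : (k : ℂ) + 1 ≠ 0 := by exact_mod_cast Nat.succ_ne_zero k

lemma Sys.stepA {x : ℂ} (h : Sys k m (-((m : ℂ) + k + 1)) F x) (h2 : F.f2 x ≠ 0)
    (h1 : F.f1 x - 2 * -((m : ℂ) + k + 1) / F.f2 x ≠ 0) :
    Sys ((k + 1 : ℕ) : ℂ) m (-((m : ℂ) + (k + 1 : ℕ) + 1)) (F.stepA m (-((m : ℂ) + k + 1))) x := by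
  have := ((h.cyc.refl h2).cyc).refl h1
  convert this using 1
  · push_cast; ring
  · ring
  · push_cast; ring
  · rfl

lemma BgTwo.lead_g1 (h : BgTwo a b m k F) : Lead a b (-((k : ℂ) + 1)) (-1)
    fun x => F.f1 x - 2 * -((m : ℂ) + k + 1) / F.f2 x := by
  have h1 := (lead_const a b (2 * -((m : ℂ) + k + 1))).div h.l2 (by norm_num)
  exact (h.l1.sub (h1.cast rfl (by norm_num))).cast (by ring) rfl

lemma BgTwo.stepA (h : BgTwo a b m k F) :
    BgTwo a b m (k + 1) (F.stepA m (-((m : ℂ) + k + 1))) := by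
  have hk : -((k : ℂ) + 1) ≠ 0 := neg_ne_zero.2 (natCast_succ_ne k)
  have hg := h.lead_g1
  refine BgTwo.of_sys ?_ ?_ ?_
  · exact ((h.sys.and (h.l2.secEv_ne_zero (by norm_num))).and (hg.secEv_ne_zero hk)).mono
      fun x hx => hx.1.1.stepA hx.1.2 hx.2
  · exact hg.cast (by push_cast; ring) rfl
  · have h1 := (lead_const a b (2 * ((m : ℂ) + -((m : ℂ) + k + 1)))).div hg hk
    exact ((h.l2.add (h1.cast rfl (by norm_num))).cast (D := 0) (by
      have := natCast_succ_ne k; field_simp; ring) rfl).secO_of_zero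

lemma BgOne.lead_g1 (h : BgOne a b m k F) : Lead a b ((k : ℂ) + 1) (-1)
    fun x => F.f1 x - 2 * -((m : ℂ) + k + 1) / F.f2 x := by
  have hn := natCast_add_one_ne_zero' m k
  have h1 : Lead a b (-2) 1 fun x => 2 * -((m : ℂ) + k + 1) / F.f2 x :=
    ((lead_const a b (2 * -((m : ℂ) + k + 1))).div h.l2 hn).cast (by field_simp) (by norm_num)
  have hO := ((h.l1.sub h1).cast (D := 0) (by norm_num) rfl).secO_of_zero
  have hq : Lead a b 2 1 fun x => F.f2 x - (F.f0 x + 2 * -((m : ℂ) + k + 1) / F.f2 x) :=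
    ((h1.neg.cast (neg_neg _) rfl).add_secO (h.l2.secO.sub h.l0.secO)).congr
      (SecEv.of_forall fun x => by ring)
  refine (Lead.of_linear_ode (κ := 2 * ((m : ℂ) + -((m : ℂ) + k + 1))) (by norm_num) hO hq
    ((h.sys.and (h.l2.secEv_ne_zero hn)).mono fun x hx => ?_)).cast (by ring) rfl
  exact ((hx.1.cyc.refl hx.2).cyc.cyc).d1

lemma BgOne.stepA (h : BgOne a b m k F) :
    BgOne a b m (k + 1) (F.stepA m (-((m : ℂ) + k + 1))) := by
  have hk := natCast_succ_ne k
  have hg := h.lead_g1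
  refine BgOne.of_sys ?_ ?_ ?_
  · exact ((h.sys.and (h.l2.secEv_ne_zero (natCast_add_one_ne_zero' m k))).and
      (hg.secEv_ne_zero hk)).mono fun x hx => hx.1.1.stepA hx.1.2 hx.2
  · exact hg.cast (by push_cast; ring) rfl
  · have h1 : Lead a b (-2) 1 fun x => 2 * ((m : ℂ) + -((m : ℂ) + k + 1)) /
        (F.f1 x - 2 * -((m : ℂ) + k + 1) / F.f2 x) :=
      ((lead_const a b (2 * ((m : ℂ) + -((m : ℂ) + k + 1)))).div hg hk).cast
        (by field_simp; ring) (by norm_num)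
    exact (h1.add_secO h.l2.secO).congr (SecEv.of_forall fun x => add_comm _ _)

lemma secEv_sys_tri_zero (h : SecEv a b fun x =>
    HasDerivAt (ricc y m) (ricc y m x * (-(2 * x) - ricc y m x) + 2 * m) x) :
    SecEv a b (Sys (0 : ℕ) m (-((m : ℂ) + (0 : ℕ) + 1)) (tri y m 0)) :=
  h.mono fun x hx => by simpa using tri_zero_sys hx

lemma Sys.tri_zero_f1 {x : ℂ}
    (h : Sys (0 : ℕ) m (-((m : ℂ) + (0 : ℕ) + 1)) (tri y m 0) x) :
    HasDerivAt (ricc y m) (ricc y m x * (-(2 * x) - ricc y m x) + 2 * m) x := by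
  simpa [tri] using h.d1

lemma bgTwo_tri (hd : SecEv a b fun x => HasDerivAt y (y x * (-(2 * x) - y x)) x)
    (hy : SecO a b (-3) y) (m k : ℕ) : BgTwo a b m k (tri y m k) := by
  induction k with
  | zero =>
    have hl0 : Lead a b (-((0 : ℕ) : ℂ)) (-1) (tri y m 0).f0 :=
      (Lead.of_secO (secO_zero a b _)).cast (by simp) rfl
    induction m with
    | zero =>
      refine BgTwo.of_sys (secEv_sys_tri_zero (hd.mono fun x hx => ?_)) hl0 (hy.mono (by norm_num))
      simpa [ricc] using hx
    | succ m ih =>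
      have h := ih (Lead.of_secO (secO_zero a b _) |>.cast (by simp) rfl)
      have h1 : Lead a b 2 1 fun x => 2 * x + ricc y m x :=
        (lead_linear a b 2).add_secO (SecO.mono h.l1.secO (by norm_num))
      refine BgTwo.of_sys (secEv_sys_tri_zero ?_) hl0 ?_
      · exact (h.sys.and (h1.secEv_ne_zero two_ne_zero)).mono fun x hx =>
          hasDerivAt_ricc_succ hx.2 hx.1.tri_zero_f1
      · exact ((lead_const a b (2 * ((m : ℂ) + 1))).div h1 two_ne_zero).secO.cast (by norm_num)
  | succ k ih => exact ih.stepA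

lemma BgOne.lead_ricc_den (h : BgOne a b m 0 (tri y m 0)) :
    Lead a b (-((m : ℂ) + 1)) (-1) fun x => 2 * x + ricc y m x :=
  (h.l2.neg.cast (by simp) rfl).congr (SecEv.of_forall fun x => by simp only [tri]; ring)

lemma bgOne_tri (hd : SecEv a b fun x => HasDerivAt y (y x * (-(2 * x) - y x)) x)
    (hy : Lead a b (-2) 1 y) (m k : ℕ) : BgOne a b m k (tri y m k) := by
  induction k with
  | zero =>
    have hl0 : ∀ m, Lead a b ((0 : ℕ) : ℂ) (-1) (tri y m 0).f0 := fun m =>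
      (Lead.of_secO (secO_zero a b _)).cast (by simp) rfl
    induction m with
    | zero =>
      refine BgOne.of_sys (secEv_sys_tri_zero (hd.mono fun x hx => ?_)) (hl0 0) hy
      simpa [ricc] using hx
    | succ m ih =>
      have hm : -((m : ℂ) + 1) ≠ 0 := neg_ne_zero.2 (natCast_succ_ne m)
      have h1 := ih.lead_ricc_den
      refine BgOne.of_sys (secEv_sys_tri_zero ?_) (hl0 _) ?_
      · exact (ih.sys.and (h1.secEv_ne_zero hm)).mono fun x hx =>
          hasDerivAt_ricc_succ hx.2 hx.1.tri_zero_f1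
      · exact ((lead_const a b (2 * ((m : ℂ) + 1))).div h1 hm).cast
          (by have := natCast_succ_ne m; field_simp) (by norm_num)
  | succ k ih => exact ih.stepA

/-- The difference of `F` and `G`, in units of `E`, has in the component with index `1` the leading
term `C x ^ κ`, and is smaller in the component with index `0`. -/
structure DiffLead (a b : ℝ) (C : ℂ) (κ : ℤ) (E : ℂ → ℂ) (F G : Tri) : Prop where
  l1 : Lead a b C κ fun x => (F.f1 x - G.f1 x) / E x
  l0 : SecO a b (κ - 2) fun x => (F.f0 x - G.f0 x) / E x

lemma DiffLead.l2 {a0 a1 a2 : ℂ} (h : DiffLead a b C κ E F G) (hF : SecEv a b (Sys a0 a1 a2 F))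
    (hG : SecEv a b (Sys a0 a1 a2 G)) : Lead a b (-C) κ fun x => (F.f2 x - G.f2 x) / E x := by
  refine (h.l1.neg.add_secO h.l0.neg).congr ((hF.and hG).mono fun x hx => ?_)
  rw [show F.f2 x - G.f2 x = -(F.f1 x - G.f1 x) - (F.f0 x - G.f0 x) by
    linear_combination hx.1.sum - hx.2.sum]
  ring

/-- In a sector dominated by the component `2`, the perturbation `e^{-x²}` keeps its leading term
in the step to the new component `0`, and is multiplied by `2x² / (k + 1)` in the new
component `1`. -/
lemma BgTwo.diffLead_stepA (hF : BgTwo a b m k F) (hG : BgTwo a b m k G)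
    (h : DiffLead a b C κ E F G) :
    Lead a b C κ (fun x => ((F.stepA m (-((m : ℂ) + k + 1))).f0 x -
        (G.stepA m (-((m : ℂ) + k + 1))).f0 x) / E x) ∧
      DiffLead a b (C * (2 / (k + 1))) (κ + 2) E (F.stepA m (-((m : ℂ) + k + 1)))
        (G.stepA m (-((m : ℂ) + k + 1))) := by
  have hk : -((k : ℂ) + 1) ≠ 0 := neg_ne_zero.2 (natCast_succ_ne k)
  have h2 := h.l2 hF.sys hG.sys
  have e1 := Lead.div_sub_div (by norm_num) hF.l2 hG.l2 h2 (2 * -((m : ℂ) + k + 1))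
  have e2 : Lead a b C κ (fun x => ((F.stepA m (-((m : ℂ) + k + 1))).f0 x -
        (G.stepA m (-((m : ℂ) + k + 1))).f0 x) / E x) :=
    (h.l1.add_secO (e1.secO.neg.cast (by ring))).congr (SecEv.of_forall fun x => by
      simp only [Tri.stepA, Tri.cyc, Tri.refl]; ring)
  refine ⟨e2, ?_, e2.secO.cast (by ring)⟩
  have e3 := Lead.div_sub_div hk hF.lead_g1 hG.lead_g1 e2 (2 * ((m : ℂ) + -((m : ℂ) + k + 1)))
  have e4 : Lead a b (C * (2 / (k + 1))) (κ + 2) _ := e3.cast (by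
    have := natCast_succ_ne k; field_simp; ring) (by ring)
  refine (e4.add_secO (h2.secO.cast (by ring))).congr (SecEv.of_forall fun x => ?_)
  simp only [Tri.stepA, Tri.cyc, Tri.refl]; ring

/-- In a sector dominated by the component `1`, the perturbation `e^{x²}` is multiplied by
`2x² / (m + k + 1)` in the step to the new component `0`, and by a further `2x² / (k + 1)` in the
new component `1`. -/
lemma BgOne.diffLead_stepA (hF : BgOne a b m k F) (hG : BgOne a b m k G)
    (h : DiffLead a b C κ E F G) :
    Lead a b (C * (2 / (m + k + 1))) (κ + 2) (fun x => ((F.stepA m (-((m : ℂ) + k + 1))).f0 x -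
        (G.stepA m (-((m : ℂ) + k + 1))).f0 x) / E x) ∧
      DiffLead a b (C * (4 / ((m + k + 1) * (k + 1)))) (κ + 4) E
        (F.stepA m (-((m : ℂ) + k + 1))) (G.stepA m (-((m : ℂ) + k + 1))) := by
  have hk := natCast_succ_ne k
  have hn := natCast_add_one_ne_zero' m k
  have h2 := h.l2 hF.sys hG.sys
  have e1 := (Lead.div_sub_div hn hF.l2 hG.l2 h2 (2 * -((m : ℂ) + k + 1))).neg
  have e2 : Lead a b (C * (2 / (m + k + 1))) (κ + 2) (fun x =>
      ((F.stepA m (-((m : ℂ) + k + 1))).f0 x -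
        (G.stepA m (-((m : ℂ) + k + 1))).f0 x) / E x) :=
    ((e1.cast (D := C * (2 / (m + k + 1))) (by field_simp)
      (show _ = κ + 2 by ring)).add_secO (h.l1.secO.cast (by ring))).congr
      (SecEv.of_forall fun x => by simp only [Tri.stepA, Tri.cyc, Tri.refl]; ring)
  refine ⟨e2, ?_, e2.secO.cast (by ring)⟩
  have e3 := Lead.div_sub_div hk hF.lead_g1 hG.lead_g1 e2 (2 * ((m : ℂ) + -((m : ℂ) + k + 1)))
  have e4 : Lead a b (C * (4 / ((m + k + 1) * (k + 1)))) (κ + 4) _ := e3.cast (by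
    field_simp; ring) (by ring)
  refine (e4.add_secO (SecO.mono h2.secO (by linarith))).congr (SecEv.of_forall fun x => ?_)
  simp only [Tri.stepA, Tri.cyc, Tri.refl]; ring

lemma diffLead_tri_zero (h : Lead a b C κ fun x => (ricc y m x - ricc z m x) / E x) :
    DiffLead a b C κ E (tri y m 0) (tri z m 0) :=
  ⟨h, (secO_zero a b _).congr (SecEv.of_forall fun x => by simp [tri])⟩

/-- The exponentially small differences in sectors dominated by the component `2`. -/
lemma diffLead_tri_two (hF : ∀ m k, BgTwo a b m k (tri y m k))
    (hG : ∀ m k, BgTwo a b m k (tri z m k)) (h : Lead a b C 0 fun x => (y x - z x) / E x)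
    (m k : ℕ) :
    DiffLead a b (C * ((-1) ^ m * m.factorial * 2 ^ k / (2 ^ m * k.factorial)))
      (2 * k - 2 * m) E (tri y m k) (tri z m k) := by
  induction k with
  | zero =>
    refine diffLead_tri_zero ?_
    induction m with
    | zero => simpa [ricc] using h
    | succ m ih =>
      have hl : ∀ {w : ℂ → ℂ}, BgTwo a b m 0 (tri w m 0) →
          Lead a b 2 1 fun x => 2 * x + ricc w m x := fun h =>
        (lead_linear a b 2).add_secO (SecO.mono h.l1.secO (by norm_num))
      have := Lead.div_sub_div two_ne_zero (hl (hF m 0)) (hl (hG m 0))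
        (ih.congr (SecEv.of_forall fun x => by rw [add_sub_add_left_eq_sub])) (2 * ((m : ℂ) + 1))
      refine this.cast ?_ (by push_cast; ring)
      rw [Nat.factorial_succ, pow_succ, pow_succ]
      push_cast
      field_simp
      ring
  | succ k ih =>
    have h1 := ((hF m k).diffLead_stepA (hG m k) ih).2
    have e1 : C * ((-1) ^ m * m.factorial * 2 ^ k / (2 ^ m * k.factorial)) * (2 / ((k : ℂ) + 1)) =
        C * ((-1) ^ m * m.factorial * 2 ^ (k + 1) / (2 ^ m * (k + 1).factorial)) := by
      rw [Nat.factorial_succ, pow_succ]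
      have := natCast_succ_ne k
      have : (k.factorial : ℂ) ≠ 0 := by exact_mod_cast k.factorial_ne_zero
      push_cast
      field_simp
    have e2 : (2 * (k : ℤ) - 2 * m + 2) = 2 * ((k + 1 : ℕ) : ℤ) - 2 * m := by push_cast; ring
    rwa [e1, e2] at h1

/-- The exponentially small differences in sectors dominated by the component `1`. -/
lemma diffLead_tri_one (hF : ∀ m k, BgOne a b m k (tri y m k))
    (hG : ∀ m k, BgOne a b m k (tri z m k)) (h : Lead a b C 2 fun x => (y x - z x) / E x)
    (m k : ℕ) :
    DiffLead a b (C * ((-1) ^ m * 2 ^ m * 4 ^ k / ((m + k).factorial * k.factorial)))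
      (4 * k + 2 * m + 2) E (tri y m k) (tri z m k) := by
  induction k with
  | zero =>
    refine diffLead_tri_zero ?_
    induction m with
    | zero => simpa [ricc] using h
    | succ m ih =>
      have := Lead.div_sub_div (neg_ne_zero.2 (natCast_succ_ne m)) (hF m 0).lead_ricc_den
        (hG m 0).lead_ricc_den
        (ih.congr (SecEv.of_forall fun x => by rw [add_sub_add_left_eq_sub])) (2 * ((m : ℂ) + 1))
      refine this.cast ?_ (by push_cast; ring)
      have := natCast_succ_ne m
      have : (m.factorial : ℂ) ≠ 0 := by exact_mod_cast m.factorial_ne_zero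
      rw [add_zero, add_zero, Nat.factorial_succ, pow_succ, pow_succ]
      push_cast
      field_simp
      ring
  | succ k ih =>
    have h1 := ((hF m k).diffLead_stepA (hG m k) ih).2
    have e1 : C * ((-1) ^ m * 2 ^ m * 4 ^ k / ((m + k).factorial * k.factorial)) *
        (4 / (((m : ℂ) + k + 1) * (k + 1))) =
        C * ((-1) ^ m * 2 ^ m * 4 ^ (k + 1) / ((m + (k + 1)).factorial * (k + 1).factorial)) := by
      rw [← add_assoc, Nat.factorial_succ, Nat.factorial_succ, pow_succ]
      have := natCast_succ_ne k
      have := natCast_add_one_ne_zero' m k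
      have : (k.factorial : ℂ) ≠ 0 := by exact_mod_cast k.factorial_ne_zero
      have : ((m + k).factorial : ℂ) ≠ 0 := by exact_mod_cast (m + k).factorial_ne_zero
      push_cast
      field_simp
    have e2 : (4 * (k : ℤ) + 2 * m + 2 + 4) = 4 * ((k + 1 : ℕ) : ℤ) + 2 * m + 2 := by
      push_cast; ring
    rwa [e1, e2] at h1

end bg

/-! ### The solutions of the Riccati equation -/

/-- The solution `-2 e^{-x²} / (γ + 2 ∫_x^∞ e^{-t²} dt)` of `y' = -(y² + 2xy)`. -/
noncomputable def seed (γ : ℂ) (x : ℂ) : ℂ := -2 * Complex.exp (-x ^ 2) / (γ + erfcTwo x)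

lemma hasDerivAt_seed {γ x : ℂ} (hx : γ + erfcTwo x ≠ 0) :
    HasDerivAt (seed γ) (seed γ x * (-(2 * x) - seed γ x)) x := by
  have h1 : HasDerivAt (fun x : ℂ => -2 * Complex.exp (-x ^ 2))
      (-2 * (Complex.exp (-x ^ 2) * (-(2 * x)))) x := by
    have := (((hasDerivAt_pow 2 x).neg).cexp).const_mul (-2)
    simpa using this
  convert! h1.div ((hasDerivAt_erfcTwo x).const_add γ) hx using 1
  simp only [seed]
  field_simp
  ring

lemma erfcTwo_codiscrete_ne (γ : ℂ) : ∀ᶠ x in codiscrete ℂ, γ + erfcTwo x ≠ 0 := by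
  have hd : Differentiable ℂ fun x => γ + erfcTwo x :=
    fun x => ((hasDerivAt_erfcTwo x).const_add γ).differentiableAt
  refine codiscrete_ne_zero_of_ode (q := fun _ => 0) (c := fun x => -2 * Complex.exp (-x ^ 2))
    (fun x => (hd.analyticAt x).meromorphicAt)
    (fun x => mul_ne_zero (by norm_num) (Complex.exp_ne_zero _)) (Eventually.of_forall fun x => ?_)
  simpa using (hasDerivAt_erfcTwo x).const_add γ

lemma isSeed_seed (γ : ℂ) : IsSeed (seed γ) := by
  have hd : Differentiable ℂ fun x => γ + erfcTwo x :=
    fun x => ((hasDerivAt_erfcTwo x).const_add γ).differentiableAt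
  have he : Differentiable ℂ fun x : ℂ => -2 * Complex.exp (-x ^ 2) := by fun_prop
  refine ⟨fun x => ((he.analyticAt x).meromorphicAt).div (hd.analyticAt x).meromorphicAt, ?_⟩
  filter_upwards [erfcTwo_codiscrete_ne γ] with x hx using hasDerivAt_seed hx

lemma seed_codiscrete_ne (γ : ℂ) : ∀ᶠ x in codiscrete ℂ, seed γ x ≠ 0 := by
  filter_upwards [erfcTwo_codiscrete_ne γ] with x hx
  exact div_ne_zero (mul_ne_zero (by norm_num) (Complex.exp_ne_zero _)) hx

/-! ### The seed solutions in sectors -/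

lemma pt_sub_two_pi (r θ : ℝ) (j : ℤ) : pt r (θ - 2 * Real.pi * j) = pt r θ := by
  simp only [pt]
  congr 1
  refine Complex.exp_eq_exp_iff_exists_int.2 ⟨-j, ?_⟩
  push_cast
  ring

lemma abs_sub_le_max {s t θ c : ℝ} (h1 : s ≤ θ) (h2 : θ ≤ t) :
    |θ - c| ≤ max 0 (max (c - s) (t - c)) := by
  refine le_max_of_le_right ?_
  rcases abs_cases (θ - c) with h | h
  · exact le_max_of_le_right (by linarith)
  · exact le_max_of_le_left (by linarith)

/-- The asymptotics of the complementary error function, for arguments normalized around `2πj`. -/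
lemma lead_erfcTwo (j : ℤ) :
    Lead (2 * Real.pi * j - 3 * Real.pi / 4) (2 * Real.pi * j + 3 * Real.pi / 4) 1 0
      fun x => x * Complex.exp (x ^ 2) * erfcTwo x := by
  intro s t hs ht
  have hM : max 0 (max (2 * Real.pi * j - s) (t - 2 * Real.pi * j)) < 3 * Real.pi / 4 :=
    max_lt (by linarith [Real.pi_pos]) (max_lt (by linarith) (by linarith))
  set M := max 0 (max (2 * Real.pi * j - s) (t - 2 * Real.pi * j)) with hMd
  have hM0 : 0 ≤ M := le_max_left _ _
  have hc : 0 < Real.cos (2 * M / 3) :=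
    Real.cos_pos_of_mem_Ioo ⟨by linarith [Real.pi_pos], by linarith⟩
  refine Asymptotics.IsBigO.of_bound (1 / (2 * Real.cos (2 * M / 3) ^ 2))
    (eventually_sec.2 ⟨1, fun r hr θ hθ => ?_⟩)
  have hr0 : 0 < r := by linarith
  have h1 := abs_sub_le_max (c := 2 * Real.pi * j) hθ.1 hθ.2
  have h2 := norm_erfcTwo_sub_one_le hr0 (h1.trans_lt hM)
  rw [pt_sub_two_pi] at h2
  have h3 : Real.cos (2 * M / 3) ≤ Real.cos (2 * (θ - 2 * Real.pi * j) / 3) := by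
    rw [← Real.cos_abs (2 * (θ - 2 * Real.pi * j) / 3)]
    refine Real.cos_le_cos_of_nonneg_of_le_pi (abs_nonneg _) (by linarith) ?_
    rw [abs_div, abs_mul, abs_of_pos (by norm_num : (0 : ℝ) < 2),
      abs_of_pos (by norm_num : (0 : ℝ) < 3)]
    linarith
  rw [zpow_zero, mul_one, norm_zpow, norm_pt hr0.le]
  refine h2.trans ?_
  rw [show (0 : ℤ) - 2 = -(2 : ℕ) by norm_num, zpow_neg, zpow_natCast, div_eq_mul_inv _ (r ^ 2)]
  gcongr

/-- For `j ∈ {0, 1}` modulo `4` this is `0`, for `j ∈ {2, 3}` it is `-2√π`: the parameter of the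
seed solution which has no exponentially small term in the two sectors of opening `π/2` around the
directions `(j - 1) π / 2` and `j π / 2`. -/
noncomputable def bgParam (j : ℤ) : ℂ := if j % 4 < 2 then 0 else -2 * sqrtPi

/-- The function `γ + 2 ∫_x^∞ e^{-t²} dt` with `γ = bgParam j` is asymptotic to `e^{-x²} / x` in a
sector of opening `π`. For `γ = -2√π` this is the case `γ = 0` at `-x`. -/
lemma lead_bgParam (j : ℤ) :
    Lead ((j : ℝ) * (Real.pi / 2) - 3 * Real.pi / 4) ((j : ℝ) * (Real.pi / 2) + Real.pi / 4) 1 0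
      fun x => x * Complex.exp (x ^ 2) * (bgParam j + erfcTwo x) := by
  have hp := Real.pi_pos
  have hj : (j : ℝ) = (j % 4 : ℤ) + 4 * (j / 4 : ℤ) := by 
    exact_mod_cast (Int.emod_add_mul_ediv j 4).symm
  have h1 := Int.emod_nonneg j (show (4 : ℤ) ≠ 0 by norm_num)
  have h2 := Int.emod_lt_of_pos j (show (0 : ℤ) < 4 by norm_num)
  by_cases h : j % 4 < 2
  · have h3 : (0 : ℝ) ≤ (j % 4 : ℤ) := by exact_mod_cast h1
    have h4 : ((j % 4 : ℤ) : ℝ) ≤ 1 := by exact_mod_cast (by omega : j % 4 ≤ 1)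
    have h5 : ((j % 4 : ℤ) : ℝ) * (Real.pi / 2) ≤ 1 * (Real.pi / 2) := by gcongr
    have h6 : 0 ≤ ((j % 4 : ℤ) : ℝ) * (Real.pi / 2) := by positivity
    simp only [bgParam, if_pos h, zero_add]
    refine (lead_erfcTwo (j / 4)).subset ?_ ?_ <;> rw [hj] <;> linarith
  · have h3 : (2 : ℝ) ≤ (j % 4 : ℤ) := by exact_mod_cast (by omega : 2 ≤ j % 4)
    have h4 : ((j % 4 : ℤ) : ℝ) ≤ 3 := by exact_mod_cast (by omega : j % 4 ≤ 3)
    have h5 : ((j % 4 : ℤ) : ℝ) * (Real.pi / 2) ≤ 3 * (Real.pi / 2) := by gcongr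
    have h6 : 2 * (Real.pi / 2) ≤ ((j % 4 : ℤ) : ℝ) * (Real.pi / 2) := by gcongr
    simp only [bgParam, if_neg h]
    have h7 : Lead ((j : ℝ) * (Real.pi / 2) - 3 * Real.pi / 4 + (-Real.pi : ℝ))
        ((j : ℝ) * (Real.pi / 2) + Real.pi / 4 + (-Real.pi : ℝ)) 1 0
        fun x => x * Complex.exp (x ^ 2) * erfcTwo x := by
      refine (lead_erfcTwo (j / 4)).subset ?_ ?_ <;> rw [hj] <;> linarith
    have e : Complex.exp ((-Real.pi : ℝ) * Complex.I) = -1 := by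
      rw [Complex.ofReal_neg, neg_mul, Complex.exp_neg, Complex.exp_pi_mul_I]; norm_num
    refine ((h7.rotate (-Real.pi)).cast (by simp) rfl).congr (SecEv.of_forall fun x => ?_)
    rw [e, neg_one_mul, erfcTwo_neg, neg_sq]
    ring

/-- In the sector around the direction `kπ/2` the exponential `e^{∓x²}` is small. -/
lemma secO_expMonomial (k : ℤ) :
    SecO ((k : ℝ) * (Real.pi / 2) - Real.pi / 4) ((k : ℝ) * (Real.pi / 2) + Real.pi / 4) (-4)
      (expMonomial k 0) := by
  intro s t hs ht
  have hM : max 0 (max (k * (Real.pi / 2) - s) (t - k * (Real.pi / 2))) < Real.pi / 4 :=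
    max_lt (by linarith [Real.pi_pos]) (max_lt (by linarith) (by linarith))
  set M := max 0 (max (k * (Real.pi / 2) - s) (t - k * (Real.pi / 2))) with hMd
  have hM0 : 0 ≤ M := le_max_left _ _
  have hc : 0 < Real.cos (2 * M) :=
    Real.cos_pos_of_mem_Ioo ⟨by linarith [Real.pi_pos], by linarith⟩
  refine Asymptotics.IsBigO.of_bound (2 / Real.cos (2 * M) ^ 2)
    (eventually_sec.2 ⟨1, fun r hr θ hθ => ?_⟩)
  have hr0 : 0 < r := by linarith
  have h1 := abs_sub_le_max (c := k * (Real.pi / 2)) hθ.1 hθ.2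
  have h3 : Real.cos (2 * M) ≤ Real.cos (2 * θ - k * Real.pi) := by
    rw [← Real.cos_abs (2 * θ - k * Real.pi)]
    refine Real.cos_le_cos_of_nonneg_of_le_pi (abs_nonneg _) (by linarith) ?_
    rw [show 2 * θ - k * Real.pi = 2 * (θ - k * (Real.pi / 2)) by ring, abs_mul,
      abs_of_pos (by norm_num : (0 : ℝ) < 2)]
    linarith
  rw [Real.cos_sub_int_mul_pi] at h3
  have h4 : ((-1 : ℂ) ^ k * pt r θ ^ 2).re = r ^ 2 * ((-1) ^ k * Real.cos (2 * θ)) := by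
    have e1 : pt r θ ^ 2 = ((r ^ 2 : ℝ) : ℂ) * Complex.exp ((2 * θ : ℝ) * Complex.I) := by
      rw [pt, mul_pow, ← Complex.exp_nat_mul]; push_cast; ring_nf
    have e2 : (-1 : ℂ) ^ k = (((-1 : ℝ) ^ k : ℝ) : ℂ) := by push_cast; rfl
    rw [e1, e2, ← mul_assoc, ← Complex.ofReal_mul, Complex.re_ofReal_mul,
      Complex.exp_ofReal_mul_I_re]
    ring
  rw [expMonomial, zpow_zero, one_mul, Complex.norm_exp, Complex.neg_re, h4, norm_zpow,
    norm_pt hr0.le, show (-4 : ℤ) = -(4 : ℕ) by norm_num, zpow_neg, zpow_natCast, Real.exp_neg,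
    ← div_eq_mul_inv, inv_le_comm₀ (Real.exp_pos _) (by positivity), inv_div]
  have h5 := Real.pow_div_factorial_le_exp (r ^ 2 * ((-1) ^ k * Real.cos (2 * θ)))
    (mul_nonneg (by positivity) (hc.le.trans h3)) 2
  refine le_trans ?_ h5
  rw [Nat.factorial_two, mul_pow, Nat.cast_ofNat, div_div_eq_mul_div, ← pow_mul]
  gcongr

section seed

variable {a b : ℝ} {γ δ : ℂ}

lemma seed_riccati (h : SecEv a b fun x => γ + erfcTwo x ≠ 0) :
    SecEv a b fun x => HasDerivAt (seed γ) (seed γ x * (-(2 * x) - seed γ x)) x :=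
  h.mono fun _ hx => hasDerivAt_seed hx

/-- Where `e^{-x²}` is small, the function `γ + 2 ∫_x^∞ e^{-t²} dt` has the limit `γ - δ`. -/
lemma lead_add_erfcTwo (hE : SecO a b (-4) fun x => Complex.exp (-x ^ 2))
    (h : Lead a b 1 0 fun x => x * Complex.exp (x ^ 2) * (δ + erfcTwo x)) (γ : ℂ) :
    Lead a b (γ - δ) 0 fun x => γ + erfcTwo x := by
  have h1 := (hE.mul (secO_zpow a b (-1))).mul h.secO
  refine ((lead_const a b (γ - δ)).add_secO (SecO.mono h1 (by norm_num))).congr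
    ((secEv_ne a b).mono fun x hx => ?_)
  have := Complex.exp_ne_zero (x ^ 2)
  rw [Complex.exp_neg, zpow_neg_one]
  field_simp
  ring

/-- Where `e^{x²}` is small, the leading term of `γ + 2 ∫_x^∞ e^{-t²} dt` does not depend
on `γ`. -/
lemma lead_mul_add_erfcTwo (hE : SecO a b (-4) fun x => Complex.exp (x ^ 2))
    (h : Lead a b 1 0 fun x => x * Complex.exp (x ^ 2) * (δ + erfcTwo x)) (γ : ℂ) :
    Lead a b 1 0 fun x => x * Complex.exp (x ^ 2) * (γ + erfcTwo x) := by
  have h1 := ((lead_linear a b (γ - δ)).secO.mul hE)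
  exact (h.add_secO (SecO.mono h1 (by norm_num))).congr (SecEv.of_forall fun x => by ring)

lemma secEv_add_erfcTwo_ne
    (h : Lead a b 1 0 fun x => x * Complex.exp (x ^ 2) * (γ + erfcTwo x)) :
    SecEv a b fun x => γ + erfcTwo x ≠ 0 :=
  (h.secEv_ne_zero one_ne_zero).mono fun _ hx => right_ne_zero_of_mul hx

lemma seed_eq (γ x : ℂ) (hx : x ≠ 0) :
    seed γ x = -2 * x / (x * Complex.exp (x ^ 2) * (γ + erfcTwo x)) := by
  have := Complex.exp_ne_zero (x ^ 2)
  rw [seed, Complex.exp_neg]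
  field_simp

lemma lead_seed_one (h : Lead a b 1 0 fun x => x * Complex.exp (x ^ 2) * (γ + erfcTwo x)) :
    Lead a b (-2) 1 (seed γ) :=
  (((lead_linear a b (-2)).div h one_ne_zero).cast (by norm_num) (by norm_num)).congr
    ((secEv_ne a b).mono fun x hx => (seed_eq γ x hx).symm)

lemma lead_seed_sub_seed
    (h : Lead a b 1 0 fun x => x * Complex.exp (x ^ 2) * (γ + erfcTwo x))
    (h' : Lead a b 1 0 fun x => x * Complex.exp (x ^ 2) * (δ + erfcTwo x)) :
    Lead a b (2 * (γ - δ)) 2 fun x => (seed γ x - seed δ x) / Complex.exp (x ^ 2) := by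
  refine (((lead_monomial a b (2 * (γ - δ)) 2).div (h.mul h') (by norm_num)).cast (by norm_num)
    (by norm_num)).congr (((secEv_ne a b).and ((secEv_add_erfcTwo_ne h).and
      (secEv_add_erfcTwo_ne h'))).mono fun x hx => ?_)
  obtain ⟨h0, h1, h2⟩ := hx
  have := Complex.exp_ne_zero (x ^ 2)
  rw [seed_eq _ _ h0, seed_eq _ _ h0, show x ^ (2 : ℤ) = x ^ 2 from rfl]
  field_simp
  ring

lemma lead_seed_div (h : Lead a b δ 0 fun x => γ + erfcTwo x) (hδ : δ ≠ 0) :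
    Lead a b (-2 / δ) 0 fun x => seed γ x / Complex.exp (-x ^ 2) :=
  ((lead_const a b (-2)).div h hδ).congr (SecEv.of_forall fun x => by
    have := Complex.exp_ne_zero (-x ^ 2)
    rw [seed]
    field_simp)

lemma secO_seed (hE : SecO a b (-4) fun x => Complex.exp (-x ^ 2))
    (h : Lead a b δ 0 fun x => γ + erfcTwo x) (hδ : δ ≠ 0) : SecO a b (-3) (seed γ) := by
  refine (SecO.mono ((lead_seed_div h hδ).secO.mul hE) (by norm_num)).congr
    (SecEv.of_forall fun x => ?_)
  exact div_mul_cancel₀ _ (Complex.exp_ne_zero _)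

end seed

lemma expMonomial_even {k : ℤ} (hk : Even k) :
    expMonomial k 0 = fun x => Complex.exp (-x ^ 2) := by
  funext x; simp [expMonomial, hk.neg_one_zpow]

lemma expMonomial_odd {k : ℤ} (hk : Odd k) :
    expMonomial k 0 = fun x => Complex.exp (x ^ 2) := by
  funext x; simp [expMonomial, hk.neg_one_zpow]

/-- The lower end of the sector of opening `π/2` centred at the direction `kπ/2`. -/
noncomputable abbrev lo (k : ℤ) : ℝ := (k : ℝ) * (Real.pi / 2) - Real.pi / 4

/-- The upper end of the sector of opening `π/2` centred at the direction `kπ/2`. -/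
noncomputable abbrev hi (k : ℤ) : ℝ := (k : ℝ) * (Real.pi / 2) + Real.pi / 4

lemma lead_bgParam_sector (k : ℤ) : Lead (lo k) (hi k) 1 0
    fun x => x * Complex.exp (x ^ 2) * (bgParam k + erfcTwo x) :=
  (lead_bgParam k).subset (by simp only [lo]; linarith [Real.pi_pos]) le_rfl

lemma lead_sector_even {k : ℤ} (hk : Even k) (γ : ℂ) :
    Lead (lo k) (hi k) (γ - bgParam k) 0 fun x => γ + erfcTwo x :=
  lead_add_erfcTwo (expMonomial_even hk ▸ secO_expMonomial k) (lead_bgParam_sector k) γ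

lemma lead_sector_odd {k : ℤ} (hk : Odd k) (γ : ℂ) :
    Lead (lo k) (hi k) 1 0 fun x => x * Complex.exp (x ^ 2) * (γ + erfcTwo x) :=
  lead_mul_add_erfcTwo (expMonomial_odd hk ▸ secO_expMonomial k) (lead_bgParam_sector k) γ

lemma bgTwo_zero (a b : ℝ) (m k : ℕ) : BgTwo a b m k (tri (fun _ => 0) m k) :=
  bgTwo_tri (SecEv.of_forall fun x => by simpa using hasDerivAt_const x (0 : ℂ))
    (secO_zero a b _) m k

lemma bgOne_of_lead {a b : ℝ} {γ : ℂ}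
    (h : Lead a b 1 0 fun x => x * Complex.exp (x ^ 2) * (γ + erfcTwo x)) (m k : ℕ) :
    BgOne a b m k (tri (seed γ) m k) :=
  bgOne_tri (seed_riccati (secEv_add_erfcTwo_ne h)) (lead_seed_one h) m k

lemma bgTwo_sector {k : ℤ} (hk : Even k) {γ : ℂ} (hγ : γ - bgParam k ≠ 0) (m l : ℕ) :
    BgTwo (lo k) (hi k) m l (tri (seed γ) m l) :=
  have h := lead_sector_even hk γ
  bgTwo_tri (seed_riccati (h.secEv_ne_zero hγ))
    (secO_seed (expMonomial_even hk ▸ secO_expMonomial k) h hγ) m l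

/-- In an even sector, the perturbation of the solution with zero seed. -/
lemma diffLead_sector_even {k : ℤ} (hk : Even k) {γ : ℂ} (hγ : γ - bgParam k ≠ 0) (m l : ℕ) :
    DiffLead (lo k) (hi k)
      (-2 / (γ - bgParam k) * ((-1) ^ m * m.factorial * 2 ^ l / (2 ^ m * l.factorial)))
      (2 * l - 2 * m) (expMonomial k 0) (tri (seed γ) m l) (tri (fun _ => 0) m l) :=
  diffLead_tri_two (bgTwo_sector hk hγ) (bgTwo_zero _ _)
    ((lead_seed_div (lead_sector_even hk γ) hγ).congr (SecEv.of_forall fun x => by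
      rw [expMonomial_even hk, sub_zero])) m l

/-- In an odd sector, the difference of two solutions with non-zero seeds. -/
lemma diffLead_sector_odd {k : ℤ} (hk : Odd k) (γ δ : ℂ) (m l : ℕ) :
    DiffLead (lo k) (hi k)
      (2 * (γ - δ) * ((-1) ^ m * 2 ^ m * 4 ^ l / ((m + l).factorial * l.factorial)))
      (4 * l + 2 * m + 2) (expMonomial k 0) (tri (seed γ) m l) (tri (seed δ) m l) :=
  diffLead_tri_one (bgOne_of_lead (lead_sector_odd hk γ)) (bgOne_of_lead (lead_sector_odd hk δ))
    ((lead_seed_sub_seed (lead_sector_odd hk γ) (lead_sector_odd hk δ)).congr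
      (SecEv.of_forall fun x => by rw [expMonomial_odd hk])) m l

/-! ### The two families -/

/-- The solution of P4 generated by the solution `y` of `y' = -(y² + 2xy)`, for the parameters
`α = 1/2 + m + l`, `β = 2m`. -/
noncomputable def fam (y : ℂ → ℂ) (m l : ℕ) : ℂ → ℂ := nf (tri y m l).f1

/-- The solution of P4 generated by the solution `y` of `y' = -(y² + 2xy)` and the symmetry
`x ↦ i x`, for the parameters `α = 1/2 + m + l`, `β = 2l`. -/
noncomputable def dual (y : ℂ → ℂ) (m l : ℕ) : ℂ → ℂ := nf (tri y m l).mirror.f1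

lemma IsSeed.isSolution_fam {y : ℂ → ℂ} (hy : IsSeed y) (m l : ℕ) {α β : ℂ}
    (hα : α = 1 / 2 + (m + l)) (hβ : β = 2 * m) : IsSolution α β (fam y m l) :=
  (hy.gsys m l).isSolution (by rw [hα, hβ]; ring) (by rw [hβ])

lemma IsSeed.isSolution_dual {y : ℂ → ℂ} (hy : IsSeed y) (m l : ℕ) {α β : ℂ}
    (hα : α = 1 / 2 + (m + l)) (hβ : β = 2 * l) : IsSolution α β (dual y m l) :=
  (hy.gsys m l).mirror.isSolution (by rw [hα, hβ]; ring) (by rw [hβ])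

/-- The rational solutions belong to both families. -/
lemma dual_zero (m l : ℕ) : dual (fun _ => 0) m l = fam (fun _ => 0) l m :=
  nf_congr (isSeed_zero.gsys m l).mirror.m1 (isSeed_zero.gsys l m).m1
    ((mirror_tri_zero m l).mono fun _ hx => hx.2.1)

/-- For `β = 0` the rational solution is trivial. -/
lemma fam_zero_zero (l : ℕ) : fam (fun _ => 0) 0 l = fun _ => 0 := by
  have h : (tri (fun _ => 0) 0 l).f1 = fun _ => 0 := by
    induction l with
    | zero => rfl
    | succ l ih =>
      have hl := natCast_succ_ne l
      funext x
      simp only [tri, Tri.stepA, Tri.cyc, Tri.refl, ih]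
      by_cases hx : (tri (fun _ => 0) 0 l).f2 x = 0
      · simp [hx]
      · push_cast
        have : (0 : ℂ) + l + 1 ≠ 0 := by rwa [zero_add]
        field_simp
        ring
  rw [fam, h, nf_zero]

section transfer

variable {a b : ℝ} {a0 a1 a2 : ℂ} {F : Tri}

lemma GSys.secEv_nf (h : GSys a0 a1 a2 F) (hs : SecEv a b (Sys a0 a1 a2 F)) :
    SecEv a b fun x => nf F.f1 x = F.f1 x :=
  hs.eventually_nhds.mono fun _ hx => nf_eq_of_analyticAt h.m1
    (Complex.analyticAt_iff_eventually_differentiableAt.2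
      (hx.mono fun _ hz => hz.d1.differentiableAt))

lemma exp_pi_div_two_mul_I : Complex.exp ((Real.pi / 2 : ℝ) * Complex.I) = Complex.I := by
  rw [Complex.ofReal_div, Complex.ofReal_ofNat, Complex.exp_pi_div_two_mul_I]

lemma SecEv.sys_mirror (h : SecEv (a + Real.pi / 2) (b + Real.pi / 2) (Sys a0 a1 a2 F)) :
    SecEv a b (Sys a1 a0 a2 F.mirror) := by
  have := h.rotate (Real.pi / 2)
  rw [exp_pi_div_two_mul_I] at this
  exact this.mono fun x hx => hx.mirror

lemma Lead.mul_I {C : ℂ} {κ : ℤ} {f : ℂ → ℂ}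
    (h : Lead (a + Real.pi / 2) (b + Real.pi / 2) C κ f) :
    Lead a b (-Complex.I * (C * Complex.I ^ κ)) κ fun x => -Complex.I * f (Complex.I * x) := by
  have := (h.rotate (Real.pi / 2)).const_mul (-Complex.I)
  rwa [exp_pi_div_two_mul_I] at this

end transfer

lemma Lead.unique {a b : ℝ} {C D : ℂ} {κ : ℤ} {f : ℂ → ℂ} (hab : a < b) (h : Lead a b C κ f)
    (h' : Lead a b D κ f) : C = D := by
  by_contra hCD
  obtain ⟨s, h1, h2⟩ := exists_between hab
  have := (h.sub h').secEv_ne_zero (sub_ne_zero.2 hCD) s s h1 h2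
  obtain ⟨R, hR⟩ := eventually_sec.1 this
  exact hR R le_rfl s ⟨le_rfl, le_rfl⟩ (sub_self _)

section families

variable {y z : ℂ → ℂ} {a b : ℝ} {m l : ℕ} {γ : ℂ} {k : ℤ}

lemma IsSeed.secEv_fam (hy : IsSeed y)
    (h : SecEv a b (Sys l m (-((m : ℂ) + l + 1)) (tri y m l))) :
    SecEv a b fun x => (tri y m l).f1 x = fam y m l x :=
  ((hy.gsys m l).secEv_nf h).mono fun _ hx => hx.symm

lemma IsSeed.secEv_dual (hy : IsSeed y) (h : SecEv (a + Real.pi / 2) (b + Real.pi / 2)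
      (Sys l m (-((m : ℂ) + l + 1)) (tri y m l))) :
    SecEv a b fun x => -Complex.I * (tri y m l).f0 (Complex.I * x) = dual y m l x :=
  ((hy.gsys m l).mirror.secEv_nf h.sys_mirror).mono fun _ hx => hx.symm

lemma lo_succ (k : ℤ) : lo (k + 1) = lo k + Real.pi / 2 := by
  simp only [lo]; push_cast; ring

lemma hi_succ (k : ℤ) : hi (k + 1) = hi k + Real.pi / 2 := by
  simp only [hi]; push_cast; ring

lemma lo_lt_hi (k : ℤ) : lo k < hi k := by
  simp only [lo, hi]; linarith [Real.pi_pos]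

lemma expMonomial_succ_mul_I (k : ℤ) (x : ℂ) :
    expMonomial (k + 1) 0 (Complex.I * x) = expMonomial k 0 x := by
  simp only [expMonomial, zpow_zero, one_mul, mul_pow, Complex.I_sq]
  rw [zpow_add_one₀ (by norm_num)]
  ring_nf

lemma lead_fam_even (hk : Even k) (hγ : γ - bgParam k ≠ 0) (m l : ℕ) :
    Lead (lo k) (hi k)
      (-2 / (γ - bgParam k) * ((-1) ^ m * m.factorial * 2 ^ l / (2 ^ m * l.factorial)))
      (2 * l - 2 * m)
      fun x => (fam (seed γ) m l x - fam (fun _ => 0) m l x) / expMonomial k 0 x :=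
  (diffLead_sector_even hk hγ m l).l1.congr
    (((isSeed_seed γ).secEv_fam (bgTwo_sector hk hγ m l).sys).and
      (isSeed_zero.secEv_fam (bgTwo_zero _ _ m l).sys) |>.mono fun x hx => by rw [hx.1, hx.2])

lemma lead_fam_odd (hk : Odd k) (γ δ : ℂ) (m l : ℕ) :
    Lead (lo k) (hi k)
      (2 * (γ - δ) * ((-1) ^ m * 2 ^ m * 4 ^ l / ((m + l).factorial * l.factorial)))
      (4 * l + 2 * m + 2)
      fun x => (fam (seed γ) m l x - fam (seed δ) m l x) / expMonomial k 0 x :=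
  (diffLead_sector_odd hk γ δ m l).l1.congr
    (((isSeed_seed γ).secEv_fam (bgOne_of_lead (lead_sector_odd hk γ) m l).sys).and
      ((isSeed_seed δ).secEv_fam (bgOne_of_lead (lead_sector_odd hk δ) m l).sys) |>.mono
        fun x hx => by rw [hx.1, hx.2])

/-- Transport of the difference of the components with index `0` by the symmetry `x ↦ i x`. -/
lemma lead_dual {C : ℂ} {κ : ℤ} (hy : IsSeed y) (hz : IsSeed z)
    (h1 : SecEv (lo (k + 1)) (hi (k + 1)) (Sys l m (-((m : ℂ) + l + 1)) (tri y m l)))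
    (h2 : SecEv (lo (k + 1)) (hi (k + 1)) (Sys l m (-((m : ℂ) + l + 1)) (tri z m l)))
    (h : Lead (lo (k + 1)) (hi (k + 1)) C κ
      fun x => ((tri y m l).f0 x - (tri z m l).f0 x) / expMonomial (k + 1) 0 x) :
    Lead (lo k) (hi k) (-Complex.I * (C * Complex.I ^ κ)) κ
      fun x => (dual y m l x - dual z m l x) / expMonomial k 0 x := by
  rw [lo_succ, hi_succ] at h h1 h2
  refine h.mul_I.congr (((hy.secEv_dual h1).and (hz.secEv_dual h2)).mono fun x hx => ?_)
  rw [← hx.1, ← hx.2, expMonomial_succ_mul_I]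
  ring

lemma lead_dual_even (hk : Even k) (γ δ : ℂ) (m l : ℕ) :
    Lead (lo k) (hi k)
      (-4 * Complex.I * (γ - δ) * (2 ^ m * 4 ^ l / ((m + l + 1).factorial * l.factorial)))
      (4 * l + 2 * m + 4)
      fun x => (dual (seed γ) m (l + 1) x - dual (seed δ) m (l + 1) x) / expMonomial k 0 x := by
  have hk1 : Odd (k + 1) := hk.add_one
  have hF := fun γ => bgOne_of_lead (lead_sector_odd hk1 γ)
  have h := ((hF γ m l).diffLead_stepA (hF δ m l) (diffLead_sector_odd hk1 γ δ m l)).1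
  refine (lead_dual (isSeed_seed γ) (isSeed_seed δ) (hF γ m (l + 1)).sys (hF δ m (l + 1)).sys
    h).cast ?_ (by ring)
  have e : Complex.I ^ (4 * (l : ℤ) + 2 * m + 2 + 2) = (-1) ^ m := by
    rw [show 4 * (l : ℤ) + 2 * m + 2 + 2 = ((2 * (2 * (l + 1) + m) : ℕ) : ℤ) by push_cast; ring,
      zpow_natCast, pow_mul, Complex.I_sq, pow_add, pow_mul]
    norm_num
  rw [e, Nat.factorial_succ]
  have h1 : ((-1 : ℂ) ^ m) * (-1) ^ m = 1 := by rw [← mul_pow]; norm_num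
  have := natCast_add_one_ne_zero' m l
  have h2 : (((m + l : ℕ) : ℂ)) + 1 = m + l + 1 := by push_cast; ring
  have : ((m + l).factorial : ℂ) ≠ 0 := by exact_mod_cast (m + l).factorial_ne_zero
  have : (l.factorial : ℂ) ≠ 0 := by exact_mod_cast l.factorial_ne_zero
  push_cast
  field_simp
  linear_combination (-4 * (γ - δ)) * h1

lemma lead_dual_odd (hk : Odd k) (hγ : γ - bgParam (k + 1) ≠ 0) (m l : ℕ) :
    Lead (lo k) (hi k)
      (2 * Complex.I / (γ - bgParam (k + 1)) * ((-1) ^ l * m.factorial * 2 ^ l /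
        (2 ^ m * l.factorial)))
      (2 * l - 2 * m)
      fun x => (dual (seed γ) m (l + 1) x - dual (fun _ => 0) m (l + 1) x) /
        expMonomial k 0 x := by
  have hk1 : Even (k + 1) := hk.add_one
  have h := ((bgTwo_sector hk1 hγ m l).diffLead_stepA (bgTwo_zero _ _ m l)
    (diffLead_sector_even hk1 hγ m l)).1
  refine (lead_dual (isSeed_seed γ) isSeed_zero (bgTwo_sector hk1 hγ m (l + 1)).sys
    (bgTwo_zero _ _ m (l + 1)).sys h).cast ?_ rfl
  have e : Complex.I ^ (2 * (l : ℤ) - 2 * m) = (-1) ^ l / (-1) ^ m := by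
    rw [zpow_sub₀ Complex.I_ne_zero, zpow_mul, zpow_mul, show Complex.I ^ (2 : ℤ) = -1 from
      Complex.I_sq, zpow_natCast, zpow_natCast]
  rw [e]
  field_simp

end families

/-! ### Parametrization of the families, backgrounds -/

/-- The seed of the member of the first family with parameter `c`: it has `γ = 1/c`, and `c = 0`
belongs to the zero seed, the limit of `seed γ` as `γ → ∞`. -/
noncomputable def seedOne (c : OnePoint ℂ) : ℂ → ℂ :=
  match c with
  | none => seed 0
  | some c => if c = 0 then fun _ => 0 else seed (1 / c)

/-- The seed of the member of the second family with parameter `c`: it has `γ = -2ic`, and `c = ∞`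
belongs to the zero seed. -/
noncomputable def seedTwo (c : OnePoint ℂ) : ℂ → ℂ :=
  match c with
  | none => fun _ => 0
  | some c => seed (-2 * Complex.I * c)

@[simp] lemma seedOne_coe (c : ℂ) :
    seedOne (c : OnePoint ℂ) = if c = 0 then fun _ => 0 else seed (1 / c) := rfl

@[simp] lemma seedTwo_infty : seedTwo OnePoint.infty = fun _ => 0 := rfl

@[simp] lemma seedTwo_coe (c : ℂ) : seedTwo (c : OnePoint ℂ) = seed (-2 * Complex.I * c) := rfl

section background

variable {m l : ℕ} {α β : ℂ}

lemma isBackground_rational (hα : α = 1 / 2 + (m + l)) (hβ : β = 2 * m) :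
    IsBackground α β (fun x => β / (2 * x)) fun _ => fam (fun _ => 0) m l := by
  refine fun j => ⟨isSeed_zero.isSolution_fam m l hα hβ, ?_⟩
  by_cases hm : m = 0
  · subst hm
    rw [fam_zero_zero]
    exact fun s t _ _ => ⟨0, 0, fun r θ _ _ _ => ⟨0, by simp, by simp [hβ]⟩⟩
  · have h := bgTwo_zero ((j : ℝ) * (Real.pi / 2) - 3 * Real.pi / 4)
      ((j : ℝ) * (Real.pi / 2) + Real.pi / 4) m l
    refine (h.l1.congr (isSeed_zero.secEv_fam h.sys)).asympOn (by exact_mod_cast hm)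
      fun x hx => ?_
    rw [hβ, zpow_neg_one]
    field_simp

lemma isBackground_linear (hα : α = 1 / 2 + (m + l)) (hβ : β = 2 * m) :
    IsBackground α β (fun x => -(2 * x)) fun j => fam (seed (bgParam j)) m l := by
  refine fun j => ⟨(isSeed_seed _).isSolution_fam m l hα hβ, ?_⟩
  have h := bgOne_of_lead (lead_bgParam j) m l
  exact (h.l1.congr ((isSeed_seed _).secEv_fam h.sys)).asympOn (by norm_num)
    fun x _ => by rw [zpow_one, neg_mul]

/-- The component `1` dominates `tri (seed γ) m l`, so its component `0`, which becomes the second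
family, is only of size `1/x`. -/
lemma lead_dual_seed {a b : ℝ} {γ : ℂ}
    (h : Lead (a + Real.pi / 2) (b + Real.pi / 2) 1 0
      fun x => x * Complex.exp (x ^ 2) * (γ + erfcTwo x)) (m l : ℕ) :
    Lead a b (-l) (-1) (dual (seed γ) m l) := by
  have h := bgOne_of_lead h m l
  refine (h.l0.mul_I.congr ((isSeed_seed _).secEv_dual h.sys)).cast ?_ rfl
  rw [zpow_neg_one, Complex.inv_I]
  linear_combination (l : ℂ) * Complex.I_sq

lemma isBackground_dual (hα : α = 1 / 2 + (m + l)) (hβ : β = 2 * l) (hl : l ≠ 0) :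
    IsBackground α β (fun x => -(β / (2 * x))) fun j => dual (seed (bgParam (j + 1))) m l := by
  refine fun j => ⟨(isSeed_seed _).isSolution_dual m l hα hβ, ?_⟩
  refine (lead_dual_seed ((lead_bgParam (j + 1)).subset ?_ ?_) m l).asympOn
    (neg_ne_zero.2 (by exact_mod_cast hl)) fun x hx => ?_
  · push_cast; linarith
  · push_cast; linarith
  · rw [hβ, zpow_neg_one]
    field_simp

end background

/-! ### Relations with exponentially small terms -/

lemma hasAsymp_zero {k κ : ℤ} {B : ℤ → ℂ → ℂ} {μ : ℝ → ℂ} {y : ℂ → ℂ} (h : y = B k)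
    (h' : y = B (k + 1)) (hμ : ∀ θ, μ θ = 0) : HasAsymp k B κ μ y := by
  have h0 : ∀ z : ℂ → ℂ, y = z → Lead (lo k) (hi k) 0 κ
      fun x => (y x - z x) / expMonomial k 0 x := fun z hz =>
    Lead.of_secO ((secO_zero _ _ _).congr (SecEv.of_forall fun x => by simp [hz]))
  exact .of_lead (h0 _ h) (h0 _ h') (fun _ => h) (fun _ => h') (fun θ _ => hμ θ)
    (fun θ _ => hμ θ) (by simp [hμ])

/-- The function `f` is equal to `bgParam k` before `τ`, to `bgParam (k + 1)` after `τ`, and to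
their mean at `τ`. -/
structure IsJump (k : ℤ) (τ : ℝ) (f : ℝ → ℂ) : Prop where
  lt : ∀ θ < τ, f θ = bgParam k
  gt : ∀ θ, τ < θ → f θ = bgParam (k + 1)
  eq : f τ = (bgParam k + bgParam (k + 1)) / 2

lemma theta_of_neg {t : ℝ} (h : t < 0) : Θ t = 0 := if_pos h

lemma theta_zero : Θ 0 = 1 / 2 := by simp [Θ]

lemma theta_of_pos {t : ℝ} (h : 0 < t) : Θ t = 1 := by
  rw [Θ, if_neg h.not_gt, if_neg h.ne']

lemma isJump_one (τ : ℝ) : IsJump 1 τ fun θ => -2 * sqrtPi * Θ (θ - τ) where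
  lt θ h := by simp [theta_of_neg (sub_neg.2 h), bgParam]
  gt θ h := by simp [theta_of_pos (sub_pos.2 h), bgParam]
  eq := by simp [theta_zero, bgParam]; ring

lemma isJump_three (τ : ℝ) : IsJump 3 τ fun θ => -2 * sqrtPi * Θ (τ - θ) where
  lt θ h := by simp [theta_of_pos (sub_pos.2 h), bgParam]
  gt θ h := by simp [theta_of_neg (sub_neg.2 h), bgParam]
  eq := by simp [theta_zero, bgParam]; ring

section asymp

variable {k : ℤ} {γ : ℂ} {f : ℝ → ℂ}

lemma hasAsymp_fam_even (hk : Even k) (hγ : γ - bgParam k ≠ 0) (m l : ℕ) :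
    HasAsymp k (fun _ => fam (fun _ => 0) m l) (2 * l - 2 * m)
      (fun _ => -2 / (γ - bgParam k) *
        ((-1) ^ m * m.factorial * 2 ^ l / (2 ^ m * l.factorial))) (fam (seed γ) m l) := by
  have h := lead_fam_even hk hγ m l
  have hC : -2 / (γ - bgParam k) *
      ((-1) ^ m * m.factorial * 2 ^ l / (2 ^ m * l.factorial)) ≠ 0 := by
    simp [*, Nat.factorial_ne_zero]
  exact .of_lead h h (fun h0 => absurd h0 hC) (fun h0 => absurd h0 hC) (fun _ _ => rfl)
    (fun _ _ => rfl) (by ring)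

lemma hasAsymp_fam_odd (hk : Odd k) (hf : IsJump k (k * (Real.pi / 2)) f) (γ : ℂ) (m l : ℕ) :
    HasAsymp k (fun j => fam (seed (bgParam j)) m l) (4 * l + 2 * m + 2)
      (fun θ => 2 * (γ - f θ) * ((-1) ^ m * 2 ^ m * 4 ^ l / ((m + l).factorial * l.factorial)))
      (fam (seed γ) m l) := by
  have h0 : ∀ δ, 2 * (γ - δ) * ((-1) ^ m * 2 ^ m * 4 ^ l / ((m + l).factorial * l.factorial)) = 0 →
      fam (seed γ) m l = fam (seed δ) m l := fun δ hδ => by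
    rw [sub_eq_zero.1 (by simpa [Nat.factorial_ne_zero] using hδ : γ - δ = 0)]
  exact .of_lead (lead_fam_odd hk γ _ m l) (lead_fam_odd hk γ _ m l) (h0 _) (h0 _)
    (fun θ h => by rw [hf.lt θ h]) (fun θ h => by rw [hf.gt θ h]) (by rw [hf.eq]; ring)

lemma hasAsymp_dual_even (hk : Even k) (hf : IsJump (k + 1) (k * (Real.pi / 2)) f) (γ : ℂ)
    (m l : ℕ) :
    HasAsymp k (fun j => dual (seed (bgParam (j + 1))) m (l + 1)) (4 * l + 2 * m + 4)
      (fun θ => -4 * Complex.I * (γ - f θ) *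
        (2 ^ m * 4 ^ l / ((m + l + 1).factorial * l.factorial))) (dual (seed γ) m (l + 1)) := by
  have h0 : ∀ δ, -4 * Complex.I * (γ - δ) *
      (2 ^ m * 4 ^ l / ((m + l + 1).factorial * l.factorial)) = 0 →
      dual (seed γ) m (l + 1) = dual (seed δ) m (l + 1) := fun δ hδ => by
    rw [sub_eq_zero.1 (by simpa [Nat.factorial_ne_zero] using hδ : γ - δ = 0)]
  exact .of_lead (lead_dual_even hk γ _ m l) (lead_dual_even hk γ _ m l) (h0 _) (h0 _)
    (fun θ h => by rw [hf.lt θ h]) (fun θ h => by rw [hf.gt θ h]) (by rw [hf.eq]; ring)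

lemma hasAsymp_dual_odd (hk : Odd k) (hγ : γ - bgParam (k + 1) ≠ 0) (m l : ℕ) :
    HasAsymp k (fun _ => dual (fun _ => 0) m (l + 1)) (2 * l - 2 * m)
      (fun _ => 2 * Complex.I / (γ - bgParam (k + 1)) * ((-1) ^ l * m.factorial * 2 ^ l /
        (2 ^ m * l.factorial))) (dual (seed γ) m (l + 1)) := by
  have h := lead_dual_odd hk hγ m l
  have hC : 2 * Complex.I / (γ - bgParam (k + 1)) * ((-1) ^ l * m.factorial * 2 ^ l /
        (2 ^ m * l.factorial)) ≠ 0 := by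
    simp [*, Nat.factorial_ne_zero]
  exact .of_lead h h (fun h0 => absurd h0 hC) (fun h0 => absurd h0 hC) (fun _ _ => rfl)
    (fun _ _ => rfl) (by ring)

end asymp

-- The coefficients of the exponential terms, as powers of `2` and factorials in `n = m + l`.
section normalized

variable {k : ℤ} {γ : ℂ} {f ν : ℝ → ℂ}

lemma hasAsymp_fam_real {μ : ℂ} (hk : Even k) (hγ : γ - bgParam k ≠ 0)
    (hμ : μ = 1 / (γ - bgParam k)) (m l : ℕ) :
    HasAsymp k (fun _ => fam (fun _ => 0) m l) (2 * (m + l : ℕ) - 4 * m)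
      (fun _ => -μ * (-1) ^ m * (2 : ℂ) ^ (((m + l : ℕ) : ℤ) - 2 * m + 1) *
        ((m.factorial : ℂ) / (l.factorial : ℂ))) (fam (seed γ) m l) := by
  have hlf : (l.factorial : ℂ) ≠ 0 := Nat.cast_ne_zero.2 l.factorial_ne_zero
  convert hasAsymp_fam_even hk hγ m l using 1
  · push_cast; ring
  · funext θ
    rw [hμ, show ((m + l : ℕ) : ℤ) - 2 * m + 1 = (l : ℤ) - m + 1 by push_cast; ring,
      zpow_add_one₀ two_ne_zero, zpow_sub₀ two_ne_zero, zpow_natCast, zpow_natCast]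
    field_simp

lemma hasAsymp_fam_imag (hk : Odd k) (hf : IsJump k (k * (Real.pi / 2)) f) (γ : ℂ) (m l : ℕ)
    (hν : ∀ θ, ν θ = γ - f θ) :
    HasAsymp k (fun j => fam (seed (bgParam j)) m l) (4 * (m + l : ℕ) - 2 * m + 2)
      (fun θ => ν θ * (-1) ^ m * ((2 : ℂ) ^ (2 * ((m + l : ℕ) : ℤ) - m + 1) /
        (((m + l).factorial : ℂ) * (l.factorial : ℂ)))) (fam (seed γ) m l) := by
  convert hasAsymp_fam_odd hk hf γ m l using 1
  · push_cast; ring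
  · funext θ
    rw [hν, show 2 * ((m + l : ℕ) : ℤ) - m + 1 = ((m + 2 * l + 1 : ℕ) : ℤ) by push_cast; ring,
      zpow_natCast, pow_succ, pow_add, pow_mul]
    norm_num
    ring

lemma hasAsymp_dual_real (hk : Even k) (hf : IsJump (k + 1) (k * (Real.pi / 2)) f) (c : ℂ)
    (l p : ℕ) (hν : ∀ θ, f θ = 2 * Complex.I * ν θ) :
    HasAsymp k (fun j => dual (seed (bgParam (j + 1))) l (p + 1))
      (2 * (p + 1 + l : ℕ) + 2 * (p + 1 : ℕ))
      (fun θ => -(c + ν θ) * ((2 : ℂ) ^ (p + 1 + l + (p + 1) + 1) /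
        (((p + 1 + l).factorial : ℂ) * (p.factorial : ℂ))))
      (dual (seed (-2 * Complex.I * c)) l (p + 1)) := by
  convert hasAsymp_dual_even hk hf (-2 * Complex.I * c) l p using 1
  · push_cast; ring
  · funext θ
    rw [hν, show p + 1 + l + (p + 1) + 1 = l + 2 * p + 3 by ring,
      show p + 1 + l = l + p + 1 by ring, pow_add, pow_add, pow_mul]
    norm_num
    linear_combination
      (-8 * (c + ν θ) * (2 ^ l * 4 ^ p) / ((l + p + 1).factorial * p.factorial)) * Complex.I_sq

lemma hasAsymp_dual_imag {c d : ℂ} (hk : Odd k) (hd : d ≠ 0)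
    (hcd : -2 * Complex.I * c - bgParam (k + 1) = -2 * Complex.I * d) (l p : ℕ) :
    HasAsymp k (fun _ => dual (fun _ => 0) l (p + 1))
      (4 * (p + 1 : ℕ) - 2 * (p + 1 + l : ℕ) - 2)
      (fun _ => 1 / d * (-1) ^ (p + 1) *
        (2 : ℂ) ^ (2 * ((p + 1 : ℕ) : ℤ) - (p + 1 + l : ℕ) - 1) *
        ((l.factorial : ℂ) / (p.factorial : ℂ)))
      (dual (seed (-2 * Complex.I * c)) l (p + 1)) := by
  have hpf : (p.factorial : ℂ) ≠ 0 := Nat.cast_ne_zero.2 p.factorial_ne_zero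
  have hγ : -2 * Complex.I * c - bgParam (k + 1) ≠ 0 := by rw [hcd]; simpa using hd
  convert hasAsymp_dual_odd hk hγ l p using 1
  · push_cast; ring
  · funext θ
    rw [hcd, show 2 * ((p + 1 : ℕ) : ℤ) - (p + 1 + l : ℕ) - 1 = (p : ℤ) - l by push_cast; ring,
      zpow_sub₀ two_ne_zero, zpow_natCast, zpow_natCast]
    have := Complex.I_ne_zero
    field_simp
    ring

end normalized

/-! ### Distinct parameters -/

lemma bgParam_zero : bgParam 0 = 0 := by simp [bgParam]

lemma lead_fam_seedOne (c : ℂ) (m l : ℕ) :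
    Lead (lo 0) (hi 0) (c * (-2 * ((-1) ^ m * m.factorial * 2 ^ l / (2 ^ m * l.factorial))))
        (2 * l - 2 * m)
        (fun x => (fam (seedOne c) m l x - fam (fun _ => 0) m l x) / expMonomial 0 0 x) ∧
      SecO (lo 0) (hi 0) (-1) (fam (seedOne c) m l) := by
  by_cases hc : c = 0
  · subst hc
    have h := bgTwo_zero (lo 0) (hi 0) m l
    simp only [seedOne_coe, if_true]
    refine ⟨(Lead.of_secO (secO_zero _ _ _)).congr (SecEv.of_forall fun x => by simp) |>.cast
      (by simp) rfl, h.l1.secO.congr (isSeed_zero.secEv_fam h.sys)⟩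
  · have hγ : 1 / c - bgParam 0 ≠ 0 := by rw [bgParam_zero, sub_zero]; exact one_div_ne_zero hc
    have h := bgTwo_sector Even.zero hγ m l
    simp only [seedOne_coe, if_neg hc]
    refine ⟨(lead_fam_even Even.zero hγ m l).cast ?_ rfl,
      h.l1.secO.congr ((isSeed_seed _).secEv_fam h.sys)⟩
    rw [bgParam_zero, sub_zero]
    field_simp

/-- A finite parameter is determined by the exponential term around the positive real axis, where
`c = ∞` is distinguished by its growth. -/
lemma injective_fam_seedOne (m l : ℕ) : Function.Injective fun c => fam (seedOne c) m l := by
  have hlt := lo_lt_hi 0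
  have hinf : ∀ c : ℂ, fam (seedOne c) m l ≠ fam (seed 0) m l := fun c h => by
    have h1 := bgOne_of_lead (bgParam_zero ▸ lead_bgParam_sector 0) m l
    have h2 := h1.l1.congr ((isSeed_seed _).secEv_fam h1.sys)
    rw [← h] at h2
    exact absurd (h2.unique hlt (Lead.of_secO (lead_fam_seedOne c m l).2)) (by norm_num)
  intro c d h
  induction c using OnePoint.rec with
  | infty =>
    induction d using OnePoint.rec with
    | infty => rfl
    | coe d => exact absurd h.symm (hinf d)
  | coe c =>
    induction d using OnePoint.rec with
    | infty => exact absurd h (hinf c)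
    | coe d =>
      have h1 := (lead_fam_seedOne c m l).1
      have h' : fam (seedOne c) m l = fam (seedOne d) m l := h
      rw [h'] at h1
      have h2 := h1.unique hlt (lead_fam_seedOne d m l).1
      rw [mul_right_cancel₀ (by simp [Nat.factorial_ne_zero]) h2]

/-- A finite parameter is determined by the exponential term around the positive real axis; `c = ∞`
is distinguished by the sign of the leading term. -/
lemma injective_dual_seedTwo (m l : ℕ) :
    Function.Injective fun c => dual (seedTwo c) m (l + 1) := by
  have hlt := lo_lt_hi 0
  have hinf : ∀ c : ℂ, dual (seedTwo c) m (l + 1) ≠ dual (fun _ => 0) m (l + 1) := fun c h => by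
    have h0 := bgTwo_zero (lo 0) (hi 0) (l + 1) m
    have h1 := h0.l1.congr (isSeed_zero.secEv_fam h0.sys)
    have h2 := lead_sector_odd odd_one (-2 * Complex.I * c)
    rw [← zero_add (1 : ℤ), lo_succ, hi_succ] at h2
    have h3 := lead_dual_seed h2 m (l + 1)
    rw [← dual_zero, ← h] at h1
    have h4 := h1.unique hlt h3
    push_cast at h4
    refine natCast_succ_ne l (self_eq_neg.1 h4)
  intro c d h
  induction c using OnePoint.rec with
  | infty =>
    induction d using OnePoint.rec with
    | infty => rfl
    | coe d => exact absurd h.symm (hinf d)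
  | coe c =>
    induction d using OnePoint.rec with
    | infty => exact absurd h (hinf c)
    | coe d =>
      have h1 := lead_dual_even Even.zero (-2 * Complex.I * c) 0 m l
      have h' : dual (seedTwo c) m (l + 1) = dual (seedTwo d) m (l + 1) := h
      rw [← seedTwo_coe, h', seedTwo_coe] at h1
      have h2 := h1.unique hlt (lead_dual_even Even.zero (-2 * Complex.I * d) 0 m l)
      have h3 := mul_right_cancel₀ (by simp [Nat.factorial_ne_zero]) h2
      rw [show c = d by simpa using h3]

lemma isClassical_seedOne {α β : ℂ} {m l : ℕ} (hα : α = 1 / 2 + (m + l)) (hβ : β = 2 * m)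
    (c : OnePoint ℂ) : IsSolution α β (fam (seedOne c) m l) ∧
      IsClassical α β (fam (seedOne c) m l) := by
  have hs : ∀ γ, IsSolution α β (fam (seed γ) m l) ∧ IsClassical α β (fam (seed γ) m l) := by
    refine fun γ => ⟨(isSeed_seed γ).isSolution_fam m l hα hβ, ?_⟩
    rw [hα, hβ, ← add_assoc]
    exact (isSeed_seed γ).isClassical (Or.inr (seed_codiscrete_ne γ)) l
  induction c using OnePoint.rec with
  | infty => exact hs 0
  | coe c =>
    rw [seedOne_coe]
    split_ifs with hc
    · refine ⟨isSeed_zero.isSolution_fam m l hα hβ, ?_⟩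
      -- for `m = 0` the transformations cannot be applied to the zero solution
      by_cases hm : m = 0
      · subst hm
        rw [fam_zero_zero, hβ, Nat.cast_zero, mul_zero]
        exact .zero α
      · rw [hα, hβ, ← add_assoc]
        exact isSeed_zero.isClassical (Or.inl hm) l
    · exact hs _

lemma isClassical_seedTwo {α β : ℂ} {m l : ℕ} (hα : α = 1 / 2 + (m + (l + 1)))
    (hβ : β = 2 * (l + 1)) (c : OnePoint ℂ) : IsSolution α β (dual (seedTwo c) m (l + 1)) ∧
      IsClassical α β (dual (seedTwo c) m (l + 1)) := by
  induction c using OnePoint.rec with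
  | infty =>
    rw [seedTwo_infty, dual_zero]
    have := isClassical_seedOne (m := l + 1) (l := m) (α := α) (β := β)
      (by rw [hα]; push_cast; ring) (by rw [hβ]; push_cast; ring) (0 : ℂ)
    rwa [seedOne_coe, if_pos rfl] at this
  | coe c =>
    refine ⟨(isSeed_seed _).isSolution_dual m (l + 1) (by rw [hα]; push_cast; ring)
      (by rw [hβ]; push_cast; ring), ?_⟩
    rw [hα, hβ, ← add_assoc (m : ℂ)]
    exact ((isSeed_seed _).isClassical_mirror_f0 (Or.inr (seed_codiscrete_ne _)) l).2

end PIV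

/-! ### Asymptotics of the classical solutions -/

open PIV in
theorem theorem5 (n m : ℕ) (hmn : m ≤ n) (α β : ℂ)
    (hα : α = 1 / 2 + (n : ℂ)) (hβ : β = 2 * (m : ℂ)) :
    ∃ (P M D : ℤ → ℂ → ℂ) (Y₁ Y₂ : OnePoint ℂ → ℂ → ℂ),
      -- the backgrounds `β/(2x)`, `-β/(2x)` and `-2x`
      PIV.IsBackground α β (fun x => β / (2 * x)) P ∧
      PIV.IsBackground α β (fun x => -(β / (2 * x))) M ∧
      PIV.IsBackground α β (fun x => -(2 * x)) D ∧
      -- two families of classical solutions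
      (∀ c : OnePoint ℂ, PIV.IsSolution α β (Y₁ c) ∧ PIV.IsClassical α β (Y₁ c)) ∧
      (∀ c : OnePoint ℂ, PIV.IsSolution α β (Y₂ c) ∧ PIV.IsClassical α β (Y₂ c)) ∧
      Function.Injective Y₁ ∧ (1 ≤ m → Function.Injective Y₂) ∧
      -- first family, finite values of the parameter
      (∀ c : ℂ,
        PIV.HasAsymp 0 P (2 * n - 4 * m)
          (fun _ => -c * (-1) ^ m * (2 : ℂ) ^ ((n : ℤ) - 2 * m + 1)
            * ((m.factorial : ℂ) / ((n - m).factorial : ℂ))) (Y₁ c) ∧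
        (c ≠ 0 → PIV.HasAsymp 1 D (4 * n - 2 * m + 2)
          (fun θ => (1 / c + 2 * PIV.sqrtPi * PIV.Θ (θ - Real.pi / 2)) * (-1) ^ m
            * ((2 : ℂ) ^ (2 * (n : ℤ) - m + 1)
              / ((n.factorial : ℂ) * ((n - m).factorial : ℂ)))) (Y₁ c)) ∧
        (c = 0 → PIV.HasPureAsymp 1 (fun x => β / (2 * x)) P (Y₁ c)) ∧
        (1 + 2 * PIV.sqrtPi * c ≠ 0 → PIV.HasAsymp 2 P (2 * n - 4 * m)
          (fun _ => -(c / (1 + 2 * PIV.sqrtPi * c)) * (-1) ^ m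
            * (2 : ℂ) ^ ((n : ℤ) - 2 * m + 1)
            * ((m.factorial : ℂ) / ((n - m).factorial : ℂ))) (Y₁ c)) ∧
        (1 + 2 * PIV.sqrtPi * c = 0 → PIV.HasPureAsymp 2 (fun x => -(2 * x)) D (Y₁ c)) ∧
        (c ≠ 0 → PIV.HasAsymp 3 D (4 * n - 2 * m + 2)
          (fun θ => (1 / c + 2 * PIV.sqrtPi * PIV.Θ (3 * Real.pi / 2 - θ)) * (-1) ^ m
            * ((2 : ℂ) ^ (2 * (n : ℤ) - m + 1)
              / ((n.factorial : ℂ) * ((n - m).factorial : ℂ)))) (Y₁ c)) ∧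
        (c = 0 → PIV.HasPureAsymp 3 (fun x => β / (2 * x)) P (Y₁ c))) ∧
      -- first family, `c = ∞`
      PIV.HasPureAsymp 0 (fun x => -(2 * x)) D (Y₁ OnePoint.infty) ∧
      PIV.HasAsymp 1 D (4 * n - 2 * m + 2)
        (fun θ => 2 * PIV.sqrtPi * PIV.Θ (θ - Real.pi / 2) * (-1) ^ m
          * ((2 : ℂ) ^ (2 * (n : ℤ) - m + 1)
            / ((n.factorial : ℂ) * ((n - m).factorial : ℂ)))) (Y₁ OnePoint.infty) ∧
      PIV.HasAsymp 2 P (2 * n - 4 * m)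
        (fun _ => -(1 / (2 * PIV.sqrtPi)) * (-1) ^ m * (2 : ℂ) ^ ((n : ℤ) - 2 * m + 1)
          * ((m.factorial : ℂ) / ((n - m).factorial : ℂ))) (Y₁ OnePoint.infty) ∧
      PIV.HasAsymp 3 D (4 * n - 2 * m + 2)
        (fun θ => 2 * PIV.sqrtPi * PIV.Θ (3 * Real.pi / 2 - θ) * (-1) ^ m
          * ((2 : ℂ) ^ (2 * (n : ℤ) - m + 1)
            / ((n.factorial : ℂ) * ((n - m).factorial : ℂ)))) (Y₁ OnePoint.infty) ∧
      -- second family, finite values of the parameter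
      (1 ≤ m → ∀ c : ℂ,
        PIV.HasAsymp 0 M (2 * n + 2 * m)
          (fun θ => -(c + Complex.I * PIV.sqrtPi * PIV.Θ θ)
            * ((2 : ℂ) ^ (n + m + 1)
              / ((n.factorial : ℂ) * ((m - 1).factorial : ℂ)))) (Y₂ c) ∧
        (c + Complex.I * PIV.sqrtPi ≠ 0 → PIV.HasAsymp 1 P (4 * m - 2 * n - 2)
          (fun _ => 1 / (c + Complex.I * PIV.sqrtPi) * (-1) ^ m
            * (2 : ℂ) ^ (2 * (m : ℤ) - n - 1)
            * (((n - m).factorial : ℂ) / ((m - 1).factorial : ℂ))) (Y₂ c)) ∧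
        (c + Complex.I * PIV.sqrtPi = 0 →
          PIV.HasPureAsymp 1 (fun x => -(β / (2 * x))) M (Y₂ c)) ∧
        PIV.HasAsymp 2 M (2 * n + 2 * m)
          (fun θ => -(c + Complex.I * PIV.sqrtPi * PIV.Θ (Real.pi - θ))
            * ((2 : ℂ) ^ (n + m + 1)
              / ((n.factorial : ℂ) * ((m - 1).factorial : ℂ)))) (Y₂ c) ∧
        (c ≠ 0 → PIV.HasAsymp 3 P (4 * m - 2 * n - 2)
          (fun _ => 1 / c * (-1) ^ m * (2 : ℂ) ^ (2 * (m : ℤ) - n - 1)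
            * (((n - m).factorial : ℂ) / ((m - 1).factorial : ℂ))) (Y₂ c)) ∧
        (c = 0 → PIV.HasPureAsymp 3 (fun x => -(β / (2 * x))) M (Y₂ c))) ∧
      -- second family, `c = ∞`
      (1 ≤ m →
        PIV.HasPureAsymp 0 (fun x => β / (2 * x)) P (Y₂ OnePoint.infty) ∧
        PIV.HasPureAsymp 1 (fun x => β / (2 * x)) P (Y₂ OnePoint.infty) ∧
        PIV.HasPureAsymp 2 (fun x => β / (2 * x)) P (Y₂ OnePoint.infty) ∧
        PIV.HasPureAsymp 3 (fun x => β / (2 * x)) P (Y₂ OnePoint.infty)) ∧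
      -- for `m = 0` the second family degenerates to the trivial solution
      (m = 0 → ∀ c : OnePoint ℂ, Y₂ c = fun _ => 0) := by
  obtain ⟨l, rfl⟩ := Nat.exists_eq_add_of_le hmn
  have hα' : α = 1 / 2 + ((m : ℂ) + l) := by rw [hα]; push_cast; ring
  have hm : m + l - m = l := by omega
  rw [hm]
  have b0 : bgParam 0 = 0 := by simp [bgParam]
  have b1 : bgParam 1 = 0 := by simp [bgParam]
  have b2 : bgParam 2 = -2 * sqrtPi := by simp [bgParam]
  have b3 : bgParam 3 = -2 * sqrtPi := by simp [bgParam]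
  have b4 : bgParam 4 = 0 := by simp [bgParam]
  have b5 : bgParam 5 = 0 := by simp [bgParam]
  have hP := isBackground_rational hα' hβ
  have hD := isBackground_linear hα' hβ
  have j1 : IsJump 1 ((1 : ℤ) * (Real.pi / 2)) fun θ => -2 * sqrtPi * Θ (θ - Real.pi / 2) := by
    simpa using isJump_one (Real.pi / 2)
  have j3 : IsJump 3 ((3 : ℤ) * (Real.pi / 2))
      fun θ => -2 * sqrtPi * Θ (3 * Real.pi / 2 - θ) := by
    convert isJump_three (3 * Real.pi / 2) using 1
    push_cast; ring
  have hpi : sqrtPi ≠ 0 := by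
    simpa [sqrtPi] using (Real.sqrt_pos.2 Real.pi_pos).ne'
  have hsub : ∀ {k : ℤ} {L : ℂ → ℂ} {B : ℤ → ℂ → ℂ} {y : ℂ → ℂ}, IsBackground α β L B →
      y = B k → y = B (k + 1) → HasPureAsymp k L B y := fun {k L B y} hB h h' =>
    ⟨fun s t hs ht => h ▸ (hB k).2 s t (by linarith [Real.pi_pos]) ht, h, h'⟩
  -- for `m = 0` the background `-β/(2x)` and the second family are trivial, and `dual`, whose
  -- asymptotics need `m ≥ 1`, is not used
  refine ⟨fun _ => fam (fun _ => 0) m l,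
    fun j => if m = 0 then fun _ => 0 else dual (seed (bgParam (j + 1))) l m,
    fun j => fam (seed (bgParam j)) m l, fun c => fam (seedOne c) m l,
    fun c => if m = 0 then fun _ => 0 else dual (seedTwo c) l m,
    hP, ?_, hD, fun c => isClassical_seedOne hα' hβ c, ?_, injective_fam_seedOne m l, ?_, ?_,
    ?_, ?_, ?_, ?_, ?_, ?_, ?_⟩
  · by_cases hm0 : m = 0
    · subst hm0
      simp only [if_true]
      have := (hP 0).1
      rw [fam_zero_zero] at this
      exact fun j => ⟨this, fun s t _ _ => ⟨0, 0, fun r θ _ _ _ => ⟨0, by simp, by simp [hβ]⟩⟩⟩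
    · simp only [if_neg hm0]
      exact isBackground_dual (by rw [hα']; ring) hβ hm0
  · intro c
    rcases m with _ | p
    · have h := isClassical_seedOne hα' hβ (0 : ℂ)
      rw [seedOne_coe, if_pos rfl, fam_zero_zero] at h
      simpa using h
    · simp only [if_neg p.succ_ne_zero]
      exact isClassical_seedTwo (by rw [hα']; push_cast; ring) (by rw [hβ]; push_cast; ring) c
  · intro h1
    obtain ⟨p, rfl⟩ := Nat.exists_eq_add_of_le' h1
    simp only [if_neg p.succ_ne_zero]
    exact injective_dual_seedTwo l p
  · intro c
    simp only [seedOne_coe]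
    refine ⟨?_, fun hc => ?_, fun hc => ?_, fun hc => ?_, fun hc => ?_, fun hc => ?_, fun hc => ?_⟩
    · split_ifs with hc
      · exact hasAsymp_zero rfl rfl fun θ => by simp [hc]
      · exact hasAsymp_fam_real Even.zero (by simpa [b0] using hc) (by simp [b0]) m l
    · rw [if_neg hc]
      exact hasAsymp_fam_imag odd_one j1 _ m l fun θ => by ring
    · rw [if_pos hc]
      exact hsub hP rfl rfl
    · split_ifs with h0
      · exact hasAsymp_zero rfl rfl fun θ => by simp [h0]
      · have e : 1 / c - bgParam 2 = (1 + 2 * sqrtPi * c) / c := by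
          rw [b2]; field_simp; ring
        exact hasAsymp_fam_real even_two (by rw [e]; exact div_ne_zero hc h0)
          (by rw [e, one_div_div]) m l
    · have h0 : c ≠ 0 := fun h => by simp [h] at hc
      have e : 1 / c = -2 * sqrtPi := by
        field_simp; linear_combination hc
      rw [if_neg h0, e]
      exact hsub hD (by rw [b2]) (by rw [show (2 : ℤ) + 1 = 3 by norm_num, b3])
    · rw [if_neg hc]
      exact hasAsymp_fam_imag (by decide) j3 _ m l fun θ => by ring
    · rw [if_pos hc]
      exact hsub hP rfl rfl
  · exact hsub hD (by rw [b0]; rfl) (by rw [zero_add, b1]; rfl)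
  · exact hasAsymp_fam_imag odd_one j1 _ m l fun θ => by ring
  · exact hasAsymp_fam_real even_two (by simpa [b2] using hpi) (by rw [b2]; ring) m l
  · exact hasAsymp_fam_imag (by decide) j3 _ m l fun θ => by ring
  · intro h1 c
    obtain ⟨p, rfl⟩ := Nat.exists_eq_add_of_le' h1
    have hM := isBackground_dual (m := l) (l := p + 1) (α := α) (by rw [hα']; ring) hβ
      p.succ_ne_zero
    simp only [if_neg p.succ_ne_zero, seedTwo_coe, add_tsub_cancel_right, ← dual_zero]
    refine ⟨?_, fun h => ?_, fun h => ?_, ?_, fun h => ?_, fun h => ?_⟩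
    · refine hasAsymp_dual_real Even.zero (?_ : IsJump _ _
        fun θ => -2 * sqrtPi * Θ (θ - 0)) c l p fun θ => ?_
      · simpa using isJump_one 0
      · rw [sub_zero]
        linear_combination (-2 * sqrtPi * Θ θ) * Complex.I_sq
    · refine hasAsymp_dual_imag odd_one h ?_ l p
      rw [one_add_one_eq_two, b2]
      linear_combination (2 * sqrtPi) * Complex.I_sq
    · have e : -2 * Complex.I * c = -2 * sqrtPi := by
        linear_combination (-2 * Complex.I) * h + (2 * sqrtPi) * Complex.I_sq
      rw [e]
      exact hsub hM (by rw [one_add_one_eq_two, b2])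
        (by rw [one_add_one_eq_two, show (2 : ℤ) + 1 = 3 by norm_num, b3])
    · refine hasAsymp_dual_real even_two (?_ : IsJump _ _
        fun θ => -2 * sqrtPi * Θ (Real.pi - θ)) c l p fun θ => ?_
      · convert isJump_three Real.pi using 1
        push_cast; ring
      · linear_combination (-2 * sqrtPi * Θ (Real.pi - θ)) * Complex.I_sq
    · refine hasAsymp_dual_imag (by decide) h ?_ l p
      rw [show (3 : ℤ) + 1 = 4 by norm_num, b4, sub_zero]
    · rw [h, mul_zero]
      exact hsub hM (by rw [show (3 : ℤ) + 1 = 4 by norm_num, b4])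
        (by rw [show (3 : ℤ) + 1 + 1 = 5 by norm_num, b5])
  · intro h1
    obtain ⟨p, rfl⟩ := Nat.exists_eq_add_of_le' h1
    simp only [if_neg p.succ_ne_zero, seedTwo_infty, dual_zero]
    exact ⟨hsub hP rfl rfl, hsub hP rfl rfl, hsub hP rfl rfl, hsub hP rfl rfl⟩
  · intro h c
    exact if_pos h
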